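/- Let $k\ge 2$ and $n_1,\dots,n_k\ge 1$, let $\Omega_1\subset\mathbb R^{n_1}$ and $\Omega_2\subset\mathbb R^{n_2+\dots+n_k}$ be bounded open sets, $\Omega=\Omega_1\times\Omega_2\subset\mathbb R^N$, and write $x=(x_1,\dots,x_k)$ with $x_i\in\mathbb R^{n_i}$. Let $p_1=1<p_2\le\dots\le p_k<\infty$, $q\in[1,\infty]$, and let $p_i'$, $q'$ be the dual exponents. Let $$u\in BV^{(p_i)}(\Omega)\cap L^{\max(p_k,q)}(\Omega),\qquad BV^{(p_i)}(\Omega)=\{u\in BV(\Omega):\ D_{x_1}u\in\mathcal M(\Omega;\mathbb R^{n_1}),\ \nabla_{x_i}u\in L^{p_i}(\Omega;\mathbb R^{n_i}),\ i=2,\dots,k\},$$ and let $\mathbf z=(\mathbf z_1,\dots,\mathbf z_k)$ be a vector field with $\mathbf z_i\in L^{p_i'}(\Omega;\mathbb R^{n_i})$ for $i=1,\dots,k$ (so $\mathbf z_1\in L^\infty$) and distributional divergence $\mathrm{div}(\mathbf z)\in L^{q'}(\Omega)$. Define the distribution $(\mathbf z_1,D_{x_1}u)$ on $\Omega$ by $$\langle(\mathbf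 z_1,D_{x_1}u),\varphi\rangle=-\int_\Omega u\,\varphi\,\mathrm{div}(\mathbf z)\,dx-\int_\Omega u\,\mathbf z\cdot\nabla\varphi\,dx-\sum_{i=2}^k\int_\Omega\varphi\,\mathbf z_i\cdot\nabla_{x_i}u\,dx,\qquad\varphi\in C_c^\infty(\Omega).$$ A measurable function $\theta$, integrable with respect to $|D_{x_1}u|$, is called a density $\theta(\mathbf z_1,D_{x_1}u,\cdot)$ if $(\mathbf z_1,D_{x_1}u)$ is a finite signed measure on $\Omega$ and $\int_B(\mathbf z_1,D_{x_1}u)=\int_B\theta\,d|D_{x_1}u|$ for all Borel sets $B\subseteq\Omega$. Let $T:\mathbb R\to\mathbb R$ be Lipschitz and nondecreasing (for instance strictly increasing). Then $T\circ u$ also belongs to $BV^{(p_i)}(\Omega)\cap L^{\max(p_k,q)}(\Omega)$; a density $\theta(\mathbf z_1,D_{x_1}u,\cdot)$ exists; every density $\theta(\mathbf z_1,D_{x_1}u,\cdot)$ is also a density $\theta(\mathbf z_1,D_{x_1}(T\circ u),\cdot)$ of $(\mathbf z_1,D_{x_1}(T\circ u))$ with respect to $|D_{x_1}(T\circ u)|$;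 and for any two such densities $$\theta(\mathbf z_1,D_{x_1}(T\circ u),x)=\theta(\mathbf z_1,D_{x_1}u,x)\qquad\text{for }|D_{x_1}(T\circ u)|\text{-a.e. }x\in\Omega.$$ If moreover $T'(t)>0$ for almost every $t\in\mathbb R$, this equality holds for $|D_{x_1}u|$-a.e. $x\in\Omega$, whatever versions of the densities are chosen. -/

import Mathlib

open MeasureTheory Set Filter
open scoped ENNReal NNReal ContDiff RealInnerProductSpace

noncomputable section

namespace AnisoPairing

/-- Smooth functions with compact support in `Ω`. -/
structure IsTest {E : Type*} [NormedAddCommGroup E] [NormedSpace ℝ E]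
    (Ω : Set E) (φ : E → ℝ) : Prop where
  smooth : ContDiff ℝ ∞ φ
  compact : HasCompactSupport φ
  supp : tsupport φ ⊆ Ω

/-! Throughout, a group of coordinates indexed by `κ` inside `EuclideanSpace ℝ ι` is given by
a map `e : κ → ι`. -/

/-- The components of `v` in the coordinates `e`. -/
def block {ι κ : Type*} (e : κ → ι) (v : EuclideanSpace ℝ ι) : EuclideanSpace ℝ κ :=
  WithLp.toLp 2 (fun j => v (e j))

/-- The classical partial gradient of `φ` in the coordinates `e`. -/
def partialGrad {ι κ : Type*} [Fintype ι] [DecidableEq ι] (e : κ → ι)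
    (φ : EuclideanSpace ℝ ι → ℝ) (x : EuclideanSpace ℝ ι) : EuclideanSpace ℝ κ :=
  WithLp.toLp 2 (fun j => fderiv ℝ φ x (EuclideanSpace.single (e j) 1))

/-- `μ` is a vector measure on `Ω` which is the distributional gradient of `u` on `Ω`
in the coordinates `e`. -/
structure IsGradMeasure {ι κ : Type*} [Fintype ι] [DecidableEq ι] [Fintype κ]
    (Ω : Set (EuclideanSpace ℝ ι)) (e : κ → ι) (u : EuclideanSpace ℝ ι → ℝ)
    (μ : VectorMeasure (EuclideanSpace ℝ ι) (EuclideanSpace ℝ κ)) : Prop where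
  concentrated : ∀ B, MeasurableSet B → Disjoint B Ω → μ B = 0
  byParts : ∀ φ, IsTest Ω φ → ∫ᵛ x, φ x ∂•μ = - ∫ x in Ω, u x • partialGrad e φ x

/-- `g` is a locally integrable function on `Ω` which is the distributional gradient of `u`
on `Ω` in the coordinates `e`. -/
structure IsWeakGrad {ι κ : Type*} [Fintype ι] [DecidableEq ι] [Fintype κ]
    (Ω : Set (EuclideanSpace ℝ ι)) (e : κ → ι) (u : EuclideanSpace ℝ ι → ℝ)
    (g : EuclideanSpace ℝ ι → EuclideanSpace ℝ κ) : Prop where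
  locInt : LocallyIntegrableOn g Ω
  byParts : ∀ φ, IsTest Ω φ → ∫ x in Ω, φ x • g x = - ∫ x in Ω, u x • partialGrad e φ x

/-- `g` is a locally integrable function on `Ω` which is the distributional divergence of `z`;
here `fderiv ℝ φ x (z x)` is `z x · ∇ φ x`. -/
structure IsWeakDiv {ι : Type*} [Fintype ι] (Ω : Set (EuclideanSpace ℝ ι))
    (z : EuclideanSpace ℝ ι → EuclideanSpace ℝ ι) (g : EuclideanSpace ℝ ι → ℝ) : Prop where
  locInt : LocallyIntegrableOn g Ω
  byParts : ∀ φ, IsTest Ω φ → ∫ x in Ω, φ x * g x = - ∫ x in Ω, fderiv ℝ φ x (z x)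

open Classical in
/-- The vector measure which is the distributional gradient in the coordinates `e`
(it is unique when it exists; `0` when there is none). -/
def gradMeasure {ι κ : Type*} [Fintype ι] [DecidableEq ι] [Fintype κ]
    (Ω : Set (EuclideanSpace ℝ ι)) (e : κ → ι) (u : EuclideanSpace ℝ ι → ℝ) :
    VectorMeasure (EuclideanSpace ℝ ι) (EuclideanSpace ℝ κ) :=
  if h : ∃ μ, IsGradMeasure Ω e u μ then h.choose else 0

open Classical in
/-- The weak gradient in the coordinates `e` (unique almost everywhere on `Ω` when it exists;
`0` when there is none). -/
def weakGrad {ι κ : Type*} [Fintype ι] [DecidableEq ι] [Fintype κ]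
    (Ω : Set (EuclideanSpace ℝ ι)) (e : κ → ι) (u : EuclideanSpace ℝ ι → ℝ) :
    EuclideanSpace ℝ ι → EuclideanSpace ℝ κ :=
  if h : ∃ g, IsWeakGrad Ω e u g then h.choose else 0

open Classical in
/-- The weak divergence (unique almost everywhere on `Ω` when it exists; `0` when there is
none). -/
def weakDiv {ι : Type*} [Fintype ι] (Ω : Set (EuclideanSpace ℝ ι))
    (z : EuclideanSpace ℝ ι → EuclideanSpace ℝ ι) : EuclideanSpace ℝ ι → ℝ :=
  if h : ∃ g, IsWeakDiv Ω z g then h.choose else 0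

/-- Indices of the coordinates of `ℝ^N`, `N = n₁ + n₂ + ⋯ + n_k`: the coordinates of `x₁` are
the left summand, those of `(x₂, …, x_k)` are the right summand. The directions `x₂, …, x_k`
are indexed by `Fin m`, `m = k - 1`. -/
abbrev Coord (n₁ : ℕ) {m : ℕ} (n : Fin m → ℕ) : Type := Fin n₁ ⊕ (Σ i : Fin m, Fin (n i))

/-- `ℝ^N`. -/
abbrev Space (n₁ : ℕ) {m : ℕ} (n : Fin m → ℕ) : Type := EuclideanSpace ℝ (Coord n₁ n)

/-- The coordinates of `x₁`. -/
abbrev dir₁ (n₁ : ℕ) {m : ℕ} (n : Fin m → ℕ) : Fin n₁ → Coord n₁ n := Sum.inl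

/-- The coordinates of `x_i` for one of the remaining directions. -/
abbrev dir (n₁ : ℕ) {m : ℕ} (n : Fin m → ℕ) (i : Fin m) : Fin (n i) → Coord n₁ n :=
  fun j => Sum.inr ⟨i, j⟩

/-- The set `Ω₁ × Ω₂` in `ℝ^N`. -/
def prodDomain {n₁ m : ℕ} {n : Fin m → ℕ} (Ω₁ : Set (EuclideanSpace ℝ (Fin n₁)))
    (Ω₂ : Set (EuclideanSpace ℝ (Σ i : Fin m, Fin (n i)))) : Set (Space n₁ n) :=
  {x | block Sum.inl x ∈ Ω₁ ∧ block Sum.inr x ∈ Ω₂}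

/-- `u ∈ BV(Ω)`. -/
structure MemBV {ι : Type*} [Fintype ι] [DecidableEq ι] (Ω : Set (EuclideanSpace ℝ ι))
    (u : EuclideanSpace ℝ ι → ℝ) : Prop where
  memLp : MemLp u 1 (volume.restrict Ω)
  exists_grad : ∃ μ : VectorMeasure (EuclideanSpace ℝ ι) (EuclideanSpace ℝ ι),
    IsGradMeasure Ω id u μ

/-- The anisotropic space `BV^{(p_i)}(Ω)` with `p₁ = 1`; `p` lists `p₂, …, p_k`. -/
structure MemAnisoBV {n₁ m : ℕ} {n : Fin m → ℕ} (Ω : Set (Space n₁ n)) (p : Fin m → ℝ≥0∞)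
    (u : Space n₁ n → ℝ) : Prop where
  memBV : MemBV Ω u
  exists_grad₁ : ∃ μ, IsGradMeasure Ω (dir₁ n₁ n) u μ
  exists_grad : ∀ i, ∃ g, MemLp g (p i) (volume.restrict Ω) ∧ IsWeakGrad Ω (dir n₁ n i) u g

/-- The space `X^{(p_i')}_r(Ω)` of vector fields `z = (z₁, …, z_k)` with `z_i ∈ L^{p_i'}`
(so `z₁ ∈ L^∞`) and distributional divergence in `L^r`. -/
structure MemX {n₁ m : ℕ} {n : Fin m → ℕ} (Ω : Set (Space n₁ n)) (p : Fin m → ℝ≥0∞)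
    (r : ℝ≥0∞) (z : Space n₁ n → Space n₁ n) : Prop where
  memLp₁ : MemLp (fun x => block (dir₁ n₁ n) (z x)) (⊤ : ℝ≥0∞) (volume.restrict Ω)
  memLp : ∀ i, MemLp (fun x => block (dir n₁ n i) (z x)) (p i).conjExponent (volume.restrict Ω)
  exists_div : ∃ g, MemLp g r (volume.restrict Ω) ∧ IsWeakDiv Ω z g

/-- The joint condition `u ∈ BV^{(p_i)}(Ω) ∩ L^{max(p_k,q)}(Ω)` and `z ∈ X^{(p_i')}_{q'}(Ω)`. -/
structure Admissible {n₁ m : ℕ} {n : Fin (m + 1) → ℕ} (Ω : Set (Space n₁ n))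
    (p : Fin (m + 1) → ℝ≥0∞) (q : ℝ≥0∞) (u : Space n₁ n → ℝ) (z : Space n₁ n → Space n₁ n) :
    Prop where
  memBV : MemAnisoBV Ω p u
  memLp : MemLp u (max (p (Fin.last m)) q) (volume.restrict Ω)
  memX : MemX Ω p q.conjExponent z

/-- The pairing `⟨(z, Du), φ⟩`. -/
def pairing {ι : Type*} [Fintype ι] (Ω : Set (EuclideanSpace ℝ ι))
    (z : EuclideanSpace ℝ ι → EuclideanSpace ℝ ι) (u φ : EuclideanSpace ℝ ι → ℝ) : ℝ :=
  - (∫ x in Ω, u x * φ x * weakDiv Ω z x) - ∫ x in Ω, u x * fderiv ℝ φ x (z x)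

/-- The pairing `⟨(z₁, D_{x₁}u), φ⟩`. -/
def pairing₁ {n₁ m : ℕ} {n : Fin m → ℕ} (Ω : Set (Space n₁ n))
    (z : Space n₁ n → Space n₁ n) (u φ : Space n₁ n → ℝ) : ℝ :=
  pairing Ω z u φ -
    ∑ i, ∫ x in Ω, φ x * ⟪block (dir n₁ n i) (z x), weakGrad Ω (dir n₁ n i) u x⟫

/-- The signed measure `σ` on `Ω` is the distribution `(z₁, D_{x₁}u)`. -/
structure IsPairingMeasure {n₁ m : ℕ} {n : Fin m → ℕ} (Ω : Set (Space n₁ n))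
    (z : Space n₁ n → Space n₁ n) (u : Space n₁ n → ℝ) (σ : SignedMeasure (Space n₁ n)) :
    Prop where
  concentrated : ∀ B, MeasurableSet B → Disjoint B Ω → σ B = 0
  eq_pairing : ∀ φ, IsTest Ω φ → ∫ᵛ x, φ x ∂•σ = pairing₁ Ω z u φ

/-- The total variation measure `|D_{x₁}u|` on `Ω`. -/
def absGrad₁ {n₁ m : ℕ} {n : Fin m → ℕ} (Ω : Set (Space n₁ n)) (u : Space n₁ n → ℝ) :
    Measure (Space n₁ n) :=
  (gradMeasure Ω (dir₁ n₁ n) u).variation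

/-- `θ` is (a version of) the Radon–Nikodym density `θ(z₁, D_{x₁}u, ·)` of the measure
`(z₁, D_{x₁}u)` with respect to `|D_{x₁}u|`. -/
structure IsPairingDensity {n₁ m : ℕ} {n : Fin m → ℕ} (Ω : Set (Space n₁ n))
    (z : Space n₁ n → Space n₁ n) (u : Space n₁ n → ℝ) (θ : Space n₁ n → ℝ) : Prop where
  measurable : Measurable θ
  integrable : Integrable θ (absGrad₁ Ω u)
  density : ∃ σ, IsPairingMeasure Ω z u σ ∧
    ∀ B, MeasurableSet B → σ B = ∫ x in B, θ x ∂(absGrad₁ Ω u)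

end AnisoPairing

end

noncomputable section

namespace AnisoPairing

/-! ### Test functions: pointwise inequalities and densities from integrated bounds. -/

section TestFunctions

variable {E : Type*} [NormedAddCommGroup E] [NormedSpace ℝ E]

/-! Write `D_{x₁}u = f μ` with `μ` a finite measure, so that `|D_{x₁}u| = |f| μ`. No fine structure
of BV functions is used: both the chain rule and the behaviour of the pairing come from integrated
inequalities, turned into pointwise ones by `ae_abs_le_of_integral_test_le`.

Chain rule. Mollification gives `|∫ T(u) ∂_v φ| ≤ K ∫ |φ| d|D_v u|` for `K`-Lipschitz `T`, hence a
bounded density of `D_v(T ∘ u)` with respect to `|D_v u|`. Using this in every direction `v` forces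
`D_{x₁}(T ∘ u)` to be parallel to `f`, so it equals `a f μ` with `|a| ≤ K` (`HasGrad.exists_comp`).
For monotone `T`, applying this to `T - (K/2) id` gives `0 ≤ a ≤ K`.

Pairing. Testing `div z` against a mollification of `w` times `φ` gives `|⟨(z₁, D_{x₁}w), φ⟩| ≤ Z ∫
|φ| d|D_{x₁}w|` with `Z` a bound for `|z₁|` (`abs_coordPairing_le`). So the pairings of `u` and `T ∘
u` have densities `s` and `t` with respect to `|f| μ`. The pairing is linear in `w` and `D_{x₁}(T ∘
u - c u) = (a - c) f μ`, so `|t - c s| ≤ Z |a - c|` almost everywhere for all rational `c`. Letting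
`c` tend to `a(x)` gives `t = a s` (`IsPairable.eq_integral_mul`). Since `a ≥ 0`, the pairing
measure of `T ∘ u` is `s a |f| μ = s |D_{x₁}(T ∘ u)|`: the density is unchanged.

Positivity. It remains to see that `a ≠ 0` almost everywhere on `{f ≠ 0}` when `T' > 0` a.e.
(`HasGrad.ae_ne_zero_of_deriv_pos`). Let `A_n = {(n+1) T' < 1}` and split the identity as `R_n +
S_n`, the primitives of the indicators of `A_n` and of its complement. As `(n+1) T - S_n` is
monotone, the density of `S_n ∘ u` is at most `(n+1) a`. Where `a = 0` it therefore vanishes, and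
that of `R_n ∘ u` is `1` for every `n`. But `R_n → 0`, so the densities of `R_n ∘ u` tend to `0`
where `f ≠ 0`. -/

theorem IsTest.add {Ω : Set E} {φ ψ : E → ℝ} (hφ : IsTest Ω φ) (hψ : IsTest Ω ψ) :
    IsTest Ω (fun x => φ x + ψ x) where
  smooth := hφ.smooth.add hψ.smooth
  compact := hφ.compact.add hψ.compact
  supp := (tsupport_add φ ψ).trans (union_subset hφ.supp hψ.supp)

theorem IsTest.const_mul {Ω : Set E} {φ : E → ℝ} (hφ : IsTest Ω φ) (c : ℝ) :
    IsTest Ω (fun x => c * φ x) where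
  smooth := contDiff_const.mul hφ.smooth
  compact := hφ.compact.mul_left
  supp := (tsupport_mul_subset_right (f := fun _ => c) (g := φ)).trans hφ.supp

theorem IsTest.mul_left {Ω : Set E} {φ w : E → ℝ} (hφ : IsTest Ω φ) (hw : ContDiff ℝ ∞ w) :
    IsTest Ω (fun x => w x * φ x) where
  smooth := hw.mul hφ.smooth
  compact := hφ.compact.mul_left
  supp := (tsupport_mul_subset_right (f := w) (g := φ)).trans hφ.supp

theorem IsTest.continuous {Ω : Set E} {φ : E → ℝ} (hφ : IsTest Ω φ) : Continuous φ :=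
  hφ.smooth.continuous

theorem IsTest.exists_bound {Ω : Set E} {φ : E → ℝ} (hφ : IsTest Ω φ) :
    ∃ C, ∀ x, ‖φ x‖ ≤ C := hφ.compact.exists_bound_of_continuous hφ.continuous

theorem IsTest.fderiv_apply {Ω : Set E} {φ : E → ℝ} (hφ : IsTest Ω φ) (v : E) :
    IsTest Ω (fun x => fderiv ℝ φ x v) where
  smooth := (hφ.smooth.fderiv_right (m := ∞) (by norm_cast)).clm_apply contDiff_const
  compact := hφ.compact.fderiv_apply ℝ v
  supp := (tsupport_fderiv_apply_subset ℝ v).trans hφ.supp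

theorem IsTest.eq_zero {Ω : Set E} {φ : E → ℝ} (hφ : IsTest Ω φ) {x : E} (hx : x ∉ Ω) :
    φ x = 0 := image_eq_zero_of_notMem_tsupport fun h => hx (hφ.supp h)

theorem IsTest.integrable_mul [MeasurableSpace E] [BorelSpace E] [SecondCountableTopology E]
    {Ω : Set E} {φ : E → ℝ}
    (hφ : IsTest Ω φ) {μ : Measure E} {f : E → ℝ} (hf : Integrable f μ) :
    Integrable (fun x => φ x * f x) μ := by
  obtain ⟨C, hC⟩ := hφ.exists_bound
  exact hf.bdd_mul hφ.continuous.aestronglyMeasurable (ae_of_all _ hC)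

theorem IsTest.integrable [MeasurableSpace E] [BorelSpace E] {Ω : Set E} {φ : E → ℝ}
    (hφ : IsTest Ω φ) {μ : Measure E} [IsFiniteMeasureOnCompacts μ] : Integrable φ μ :=
  hφ.continuous.integrable_of_hasCompactSupport hφ.compact

variable [FiniteDimensional ℝ E] [MeasurableSpace E] [BorelSpace E]

/-- The integral over a compact set is a limit of integrals against test functions. -/
theorem exists_isTest_tendsto_setIntegral {Ω s : Set E} (hΩ : IsOpen Ω) (hs : IsCompact s)
    (hsΩ : s ⊆ Ω) {μ : Measure E} {f : E → ℝ} (hf : Integrable f μ) :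
    ∃ φ : ℕ → E → ℝ, (∀ n, IsTest Ω (φ n)) ∧ (∀ n x, 0 ≤ φ n x) ∧
      Tendsto (fun n => ∫ x, φ n x * f x ∂μ) atTop (nhds (∫ x in s, f x ∂μ)) := by
  obtain ⟨δ, δpos, hδ⟩ := hs.exists_cthickening_subset_open hΩ hsΩ
  obtain ⟨u, -, u_pos, u_lim⟩ : ∃ u, StrictAnti u ∧ (∀ (n : ℕ), u n ∈ Ioo 0 δ)
    ∧ Tendsto u atTop (nhds 0) := exists_seq_strictAnti_tendsto' δpos
  have : ∀ n, ∃ (g : E → ℝ), Function.support g = Metric.thickening (u n) s ∧ ContDiff ℝ ∞ g ∧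
      Set.range g ⊆ Set.Icc 0 1 ∧ ∀ x ∈ s, g x = 1 := by
    intro n
    rcases exists_contMDiff_support_eq_eq_one_iff (modelWithCornersSelf ℝ E)
      Metric.isOpen_thickening hs.isClosed
      (Metric.self_subset_thickening (u_pos n).1 s) with ⟨g, g_smooth, g_range, g_supp, hg⟩
    exact ⟨g, g_supp, g_smooth.contDiff, g_range, fun x hx ↦ (hg x).1 hx⟩
  choose g g_supp g_diff g_range hg using this
  have g0 : ∀ n x, 0 ≤ g n x := fun n x => (g_range n (mem_range_self x)).1
  have g1 : ∀ n x, g n x ≤ 1 := fun n x => (g_range n (mem_range_self x)).2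
  have hts : ∀ n, tsupport (g n) ⊆ Metric.cthickening δ s := fun n => by
    rw [tsupport, g_supp]
    exact (Metric.closure_thickening_subset_cthickening _ _).trans
      (Metric.cthickening_mono (u_pos n).2.le s)
  have hK : IsCompact (Metric.cthickening δ s) := hs.cthickening
  refine ⟨g, fun n => ⟨g_diff n, hK.of_isClosed_subset (isClosed_tsupport _) (hts n),
    (hts n).trans hδ⟩, g0, ?_⟩
  rw [← integral_indicator hs.measurableSet]
  refine tendsto_integral_of_dominated_convergence (fun x => ‖f x‖)
    (fun n ↦ (g_diff n).continuous.aestronglyMeasurable.mul hf.aestronglyMeasurable) hf.norm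
    (fun n => ae_of_all _ fun x => ?_) (ae_of_all _ fun x => ?_)
  · rw [norm_mul, Real.norm_of_nonneg (g0 n x)]
    exact mul_le_of_le_one_left (norm_nonneg _) (g1 n x)
  · by_cases hxs : x ∈ s
    · simp [fun n ↦ hg n x hxs, indicator_of_mem hxs f]
    · simp_rw [indicator_of_notMem hxs f]
      apply tendsto_const_nhds.congr'
      suffices H : ∀ᶠ n in atTop, g n x = 0 by
        filter_upwards [H] with n hn using by simp [hn]
      obtain ⟨ε, εpos, hε⟩ : ∃ ε, 0 < ε ∧ x ∉ Metric.thickening ε s := by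
        rw [← hs.isClosed.closure_eq, Metric.closure_eq_iInter_thickening s] at hxs
        simpa using hxs
      filter_upwards [(tendsto_order.1 u_lim).2 _ εpos] with n hn
      rw [← Function.notMem_support, g_supp]
      contrapose hε
      exact Metric.thickening_mono hn.le s hε

/-- If `f` were negative on a set of positive measure in `Ω`, inner regularity would give a compact
set of positive measure there, and test functions decreasing to it would have a negative integral in
the limit. -/
theorem ae_nonneg_of_integral_test_nonneg {Ω : Set E} (hΩ : IsOpen Ω) {μ : Measure E}
    [IsFiniteMeasure μ] {f : E → ℝ} (hf : Integrable f μ)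
    (h : ∀ φ, IsTest Ω φ → (∀ x, 0 ≤ φ x) → 0 ≤ ∫ x, φ x * f x ∂μ) :
    ∀ᵐ x ∂μ, x ∈ Ω → 0 ≤ f x := by
  obtain ⟨f', hf'm, hff'⟩ := hf.aestronglyMeasurable
  have hf' : Integrable f' μ := hf.congr hff'
  set A : Set E := {x | f' x < 0} ∩ Ω with hA
  have hAm : MeasurableSet A :=
    (measurableSet_lt hf'm.measurable measurable_const).inter hΩ.measurableSet
  have hA0 : μ A = 0 := by
    by_contra hne
    obtain ⟨s, hsA, hs, hs0⟩ :=
      hAm.exists_lt_isCompact (μ := μ) (r := 0) (pos_iff_ne_zero.2 hne)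
    obtain ⟨φ, hφ, hφ0, hlim⟩ :=
      exists_isTest_tendsto_setIntegral hΩ hs (hsA.trans inter_subset_right) hf'
    have h1 : 0 ≤ ∫ x in s, f' x ∂μ := by
      refine ge_of_tendsto' hlim fun n => ?_
      rw [integral_congr_ae (g := fun x => φ n x * f x)]
      · exact h _ (hφ n) (hφ0 n)
      · filter_upwards [hff'] with x hx
        simp [hx]
    -- A positive function with zero integral: the set `s` must be null.
    have h2 : ∫ x in s, (-f' x) ∂μ = 0 := by
      refine le_antisymm (by rw [integral_neg]; linarith) ?_
      exact setIntegral_nonneg hs.measurableSet fun x hx => by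
        have := (hsA hx).1
        simp only [mem_ofPred_eq] at this
        linarith
    rw [setIntegral_eq_zero_iff_of_nonneg_ae] at h2
    · have h3 : μ.restrict s univ = 0 := by
        refine measure_mono_null ?_ (ae_iff.1 (h2.and (ae_restrict_mem hs.measurableSet)))
        intro x _ hx
        have := (hsA hx.2).1
        simp only [mem_ofPred_eq] at this
        have h4 := hx.1
        simp only [Pi.zero_apply] at h4
        linarith
      rw [Measure.restrict_apply_univ] at h3
      exact hs0.ne' h3
    · filter_upwards [ae_restrict_mem hs.measurableSet] with x hx
      have := (hsA hx).1
      simp only [mem_ofPred_eq] at this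
      simp only [Pi.zero_apply]
      linarith
    · exact hf'.neg.integrableOn
  filter_upwards [hff', measure_eq_zero_iff_ae_notMem.1 hA0] with x hx hxA hxΩ
  rw [hx]
  by_contra hlt
  exact hxA ⟨not_le.1 hlt, hxΩ⟩

/-- The device that localizes every estimate below: apply the sign criterion to `k - f` and `k + f`.
-/
theorem ae_abs_le_of_integral_test_le {Ω : Set E} (hΩ : IsOpen Ω) {μ : Measure E}
    [IsFiniteMeasure μ] (hμ : μ Ωᶜ = 0) {f k : E → ℝ} (hf : Integrable f μ) (hk : Integrable k μ)
    (h : ∀ φ, IsTest Ω φ → |∫ x, φ x * f x ∂μ| ≤ ∫ x, |φ x| * k x ∂μ) :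
    ∀ᵐ x ∂μ, |f x| ≤ k x := by
  have key : ∀ φ, IsTest Ω φ → (∀ x, 0 ≤ φ x) →
      |∫ x, φ x * f x ∂μ| ≤ ∫ x, φ x * k x ∂μ := fun φ hφ h0 => by
    simpa only [abs_of_nonneg (h0 _)] using h φ hφ
  have h1 : ∀ᵐ x ∂μ, x ∈ Ω → 0 ≤ k x - f x := by
    refine ae_nonneg_of_integral_test_nonneg hΩ (hk.sub hf) fun φ hφ h0 => ?_
    simp_rw [mul_sub]
    rw [integral_sub (hφ.integrable_mul hk) (hφ.integrable_mul hf)]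
    linarith [(abs_le.1 (key φ hφ h0)).2]
  have h2 : ∀ᵐ x ∂μ, x ∈ Ω → 0 ≤ k x + f x := by
    refine ae_nonneg_of_integral_test_nonneg hΩ (hk.add hf) fun φ hφ h0 => ?_
    simp_rw [mul_add]
    rw [integral_add (hφ.integrable_mul hk) (hφ.integrable_mul hf)]
    linarith [(abs_le.1 (key φ hφ h0)).1]
  filter_upwards [h1, h2, measure_eq_zero_iff_ae_notMem.1 hμ] with x hx1 hx2 hx3
  have hx : x ∈ Ω := by simpa using hx3
  rw [abs_le]
  constructor <;> linarith [hx1 hx, hx2 hx]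

theorem ae_eq_of_integral_test_eq {Ω : Set E} (hΩ : IsOpen Ω) {μ : Measure E}
    [IsFiniteMeasure μ] (hμ : μ Ωᶜ = 0) {f g : E → ℝ} (hf : Integrable f μ) (hg : Integrable g μ)
    (h : ∀ φ, IsTest Ω φ → ∫ x, φ x * f x ∂μ = ∫ x, φ x * g x ∂μ) : f =ᵐ[μ] g := by
  have := ae_abs_le_of_integral_test_le hΩ hμ (hf.sub hg) (integrable_zero E ℝ μ)
    fun φ hφ => by
      simp only [Pi.sub_apply, mul_sub]
      rw [integral_sub (hφ.integrable_mul hf) (hφ.integrable_mul hg), h φ hφ]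
      simp
  filter_upwards [this] with x hx
  have := abs_nonpos_iff.1 hx
  simpa [sub_eq_zero] using this

/-- A linear functional on test functions dominated by `C ∫ |φ| dμ` has a density bounded by `C`
with respect to `μ`. -/
theorem exists_density_of_abs_le {Ω : Set E} (hΩ : IsOpen Ω) {μ : Measure E}
    [IsFiniteMeasure μ] (hμ : μ Ωᶜ = 0) (L : (E → ℝ) → ℝ) {C : ℝ} (hC : 0 ≤ C)
    (hadd : ∀ φ ψ, IsTest Ω φ → IsTest Ω ψ → L (fun x => φ x + ψ x) = L φ + L ψ)
    (hmul : ∀ c φ, IsTest Ω φ → L (fun x => c * φ x) = c * L φ)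
    (hL : ∀ φ, IsTest Ω φ → |L φ| ≤ C * ∫ x, |φ x| ∂μ) :
    ∃ g : E → ℝ, Measurable g ∧ (∀ x, |g x| ≤ C) ∧
      ∀ φ, IsTest Ω φ → L φ = ∫ x, φ x * g x ∂μ := by
  let V : Submodule ℝ (E → ℝ) :=
    { carrier := {φ | IsTest Ω φ}
      add_mem' := fun h1 h2 => h1.add h2
      zero_mem' := ⟨contDiff_const, HasCompactSupport.zero, by simp [tsupport]⟩
      smul_mem' := fun c φ h => h.const_mul c }
  have hmem : ∀ φ, IsTest Ω φ → MemLp φ 2 μ := fun φ hφ =>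
    hφ.continuous.memLp_of_hasCompactSupport hφ.compact
  let J : V →ₗ[ℝ] Lp ℝ 2 μ :=
    { toFun := fun φ => (hmem φ.1 φ.2).toLp φ.1
      map_add' := fun φ ψ => MemLp.toLp_add (hmem φ.1 φ.2) (hmem ψ.1 ψ.2)
      map_smul' := fun c φ => MemLp.toLp_const_smul c (hmem φ.1 φ.2) }
  let L' : V →ₗ[ℝ] ℝ :=
    { toFun := fun φ => L φ.1
      map_add' := fun φ ψ => hadd _ _ φ.2 ψ.2
      map_smul' := fun c φ => hmul c _ φ.2 }
  have hJ : ∀ φ : V, (J φ : E → ℝ) =ᵐ[μ] φ.1 := fun φ => MemLp.coeFn_toLp (hmem φ.1 φ.2)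
  have : Module.Free ℝ (LinearMap.range J) := Module.Free.of_divisionRing ℝ _
  have : Module.Projective ℝ (LinearMap.range J) := Module.Projective.of_free
  -- `L` is defined on functions, not on classes in `L²(μ)`. A linear section of `J` transports it
  -- to the range of `J`; the bound on `L` shows that it ignores functions vanishing `μ`-a.e., so
  -- the choice of section is immaterial.
  obtain ⟨s, hs⟩ := J.rangeRestrict.exists_rightInverse_of_surjective
    (LinearMap.range_eq_top.2 J.surjective_rangeRestrict)
  have hJs : ∀ y, J (s y) = y := fun y => congrArg Subtype.val (LinearMap.congr_fun hs y)
  have hLs : ∀ φ : V, L' (s (J.rangeRestrict φ)) = L' φ := fun φ => by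
    rw [← sub_eq_zero, ← map_sub, ← abs_nonpos_iff]
    refine (hL _ (s (J.rangeRestrict φ) - φ).2).trans (le_of_eq ?_)
    rw [integral_eq_zero_of_ae, mul_zero]
    have h1 : J (s (J.rangeRestrict φ) - φ) = 0 := by rw [map_sub, hJs]; simp
    have h2 := hJ (s (J.rangeRestrict φ) - φ)
    rw [h1] at h2
    filter_upwards [h2, Lp.coeFn_zero ℝ 2 μ] with x hx hx'
    rw [← hx, hx']
    simp
  let ℓ : LinearMap.range J →ₗ[ℝ] ℝ := L'.comp s
  have hℓ : ∀ y, ‖ℓ y‖ ≤ (C * (μ univ ^ (1 / (1 : ℝ≥0∞).toReal - 1 / (2 : ℝ≥0∞).toReal)).toReal)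
      * ‖y‖ := fun y => by
    refine (hL _ (s y).2).trans ?_
    rw [mul_assoc]
    refine mul_le_mul_of_nonneg_left ?_ hC
    have h1 : eLpNorm (s y).1 1 μ ≤ eLpNorm (s y).1 2 μ *
        μ univ ^ (1 / (1 : ℝ≥0∞).toReal - 1 / (2 : ℝ≥0∞).toReal) :=
      eLpNorm_le_eLpNorm_mul_rpow_measure_univ (by norm_num)
        (hmem _ (s y).2).aestronglyMeasurable
    have h2 : ‖y‖ = (eLpNorm (s y).1 2 μ).toReal := by
      rw [Submodule.coe_norm, ← hJs y]
      exact Lp.norm_toLp _ (hmem _ (s y).2)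
    have h3 : ∫ x, |(s y).1 x| ∂μ = (eLpNorm (s y).1 1 μ).toReal := by
      have := (hmem _ (s y).2).integrable (by norm_num)
      rw [eLpNorm_one_eq_lintegral_enorm, ← integral_norm_eq_lintegral_enorm
        this.aestronglyMeasurable]
      rfl
    rw [h2, h3, mul_comm, ← ENNReal.toReal_mul]
    refine ENNReal.toReal_mono ?_ h1
    refine ENNReal.mul_ne_top (hmem _ (s y).2).eLpNorm_ne_top ?_
    refine (ENNReal.rpow_lt_top_of_nonneg ?_ (measure_ne_top _ _)).ne
    norm_num
  -- Hahn–Banach extends the functional to all of `L²(μ)`, and the Riesz representation yields the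
  -- density.
  obtain ⟨G, hG, -⟩ := exists_extension_norm_eq (𝕜 := ℝ) (LinearMap.range J) (ℓ.mkContinuous _ hℓ)
  let g₀ : Lp ℝ 2 μ := (InnerProductSpace.toDual ℝ (Lp ℝ 2 μ)).symm G
  have hg₀ : ∀ φ, IsTest Ω φ → L φ = ∫ x, φ x * g₀ x ∂μ := fun φ hφ => by
    have h1 : G (J ⟨φ, hφ⟩) = L φ :=
      (hG (J.rangeRestrict ⟨φ, hφ⟩)).trans (hLs ⟨φ, hφ⟩)
    rw [← h1, ← InnerProductSpace.toDual_symm_apply, L2.inner_def]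
    refine integral_congr_ae ?_
    filter_upwards [hJ ⟨φ, hφ⟩] with x hx
    rw [hx]
    simp [g₀]
  have hg₀i : Integrable g₀ μ := (Lp.memLp g₀).integrable (by norm_num)
  have hb : ∀ᵐ x ∂μ, |g₀ x| ≤ C := by
    refine ae_abs_le_of_integral_test_le hΩ hμ hg₀i (integrable_const C) fun φ hφ => ?_
    rw [← hg₀ φ hφ, integral_mul_const, mul_comm]
    exact hL φ hφ
  -- Truncation changes `g₀` only on a null set and makes the bound hold everywhere.
  refine ⟨fun x => max (-C) (min C (g₀ x)), ?_, fun x => ?_, fun φ hφ => ?_⟩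
  · exact measurable_const.max (measurable_const.min (Lp.stronglyMeasurable g₀).measurable)
  · rw [abs_le]
    exact ⟨le_max_left _ _, max_le (by linarith) (min_le_left _ _)⟩
  · rw [hg₀ φ hφ]
    refine integral_congr_ae ?_
    filter_upwards [hb] with x hx
    rw [abs_le] at hx
    rw [min_eq_right hx.2, max_eq_right hx.1]

end TestFunctions

/-! ### Mollification of functions and measures. -/

section Mollification

/-- A bump function around `0` with outer radius `1 / (n + 1)`. -/
def stdBump (E : Type*) [NormedAddCommGroup E] (n : ℕ) : ContDiffBump (0 : E) where
  rIn := 1 / 2 / (n + 1)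
  rOut := 1 / (n + 1)
  rIn_pos := by positivity
  rIn_lt_rOut := by gcongr; norm_num

theorem tendsto_stdBump_rOut {E : Type*} [NormedAddCommGroup E] : Tendsto (fun n => (stdBump E n).rOut) atTop (nhds 0) :=
  tendsto_one_div_add_atTop_nhds_zero_nat

/-- The convolution of the measure `g κ` with the kernel `ρ`. -/
def mollify {E : Type*} [NormedAddCommGroup E] [MeasurableSpace E] (ρ : E → ℝ) (κ : Measure E)
    (g : E → ℝ) (x : E) : ℝ := ∫ y, g y * ρ (x - y) ∂κ

theorem abs_mollify_le {E : Type*} [NormedAddCommGroup E] [MeasurableSpace E] {ρ : E → ℝ}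
    (hρ : ∀ x, 0 ≤ ρ x) {κ : Measure E} {g : E → ℝ} (x : E) :
    |mollify ρ κ g x| ≤ mollify ρ κ (fun y => |g y|) x := by
  refine abs_integral_le_integral_abs.trans (le_of_eq ?_)
  simp only [abs_mul, abs_of_nonneg (hρ _), mollify]

variable {E : Type*} [NormedAddCommGroup E] [NormedSpace ℝ E] [FiniteDimensional ℝ E]
  [MeasurableSpace E] [BorelSpace E]

variable (ν : Measure E) [ν.IsAddHaarMeasure] (ρ : ContDiffBump (0 : E))

theorem exists_bound_normed : ∃ C, 0 ≤ C ∧ ∀ x, ‖ρ.normed ν x‖ ≤ C := by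
  obtain ⟨C, hC⟩ := (ρ.hasCompactSupport_normed (μ := ν)).exists_bound_of_continuous
    ρ.continuous_normed
  exact ⟨C, (norm_nonneg _).trans (hC 0), hC⟩

variable {κ : Measure E} {g : E → ℝ}

theorem integrable_mul_normed (hg : Integrable g κ) (x : E) :
    Integrable (fun y => g y * ρ.normed ν (x - y)) κ := by
  obtain ⟨C, -, hC⟩ := exists_bound_normed ν ρ
  exact hg.mul_bdd (c := C) (ρ.continuous_normed.comp
    (continuous_const.sub continuous_id)).aestronglyMeasurable (ae_of_all _ fun y => hC _)

theorem exists_bound_mollify (hg : Integrable g κ) :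
    ∃ C, ∀ x, ‖mollify (ρ.normed ν) κ g x‖ ≤ C := by
  obtain ⟨C, hC0, hC⟩ := exists_bound_normed ν ρ
  refine ⟨∫ y, |g y| * C ∂κ, fun x => ?_⟩
  refine (norm_integral_le_integral_norm _).trans (integral_mono_of_nonneg
    (ae_of_all _ fun y => norm_nonneg _) (hg.abs.mul_const C) (ae_of_all _ fun y => ?_))
  simp only [norm_mul, Real.norm_eq_abs]
  exact mul_le_mul_of_nonneg_left (hC _) (abs_nonneg _)

theorem continuous_mollify (hg : Integrable g κ) : Continuous (mollify (ρ.normed ν) κ g) := by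
  obtain ⟨C, hC0, hC⟩ := exists_bound_normed ν ρ
  refine continuous_of_dominated (bound := fun y => |g y| * C)
    (fun x => (integrable_mul_normed ν ρ hg x).aestronglyMeasurable)
    (fun x => ae_of_all _ fun y => ?_) (hg.abs.mul_const C)
    (ae_of_all _ fun y => continuous_const.mul (ρ.continuous_normed.comp
      (continuous_id.sub continuous_const)))
  simp only [norm_mul, Real.norm_eq_abs]
  exact mul_le_mul_of_nonneg_left (hC _) (abs_nonneg _)

theorem contDiff_mollify {W : E → ℝ} (hW : Integrable W ν) :
    ContDiff ℝ ∞ (mollify (ρ.normed ν) ν W) :=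
  (ρ.hasCompactSupport_normed (μ := ν)).contDiff_convolution_right
    (ContinuousLinearMap.mul ℝ ℝ) hW.locallyIntegrable ρ.contDiff_normed

theorem fderiv_mollify {W : E → ℝ} (hW : Integrable W ν) (x v : E) :
    fderiv ℝ (mollify (ρ.normed ν) ν W) x v = ∫ y, W y * fderiv ℝ (ρ.normed ν) (x - y) v ∂ν := by
  have h1 := (ρ.hasCompactSupport_normed (μ := ν)).hasFDerivAt_convolution_right
    (ContinuousLinearMap.mul ℝ ℝ) hW.locallyIntegrable (ρ.contDiff_normed (n := 1)) x
  have h2 := h1.fderiv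
  change fderiv ℝ (mollify (ρ.normed ν) ν W) x = _ at h2
  rw [h2]
  have h3 : ConvolutionExistsAt W (fderiv ℝ (ρ.normed ν)) x
      ((ContinuousLinearMap.mul ℝ ℝ).precompR E) ν :=
    ((ρ.hasCompactSupport_normed (μ := ν)).fderiv ℝ).convolutionExists_right _
      hW.locallyIntegrable ((ρ.contDiff_normed (n := 1)).continuous_fderiv (by norm_num)) x
  rw [convolution_def, ContinuousLinearMap.integral_apply h3]
  rfl

theorem hasCompactSupport_mollify {W : E → ℝ} (hW : HasCompactSupport W) :
    HasCompactSupport (mollify (ρ.normed ν) ν W) :=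
  hW.convolution (ContinuousLinearMap.mul ℝ ℝ) (ρ.hasCompactSupport_normed (μ := ν))

/-- Fubini and the evenness of the kernel: mollification is symmetric, even between a measure and a
function. -/
theorem integral_mul_mollify [SFinite κ] {ψ : E → ℝ} (hψ : Integrable ψ ν) (hg : Integrable g κ) :
    ∫ x, ψ x * mollify (ρ.normed ν) κ g x ∂ν = ∫ y, g y * mollify (ρ.normed ν) ν ψ y ∂κ := by
  simp only [mollify, ← integral_const_mul]
  rw [integral_integral_swap]
  · refine integral_congr_ae (ae_of_all _ fun y => integral_congr_ae (ae_of_all _ fun x => ?_))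
    simp only
    rw [← neg_sub y x, ρ.normed_neg]
    ring
  · obtain ⟨C, hC0, hC⟩ := exists_bound_normed ν ρ
    have h1 : Integrable (fun p : E × E => (ψ p.1 * g p.2) * ρ.normed ν (p.1 - p.2))
        (ν.prod κ) :=
      (hψ.mul_prod hg).mul_bdd (c := C) (ρ.continuous_normed.comp
        (continuous_fst.sub continuous_snd)).aestronglyMeasurable (ae_of_all _ fun y => hC _)
    refine h1.congr (ae_of_all _ fun p => ?_)
    simp only [Function.uncurry]
    ring

theorem mollify_eq_convolution (ψ : E → ℝ) :
    mollify (ρ.normed ν) ν ψ =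
      MeasureTheory.convolution (ρ.normed ν) ψ (ContinuousLinearMap.lsmul ℝ ℝ) ν := by
  ext x
  rw [convolution_eq_swap]
  simp only [mollify, ContinuousLinearMap.lsmul_apply, smul_eq_mul, mul_comm]

theorem abs_mollify_le_of_bound {ψ : E → ℝ} {C : ℝ} (hC : ∀ x, ‖ψ x‖ ≤ C) (x : E) :
    ‖mollify (ρ.normed ν) ν ψ x‖ ≤ C := by
  rw [mollify_eq_convolution, convolution_def]
  refine (norm_integral_le_of_norm_le ((ρ.integrable_normed (μ := ν)).mul_const C)
    (ae_of_all _ fun y => ?_)).trans (le_of_eq ?_)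
  · simp only [ContinuousLinearMap.lsmul_apply, norm_smul, Real.norm_of_nonneg (ρ.nonneg_normed _)]
    exact mul_le_mul_of_nonneg_left (hC _) (ρ.nonneg_normed _)
  · rw [integral_mul_const, ρ.integral_normed, one_mul]

/-- After moving the mollification onto `ψ`, the mollified `ψ` converges pointwise and boundedly.
This is weak convergence of the mollified measures. -/
theorem tendsto_integral_mul_mollify [SFinite κ] {ψ : E → ℝ} (hψ : Continuous ψ)
    (hψc : HasCompactSupport ψ) (hg : Integrable g κ) :
    Tendsto (fun n => ∫ x, ψ x * mollify ((stdBump E n).normed ν) κ g x ∂ν) atTop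
      (nhds (∫ x, ψ x * g x ∂κ)) := by
  simp_rw [integral_mul_mollify ν _ (hψ.integrable_of_hasCompactSupport hψc) hg]
  obtain ⟨C, hC⟩ := hψc.exists_bound_of_continuous hψ
  have : ∫ x, ψ x * g x ∂κ = ∫ x, g x * ψ x ∂κ := by simp only [mul_comm]
  rw [this]
  refine tendsto_integral_of_dominated_convergence (fun x => |g x| * C) (fun n => ?_)
    (hg.abs.mul_const C) (fun n => ae_of_all _ fun x => ?_) (ae_of_all _ fun x => ?_)
  · exact hg.aestronglyMeasurable.mul (continuous_mollify ν _
      (hψ.integrable_of_hasCompactSupport hψc)).aestronglyMeasurable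
  · rw [norm_mul]
    exact mul_le_mul_of_nonneg_left (abs_mollify_le_of_bound ν _ hC x) (abs_nonneg _)
  · refine tendsto_const_nhds.mul ?_
    simp_rw [mollify_eq_convolution]
    exact ContDiffBump.convolution_tendsto_right_of_continuous tendsto_stdBump_rOut hψ x

theorem tendsto_eLpNorm_translate_sub {a : ℝ≥0∞} [Fact (1 ≤ a)] (ha : a ≠ ⊤) {W : E → ℝ}
    (hW : MemLp W a ν) :
    Tendsto (fun t => eLpNorm (fun x => W (x - t) - W x) a ν) (nhds 0) (nhds 0) := by
  let G : C(E, C(E, E)) := (ContinuousMap.mk (fun p : E × E => p.2 - p.1)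
    (continuous_snd.sub continuous_fst)).curry
  have hG : ∀ t, MeasurePreserving (G t) ν ν := fun t => measurePreserving_sub_right ν t
  have h1 : Tendsto (fun t => Lp.compMeasurePreserving (G t) (hG t) (hW.toLp W)) (nhds 0)
      (nhds (Lp.compMeasurePreserving (G 0) (hG 0) (hW.toLp W))) :=
    Tendsto.compMeasurePreservingLp tendsto_const_nhds (G.continuous.tendsto 0) hG (hG 0) ha
  rw [tendsto_iff_edist_tendsto_0] at h1
  simp_rw [Lp.toLp_compMeasurePreserving hW, Lp.edist_toLp_toLp] at h1
  refine h1.congr fun t => ?_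
  congr 1
  ext x
  simp [G]

/-- The difference is an average over `|t| < rOut` of the integrals of `(W(x - t) - W(x)) h(x)`, so
Hölder and the continuity of translations apply. The radius `δ` does not depend on `h`, which may
therefore depend on the mollification itself, as in `tendsto_integral_abs_mollify_sub`. -/
theorem exists_forall_abs_integral_mollify_sub_le {a b : ℝ≥0∞} [ENNReal.HolderConjugate a b]
    (ha : a ≠ ⊤) {W : E → ℝ} (hW : MemLp W a ν) {η : ℝ} (hη : 0 < η) :
    ∃ δ > 0, ∀ ρ : ContDiffBump (0 : E), ρ.rOut < δ → ∀ h : E → ℝ, MemLp h b ν →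
      |∫ x, mollify (ρ.normed ν) ν W x * h x ∂ν - ∫ x, W x * h x ∂ν| ≤
        η * (eLpNorm h b ν).toReal := by
  have : Fact (1 ≤ a) := ⟨ENNReal.HolderConjugate.one_le a b⟩
  have h1 := (tendsto_eLpNorm_translate_sub ν ha hW).eventually
    (gt_mem_nhds (ENNReal.ofReal_pos.2 hη))
  obtain ⟨δ, hδ, hδW⟩ := Metric.eventually_nhds_iff.1 h1
  refine ⟨δ, hδ, fun ρ hρ h hh => ?_⟩
  have hshift : ∀ t, MemLp (fun x => W (x - t)) a ν := fun t =>
    hW.comp_measurePreserving (measurePreserving_sub_right ν t)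
  have hint : ∀ t, Integrable (fun x => W (x - t) * h x) ν := fun t => (hshift t).integrable_mul hh
  have hbd : ∀ f : E → ℝ, MemLp f a ν →
      ∫ x, |f x * h x| ∂ν ≤ (eLpNorm f a ν).toReal * (eLpNorm h b ν).toReal := fun f hf => by
    have h2 : eLpNorm (f • h) 1 ν ≤ eLpNorm f a ν * eLpNorm h b ν :=
      eLpNorm_smul_le_mul_eLpNorm hh.aestronglyMeasurable hf.aestronglyMeasurable
    have h3 : ∫ x, |f x * h x| ∂ν = (eLpNorm (f • h) 1 ν).toReal := by
      rw [eLpNorm_one_eq_lintegral_enorm, ← integral_norm_eq_lintegral_enorm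
        (hf.aestronglyMeasurable.smul hh.aestronglyMeasurable)]
      rfl
    rw [h3, ← ENNReal.toReal_mul]
    exact ENNReal.toReal_mono (ENNReal.mul_ne_top hf.eLpNorm_ne_top hh.eLpNorm_ne_top) h2
  have hm : ∀ x, mollify (ρ.normed ν) ν W x = ∫ t, ρ.normed ν t * W (x - t) ∂ν := fun x => by
    rw [mollify_eq_convolution, convolution_def]; rfl
  have hprod : Integrable (fun p : E × E => ρ.normed ν p.2 * W (p.1 - p.2) * h p.1)
      (ν.prod ν) := by
    have hmeas : AEStronglyMeasurable
        (fun p : E × E => ρ.normed ν p.2 * W (p.1 - p.2) * h p.1) (ν.prod ν) :=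
      ((ρ.continuous_normed.aestronglyMeasurable (μ := ν)).convolution_integrand
        (ContinuousLinearMap.mul ℝ ℝ) hW.aestronglyMeasurable).mul
        hh.aestronglyMeasurable.comp_fst
    rw [integrable_prod_iff' hmeas]
    refine ⟨ae_of_all _ fun t => ?_, ?_⟩
    · simp only [mul_assoc]
      exact (hint t).const_mul _
    · refine Integrable.mono' ((ρ.integrable_normed (μ := ν)).mul_const
        ((eLpNorm W a ν).toReal * (eLpNorm h b ν).toReal))
        hmeas.norm.prod_swap.integral_prod_right' (ae_of_all _ fun t => ?_)
      rw [Real.norm_of_nonneg (integral_nonneg fun x => norm_nonneg _)]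
      simp only [mul_assoc, norm_mul (ρ.normed ν t), Real.norm_of_nonneg (ρ.nonneg_normed t),
        integral_const_mul]
      refine mul_le_mul_of_nonneg_left ?_ (ρ.nonneg_normed _)
      refine (hbd _ (hshift t)).trans (le_of_eq ?_)
      congr 2
      exact eLpNorm_comp_measurePreserving hW.aestronglyMeasurable
        (measurePreserving_sub_right ν t)
  have e1 : ∫ x, mollify (ρ.normed ν) ν W x * h x ∂ν =
      ∫ t, ρ.normed ν t * ∫ x, W (x - t) * h x ∂ν ∂ν := by
    simp_rw [hm, ← integral_mul_const]
    rw [integral_integral_swap hprod]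
    simp_rw [mul_assoc, integral_const_mul]
  have e2 : ∫ x, W x * h x ∂ν = ∫ t, ρ.normed ν t * ∫ x, W x * h x ∂ν ∂ν := by
    rw [integral_mul_const, ρ.integral_normed, one_mul]
  have i1 : Integrable (fun t => ρ.normed ν t * ∫ x, W (x - t) * h x ∂ν) ν := by
    refine hprod.integral_prod_right.congr (ae_of_all _ fun t => ?_)
    simp_rw [mul_assoc, integral_const_mul]
  rw [e1, e2, ← integral_sub i1 ((ρ.integrable_normed).mul_const _)]
  rw [← Real.norm_eq_abs]
  refine (norm_integral_le_of_norm_le ((ρ.integrable_normed (μ := ν)).mul_const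
    (η * (eLpNorm h b ν).toReal)) (ae_of_all _ fun t => ?_)).trans (le_of_eq ?_)
  · rw [← mul_sub, norm_mul, Real.norm_of_nonneg (ρ.nonneg_normed _)]
    by_cases ht : ρ.normed ν t = 0
    · simp [ht]
    · refine mul_le_mul_of_nonneg_left ?_ (ρ.nonneg_normed _)
      have ht' : t ∈ Metric.ball (0 : E) ρ.rOut := by
        rw [← ρ.support_normed_eq (μ := ν)]; exact ht
      rw [← integral_sub (hint t) (show Integrable (fun x => W x * h x) ν from hW.integrable_mul hh)]
      have h4 : eLpNorm (fun x => W (x - t) - W x) a ν < ENNReal.ofReal η :=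
        hδW ((Metric.mem_ball.1 ht').trans hρ)
      have h5 := hbd _ ((hshift t).sub hW)
      refine (norm_integral_le_integral_norm _).trans (le_trans (le_of_eq ?_) (h5.trans ?_))
      · refine integral_congr_ae (ae_of_all _ fun x => ?_)
        simp [sub_mul]
      · refine mul_le_mul_of_nonneg_right ?_ ENNReal.toReal_nonneg
        exact ENNReal.toReal_le_of_le_ofReal hη.le h4.le
  · rw [integral_mul_const, ρ.integral_normed, one_mul]

theorem tendsto_integral_mollify_mul_of_ne_top {a b : ℝ≥0∞} [ENNReal.HolderConjugate a b]
    (ha : a ≠ ⊤) {W h : E → ℝ} (hW : MemLp W a ν)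
    (hh : MemLp h b ν) :
    Tendsto (fun n => ∫ x, mollify ((stdBump E n).normed ν) ν W x * h x ∂ν) atTop
      (nhds (∫ x, W x * h x ∂ν)) := by
  rw [Metric.tendsto_atTop']
  intro ε hε
  set c := (eLpNorm h b ν).toReal
  have hc : 0 ≤ c := ENNReal.toReal_nonneg
  obtain ⟨δ, hδ, hδ'⟩ := exists_forall_abs_integral_mollify_sub_le ν (b := b) ha hW
    (η := ε / (c + 1)) (by positivity)
  obtain ⟨N, hN⟩ := eventually_atTop.1
    ((tendsto_stdBump_rOut (E := E)).eventually (gt_mem_nhds hδ))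
  refine ⟨N, fun n hn => ?_⟩
  rw [Real.dist_eq]
  refine (hδ' _ (hN n hn.le) h hh).trans_lt ?_
  rw [div_mul_eq_mul_div, div_lt_iff₀ (by positivity)]
  nlinarith

/-- Weak convergence of mollifications, for conjugate exponents in `[1, ∞]`. -/
theorem tendsto_integral_mollify_mul {a b : ℝ≥0∞} [ENNReal.HolderConjugate a b]
    {W h : E → ℝ} (hW : MemLp W a ν) (hWi : Integrable W ν)
    (hh : MemLp h b ν) (hhi : Integrable h ν) :
    Tendsto (fun n => ∫ x, mollify ((stdBump E n).normed ν) ν W x * h x ∂ν) atTop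
      (nhds (∫ x, W x * h x ∂ν)) := by
  by_cases ha : a = ⊤
  -- Translations are not continuous in `L^∞`; when `a = ∞`, the mollification is moved onto `h`,
  -- whose exponent is finite.
  · have hb : b ≠ ⊤ := by
      rintro rfl
      have := ENNReal.HolderConjugate.inv_add_inv_eq_one a (⊤ : ℝ≥0∞)
      simp [ha] at this
    have := ENNReal.HolderConjugate.symm (p := a) (q := b)
    have h1 := tendsto_integral_mollify_mul_of_ne_top ν hb hh hW
    simp only [mul_comm (W _)]
    refine h1.congr fun n => ?_
    simp only [mul_comm _ (W _), mul_comm _ (h _)]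
    exact (integral_mul_mollify ν _ hWi hhi)
  · exact tendsto_integral_mollify_mul_of_ne_top ν ha hW hh

theorem integrable_mollify {W : E → ℝ} (hW : Integrable W ν) :
    Integrable (mollify (ρ.normed ν) ν W) ν := by
  rw [mollify_eq_convolution]
  exact ρ.integrable_normed.integrable_convolution _ hW

/-- The `L¹` norm of the error is its pairing with its own sign, so the estimate uniform over
bounded `h` applies. -/
theorem tendsto_integral_abs_mollify_sub {W : E → ℝ} (hW : Integrable W ν) :
    Tendsto (fun n => ∫ x, |mollify ((stdBump E n).normed ν) ν W x - W x| ∂ν) atTop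
      (nhds 0) := by
  rw [Metric.tendsto_atTop']
  intro ε hε
  obtain ⟨δ, hδ, hδ'⟩ := exists_forall_abs_integral_mollify_sub_le ν (a := 1) (b := ⊤)
    ENNReal.one_ne_top (memLp_one_iff_integrable.2 hW) (half_pos hε)
  obtain ⟨N, hN⟩ := eventually_atTop.1
    ((tendsto_stdBump_rOut (E := E)).eventually (gt_mem_nhds hδ))
  refine ⟨N, fun n hn => ?_⟩
  set w := mollify ((stdBump E n).normed ν) ν W
  have hw : Integrable w ν := integrable_mollify ν _ hW
  let s : E → ℝ := fun x => SignType.sign (w x - W x)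
  have hsb : ∀ x, ‖s x‖ ≤ 1 := fun x => by
    simp only [s]
    rcases lt_trichotomy (w x - W x) 0 with h | h | h <;> simp [h]
  have hsm : AEStronglyMeasurable s ν := by
    have h1 : Measurable (fun t : ℝ => ((SignType.sign t : SignType) : ℝ)) := by
      have : (fun t : ℝ => ((SignType.sign t : SignType) : ℝ)) =
          fun t => if 0 < t then 1 else if t < 0 then -1 else 0 := by
        ext t
        rcases lt_trichotomy t 0 with h | h | h
        · simp [h, h.not_gt]
        · simp [h]
        · simp [h]
      rw [this]
      exact Measurable.ite measurableSet_Ioi measurable_const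
        (Measurable.ite measurableSet_Iio measurable_const measurable_const)
    exact (h1.comp_aemeasurable (hw.sub hW).aemeasurable).aestronglyMeasurable
  have hs : MemLp s ⊤ ν := memLp_top_of_bound hsm 1 (ae_of_all _ hsb)
  have h1 := hδ' _ (hN n hn.le) s hs
  have h2 : ∫ x, |w x - W x| ∂ν = ∫ x, w x * s x ∂ν - ∫ x, W x * s x ∂ν := by
    rw [← integral_sub (hw.mul_bdd hsm (ae_of_all _ hsb)) (hW.mul_bdd hsm (ae_of_all _ hsb))]
    refine integral_congr_ae (ae_of_all _ fun x => ?_)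
    simp only [s]
    rw [← sub_mul, mul_comm, sign_mul_self]
  have h3 : (eLpNorm s ⊤ ν).toReal ≤ 1 := by
    refine ENNReal.toReal_le_of_le_ofReal zero_le_one ?_
    rw [eLpNorm_exponent_top]
    exact eLpNormEssSup_le_of_ae_bound (ae_of_all _ hsb)
  rw [Real.dist_eq, sub_zero, h2]
  refine h1.trans_lt ?_
  nlinarith

end Mollification

/-! ### Directional derivatives of Lipschitz functions of `u`. -/

section DirectionalDerivative

variable {E : Type*} [NormedAddCommGroup E] [NormedSpace ℝ E]
  [MeasurableSpace E]

/-- The distributional derivative of `u` on `Ω` in the direction `v` is the measure `g m`. -/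
def HasDeriv (ν : Measure E) (Ω : Set E) (v : E) (u : E → ℝ) (m : Measure E) (g : E → ℝ) : Prop :=
  ∀ φ, IsTest Ω φ → ∫ x, φ x * g x ∂m = -∫ x in Ω, u x * fderiv ℝ φ x v ∂ν

theorem HasDeriv.congr {ν : Measure E} {Ω : Set E} {v : E} {u : E → ℝ} {m : Measure E}
    {g g' : E → ℝ} (h : HasDeriv ν Ω v u m g) (hg : g =ᵐ[m] g') : HasDeriv ν Ω v u m g' :=
  fun φ hφ => by
    rw [← h φ hφ]
    refine integral_congr_ae ?_
    filter_upwards [hg] with x hx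
    rw [hx]

theorem setIntegral_test_eq_integral [BorelSpace E] {ν : Measure E} {Ω : Set E} (hΩ : IsOpen Ω) (F : ℝ → ℝ) {u φ : E → ℝ}
    (hφ : IsTest Ω φ) :
    ∫ x in Ω, F (u x) * φ x ∂ν = ∫ x, F (Ω.indicator u x) * φ x ∂ν := by
  rw [← setIntegral_eq_integral_of_forall_compl_eq_zero (s := Ω) (μ := ν)
    (f := fun x => F (Ω.indicator u x) * φ x) (fun x hx => by rw [hφ.eq_zero hx, mul_zero])]
  refine setIntegral_congr_fun hΩ.measurableSet fun x hx => ?_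
  simp only [indicator_of_mem hx]

variable [BorelSpace E] [FiniteDimensional ℝ E] {ν : Measure E} [ν.IsAddHaarMeasure]

/-- When the ball around `x` lies in `Ω`, the reflected and translated kernel is a test function on
`Ω`, so the definition of the distributional derivative applies to it. -/
theorem HasDeriv.fderiv_mollify_eq {Ω : Set E} (hΩ : IsOpen Ω) {v : E} {u g : E → ℝ}
    {m : Measure E} (h : HasDeriv ν Ω v u m g) (hu : IntegrableOn u Ω ν)
    (ρ : ContDiffBump (0 : E)) {x : E} (hx : Metric.closedBall x ρ.rOut ⊆ Ω) :
    fderiv ℝ (mollify (ρ.normed ν) ν (Ω.indicator u)) x v = mollify (ρ.normed ν) m g x := by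
  rw [fderiv_mollify ν ρ (hu.integrable_indicator hΩ.measurableSet)]
  have hts : tsupport (fun y => ρ.normed ν (x - y)) ⊆ Metric.closedBall x ρ.rOut := by
    refine closure_minimal (fun y hy => ?_) Metric.isClosed_closedBall
    have h1 : x - y ∈ Function.support (ρ.normed ν) := hy
    rw [ρ.support_normed_eq, Metric.mem_ball, dist_zero_right] at h1
    rw [Metric.mem_closedBall, dist_comm, dist_eq_norm]
    exact h1.le
  have hψ : IsTest Ω (fun y => ρ.normed ν (x - y)) :=
    { smooth := ρ.contDiff_normed.comp (contDiff_const.sub contDiff_id)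
      compact := (isCompact_closedBall x ρ.rOut).of_isClosed_subset (isClosed_tsupport _) hts
      supp := hts.trans hx }
  have hd : ∀ y, fderiv ℝ (fun y => ρ.normed ν (x - y)) y v = -fderiv ℝ (ρ.normed ν) (x - y) v := by
    intro y
    have h1 : HasFDerivAt (ρ.normed ν) (fderiv ℝ (ρ.normed ν) (x - y)) (x - y) :=
      ((ρ.contDiff_normed (n := 1)).differentiable (by norm_num) _).hasFDerivAt
    have h2 := h1.comp y ((hasFDerivAt_id y).const_sub x)
    have h3 : fderiv ℝ (fun y => ρ.normed ν (x - y)) y = _ := h2.fderiv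
    rw [h3]
    simp
  have h1 := h _ hψ
  have h2 := setIntegral_test_eq_integral (ν := ν) hΩ id (u := u) (hψ.fderiv_apply v)
  simp only [id] at h2
  rw [h2] at h1
  simp only [hd, mul_neg, integral_neg, neg_neg] at h1
  rw [← h1]
  simp only [mollify, mul_comm]

theorem eventually_closedBall_stdBump_subset {E : Type*} [NormedAddCommGroup E] {Ω K : Set E} (hΩ : IsOpen Ω) (hK : IsCompact K)
    (hKΩ : K ⊆ Ω) :
    ∀ᶠ n in atTop, ∀ x ∈ K, Metric.closedBall x (stdBump E n).rOut ⊆ Ω := by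
  obtain ⟨δ, δpos, hδ⟩ := hK.exists_cthickening_subset_open hΩ hKΩ
  filter_upwards [(tendsto_stdBump_rOut (E := E)).eventually (ge_mem_nhds δpos)] with n hn x hx
  exact (Metric.closedBall_subset_cthickening hx _).trans
    ((Metric.cthickening_mono hn _).trans hδ)

/-- Subtracting `T 0` matters because constants need not be integrable for `μ`. -/
theorem _root_.LipschitzWith.integrable_comp_sub {T : ℝ → ℝ} {K : ℝ≥0} (hT : LipschitzWith K T)
    {X : Type*} [MeasurableSpace X] {μ : Measure X} {w : X → ℝ} (hw : Integrable w μ) :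
    Integrable (fun x => T (w x) - T 0) μ := by
  refine Integrable.mono' (hw.norm.const_mul K)
    ((hT.continuous.comp_aestronglyMeasurable hw.aestronglyMeasurable).sub
      aestronglyMeasurable_const) (ae_of_all _ fun x => ?_)
  have := hT.dist_le_mul (w x) 0
  rwa [dist_eq_norm, dist_zero_right] at this

theorem integrable_comp_mul_test {T : ℝ → ℝ} {K : ℝ≥0} (hT : LipschitzWith K T) {Ω : Set E}
    {w χ : E → ℝ} (hw : Integrable w ν) (hχ : IsTest Ω χ) :
    Integrable (fun x => T (w x) * χ x) ν := by
  refine ((hχ.integrable_mul (hT.integrable_comp_sub hw)).add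
    (hχ.integrable.const_mul (T 0))).congr (ae_of_all _ fun x => ?_)
  simp only [Pi.add_apply]
  ring

/-- Compare difference quotients. Where `T ∘ w` has no derivative along `v`, the value of
`lineDeriv` is `0` by convention and the bound is trivial. -/
theorem abs_lineDeriv_comp_le {E : Type*} [NormedAddCommGroup E] [NormedSpace ℝ E] {T : ℝ → ℝ} {K : ℝ≥0} (hT : LipschitzWith K T) {w : E → ℝ}
    {x : E} (hw : DifferentiableAt ℝ w x) (v : E) :
    |lineDeriv ℝ (fun y => T (w y)) x v| ≤ K * |fderiv ℝ w x v| := by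
  by_cases hd : LineDifferentiableAt ℝ (fun y => T (w y)) x v
  · have h1 := hd.hasLineDerivAt.tendsto_slope_zero
    have h2 := (hw.hasFDerivAt.hasLineDerivAt v).tendsto_slope_zero
    refine le_of_tendsto_of_tendsto' h1.abs (h2.abs.const_mul (K : ℝ)) fun t => ?_
    simp only [smul_eq_mul, abs_mul]
    have := hT.dist_le_mul (w (x + t • v)) (w x)
    simp only [Real.dist_eq] at this
    nlinarith [abs_nonneg t⁻¹]
  · rw [lineDeriv_zero_of_not_lineDifferentiableAt hd, abs_zero]
    positivity

/-- Integration by parts is available for the Lipschitz function `T ∘ w`, so `T` needs no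
regularization. -/
theorem abs_integral_comp_mul_fderiv_le_of_smooth {T : ℝ → ℝ} {K : ℝ≥0} (hT : LipschitzWith K T)
    {Ω : Set E} {w φ : E → ℝ} (hw : ContDiff ℝ ∞ w) (hwc : HasCompactSupport w)
    (hφ : IsTest Ω φ) (v : E) :
    |∫ x, T (w x) * fderiv ℝ φ x v ∂ν| ≤ K * ∫ x, |φ x| * |fderiv ℝ w x v| ∂ν := by
  obtain ⟨C, hC⟩ := (hw.of_le (m := 1) (by simp)).lipschitzWith_of_hasCompactSupport hwc
    (by norm_num)
  obtain ⟨D, hD⟩ := (hφ.smooth.of_le (m := 1) (by simp)).lipschitzWith_of_hasCompactSupport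
    hφ.compact (by norm_num)
  have h1 := (hT.comp hC).integral_lineDeriv_mul_eq (μ := ν) hD hφ.compact v
  have h2 : ∀ x, lineDeriv ℝ φ x (-v) = -fderiv ℝ φ x v := fun x => by
    rw [(hφ.smooth.differentiable (by simp) x).lineDeriv_eq_fderiv, map_neg]
  simp only [h2, neg_mul, integral_neg, Function.comp_def] at h1
  have h3 : ∫ x, T (w x) * fderiv ℝ φ x v ∂ν = -∫ x, lineDeriv ℝ (fun y => T (w y)) x v * φ x ∂ν := by
    rw [h1, neg_neg]
    simp only [mul_comm]
  have hwd : Differentiable ℝ w := hw.differentiable (by simp)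
  rw [h3, abs_neg, ← integral_const_mul, ← Real.norm_eq_abs]
  have hcont : Continuous fun x => (K : ℝ) * (|φ x| * |fderiv ℝ w x v|) :=
    continuous_const.mul (hφ.continuous.abs.mul
      ((hw.continuous_fderiv (by simp)).clm_apply continuous_const).abs)
  refine norm_integral_le_of_norm_le (hcont.integrable_of_hasCompactSupport ?_)
    (ae_of_all _ fun x => ?_)
  · exact (HasCompactSupport.mul_right (f' := fun x => |fderiv ℝ w x v|)
      (hφ.compact.comp_left (g := abs) abs_zero)).mul_left
  · rw [norm_mul, Real.norm_eq_abs, Real.norm_eq_abs]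
    have := abs_lineDeriv_comp_le hT (hwd x) v
    nlinarith [abs_nonneg (φ x)]

/-- The derivative of a Lipschitz function of `u` is dominated by the derivative of `u`. -/
theorem HasDeriv.abs_integral_comp_mul_fderiv_le {Ω : Set E} (hΩ : IsOpen Ω)
    (hΩb : Bornology.IsBounded Ω) {v : E} {u g : E → ℝ} {m : Measure E} [IsFiniteMeasure m]
    (h : HasDeriv ν Ω v u m g) (hu : IntegrableOn u Ω ν) (hg : Integrable g m)
    {T : ℝ → ℝ} {K : ℝ≥0} (hT : LipschitzWith K T) {φ : E → ℝ} (hφ : IsTest Ω φ) :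
    |∫ x in Ω, T (u x) * fderiv ℝ φ x v ∂ν| ≤ K * ∫ x, |φ x| * |g x| ∂m := by
  set W := Ω.indicator u with hWdef
  have hW : Integrable W ν := hu.integrable_indicator hΩ.measurableSet
  have hWc : HasCompactSupport W :=
    HasCompactSupport.of_support_subset_isCompact hΩb.isCompact_closure
      (support_indicator_subset.trans subset_closure)
  set w : ℕ → E → ℝ := fun n => mollify ((stdBump E n).normed ν) ν W with hw
  have hwi : ∀ n, Integrable (w n) ν := fun n => integrable_mollify ν _ hW
  have hχ := hφ.fderiv_apply v
  obtain ⟨C, hC⟩ := hχ.exists_bound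
  rw [setIntegral_test_eq_integral hΩ T hχ]
  -- `L¹` convergence of the mollifications survives composition with the Lipschitz function `T`.
  have lim1 : Tendsto (fun n => ∫ x, T (w n x) * fderiv ℝ φ x v ∂ν) atTop
      (nhds (∫ x, T (W x) * fderiv ℝ φ x v ∂ν)) := by
    rw [tendsto_iff_norm_sub_tendsto_zero]
    refine squeeze_zero (fun n => norm_nonneg _) (fun n => ?_)
      (g := fun n => (K * C) * ∫ x, |w n x - W x| ∂ν) ?_
    · rw [← integral_sub (integrable_comp_mul_test hT (hwi n) hχ)
        (integrable_comp_mul_test hT hW hχ), ← integral_const_mul]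
      refine norm_integral_le_of_norm_le (((hwi n).sub hW).abs.const_mul _)
        (ae_of_all _ fun x => ?_)
      rw [← sub_mul, norm_mul, mul_right_comm]
      have := hT.dist_le_mul (w n x) (W x)
      rw [Real.dist_eq, Real.dist_eq] at this
      exact mul_le_mul this (hC x) (norm_nonneg _) (by positivity)
    · simpa using (tendsto_integral_abs_mollify_sub ν hW).const_mul ((K : ℝ) * C)
  have lim2 := tendsto_integral_mul_mollify ν (κ := m) hφ.continuous.abs
    (hφ.compact.comp_left (g := abs) abs_zero) hg.abs
  refine le_of_tendsto_of_tendsto lim1.abs (lim2.const_mul (K : ℝ)) ?_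
  filter_upwards [eventually_closedBall_stdBump_subset hΩ hφ.compact hφ.supp] with n hn
  refine (abs_integral_comp_mul_fderiv_le_of_smooth hT (contDiff_mollify ν _ hW)
    (hasCompactSupport_mollify ν _ hWc) hφ v).trans ?_
  refine mul_le_mul_of_nonneg_left ?_ K.coe_nonneg
  refine integral_mono_of_nonneg (ae_of_all _ fun x => by positivity) ?_ (ae_of_all _ fun x => ?_)
  · exact (hφ.continuous.abs.mul (continuous_mollify ν _ hg.abs)).integrable_of_hasCompactSupport
      (hφ.compact.comp_left (g := abs) abs_zero).mul_right
  · by_cases hx : x ∈ tsupport φ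
    · simp only
      rw [h.fderiv_mollify_eq hΩ hu _ (hn x hx)]
      exact mul_le_mul_of_nonneg_left (abs_mollify_le (ContDiffBump.nonneg_normed _) x) (abs_nonneg _)
    · simp [image_eq_zero_of_notMem_tsupport hx]

end DirectionalDerivative

/-! ### Chain rule: the gradient of `T ∘ u` is a bounded multiple of that of `u`. -/

section ChainRule

/-- The distributional gradient of `u` on `Ω` in the directions `d j` is the measure `f m`. -/
def HasGrad {E : Type*} [NormedAddCommGroup E] [NormedSpace ℝ E] [MeasurableSpace E]
    {κ : Type*} (ν : Measure E) (Ω : Set E) (d : κ → E) (u : E → ℝ) (m : Measure E)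
    (f : E → EuclideanSpace ℝ κ) : Prop :=
  ∀ j, HasDeriv ν Ω (d j) u m (fun x => f x j)

theorem HasGrad.congr {E : Type*} [NormedAddCommGroup E] [NormedSpace ℝ E] [MeasurableSpace E]
    {κ : Type*} {ν : Measure E} {Ω : Set E} {d : κ → E} {u : E → ℝ} {m : Measure E}
    {f g : E → EuclideanSpace ℝ κ} (hf : HasGrad ν Ω d u m f)
    (h : f =ᵐ[m] g) : HasGrad ν Ω d u m g := fun j =>
  (hf j).congr (by filter_upwards [h] with x hx; rw [hx])

variable {E : Type*} [NormedAddCommGroup E] [NormedSpace ℝ E] [FiniteDimensional ℝ E]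
  [MeasurableSpace E] [BorelSpace E] {ν : Measure E}

/-- This reaches all directions in the span of the `d j`, as the parallelism of the gradients
requires. -/
theorem HasDeriv.sum {κ : Type*} [Fintype κ] {Ω : Set E} {d : κ → E} {u : E → ℝ} {m : Measure E}
    {f : κ → E → ℝ} (h : ∀ j, HasDeriv ν Ω (d j) u m (f j)) (hf : ∀ j, Integrable (f j) m)
    (hu : IntegrableOn u Ω ν) (c : κ → ℝ) :
    HasDeriv ν Ω (∑ j, c j • d j) u m (fun x => ∑ j, c j * f j x) := by
  intro φ hφ
  have e1 : ∀ x, φ x * ∑ j, c j * f j x = ∑ j, c j * (φ x * f j x) := fun x => by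
    rw [Finset.mul_sum]
    exact Finset.sum_congr rfl fun j _ => by ring
  have e2 : ∀ x, u x * fderiv ℝ φ x (∑ j, c j • d j) =
      ∑ j, c j * (fderiv ℝ φ x (d j) * u x) := fun x => by
    rw [map_sum, Finset.mul_sum]
    exact Finset.sum_congr rfl fun j _ => by rw [map_smul, smul_eq_mul]; ring
  simp only [e1, e2]
  rw [integral_finsetSum _ fun j _ => (hφ.integrable_mul (hf j)).const_mul _,
    integral_finsetSum _ fun j _ => ((hφ.fderiv_apply (d j)).integrable_mul hu).const_mul _,
    ← Finset.sum_neg_distrib]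
  refine Finset.sum_congr rfl fun j _ => ?_
  rw [integral_const_mul, integral_const_mul, h j φ hφ, mul_neg]
  simp only [mul_comm (u _)]

theorem HasDeriv.linear_comb {Ω : Set E} {v : E} {u w : E → ℝ} {m : Measure E}
    {f g : E → ℝ} (hu : HasDeriv ν Ω v u m f) (hw : HasDeriv ν Ω v w m g)
    (hf : Integrable f m) (hg : Integrable g m)
    (hui : IntegrableOn u Ω ν) (hwi : IntegrableOn w Ω ν) (c : ℝ) :
    HasDeriv ν Ω v (fun x => w x + c * u x) m (fun x => g x + c * f x) := by
  intro φ hφ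
  have hχ := hφ.fderiv_apply v
  have e1 : ∀ x, φ x * (g x + c * f x) = φ x * g x + c * (φ x * f x) := fun x => by ring
  have e2 : ∀ x, (w x + c * u x) * fderiv ℝ φ x v =
      fderiv ℝ φ x v * w x + c * (fderiv ℝ φ x v * u x) := fun x => by ring
  simp only [e1, e2]
  rw [integral_add (hφ.integrable_mul hg) ((hφ.integrable_mul hf).const_mul _),
    integral_add (hχ.integrable_mul hwi) ((hχ.integrable_mul hui).const_mul _),
    integral_const_mul, integral_const_mul, hu φ hφ, hw φ hφ]
  simp only [mul_comm (fderiv ℝ φ _ v)]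
  ring

theorem integrableOn_comp_lipschitz {T : ℝ → ℝ} {K : ℝ≥0} (hT : LipschitzWith K T)
    {X : Type*} [MeasurableSpace X] {μ : Measure X} [IsFiniteMeasure μ] {w : X → ℝ}
    (hw : Integrable w μ) : Integrable (fun x => T (w x)) μ :=
  ((hT.integrable_comp_sub hw).add (integrable_const (T 0))).congr
    (ae_of_all _ fun x => by simp)

variable {κ : Type*} [Fintype κ] {Ω : Set E} {d : κ → E} {u : E → ℝ} {m : Measure E}
  {f : E → EuclideanSpace ℝ κ}

theorem _root_.MeasureTheory.Integrable.euclidean_apply {X κ : Type*} [Fintype κ]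
    [MeasurableSpace X] {μ : Measure X}
    {f : X → EuclideanSpace ℝ κ} (hf : Integrable f μ) (j : κ) :
    Integrable (fun x => f x j) μ :=
  hf.mono ((EuclideanSpace.proj (𝕜 := ℝ) j).continuous.comp_aestronglyMeasurable
    hf.aestronglyMeasurable) (ae_of_all _ fun x => PiLp.norm_apply_le (f x) j)

theorem HasGrad.linear_comb {w : E → ℝ} {g : E → EuclideanSpace ℝ κ}
    (hu : HasGrad ν Ω d u m f) (hw : HasGrad ν Ω d w m g)
    (hf : Integrable f m) (hg : Integrable g m)
    (hui : IntegrableOn u Ω ν) (hwi : IntegrableOn w Ω ν) (c : ℝ) :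
    HasGrad ν Ω d (fun x => w x + c * u x) m (fun x => g x + c • f x) := fun j =>
  (hu j).linear_comb (hw j) (hf.euclidean_apply j) (hg.euclidean_apply j) hui hwi c

/-- Uniqueness of the density turns linear relations between functions of `u` into pointwise
relations between the densities of their gradients. -/
theorem HasGrad.ae_eq [IsFiniteMeasure m] {g : E → EuclideanSpace ℝ κ} (hΩ : IsOpen Ω)
    (hm : m Ωᶜ = 0) (hf : HasGrad ν Ω d u m f)
    (hg : HasGrad ν Ω d u m g) (hfi : Integrable f m) (hgi : Integrable g m) : f =ᵐ[m] g := by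
  have : ∀ j, (fun x => f x j) =ᵐ[m] fun x => g x j := fun j =>
    ae_eq_of_integral_test_eq hΩ hm (hfi.euclidean_apply j) (hgi.euclidean_apply j)
      fun φ hφ => (hf j φ hφ).trans (hg j φ hφ).symm
  filter_upwards [ae_all_iff.2 this] with x hx
  ext j
  exact hx j

/-- Take for `v` the component of `b` orthogonal to `f`: the bound makes `⟪v, b⟫ = ‖v‖²` vanish. For
`f = 0` the quotient is `0` by convention, in agreement with `b = 0`. -/
theorem collinear_of_abs_inner_le {F : Type*} [NormedAddCommGroup F] [InnerProductSpace ℝ F]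
    {b f : F} {C : ℝ} (h : ∀ v, |⟪v, b⟫| ≤ C * |⟪v, f⟫|) :
    b = (⟪f, b⟫ / ‖f‖ ^ 2) • f ∧ |⟪f, b⟫ / ‖f‖ ^ 2| ≤ |C| := by
  set c := ⟪f, b⟫ / ‖f‖ ^ 2 with hc
  have hort : ⟪b - c • f, f⟫ = 0 := by
    rw [inner_sub_left, inner_smul_left, real_inner_self_eq_norm_sq, real_inner_comm]
    by_cases hf : f = 0
    · simp [hf]
    · have : ‖f‖ ^ 2 ≠ 0 := by simpa using hf
      simp only [hc, conj_trivial]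
      field_simp
      ring
  have h1 := h (b - c • f)
  rw [hort, abs_zero, mul_zero] at h1
  have h2 : ⟪b - c • f, b - c • f⟫ = 0 := by
    rw [inner_sub_right, inner_smul_right, hort, mul_zero, sub_zero]
    exact abs_nonpos_iff.1 h1
  refine ⟨sub_eq_zero.1 (inner_self_eq_zero.1 h2), ?_⟩
  have h3 := h f
  rw [real_inner_self_eq_norm_sq, abs_of_nonneg (sq_nonneg ‖f‖)] at h3
  rw [hc, abs_div, abs_of_nonneg (sq_nonneg ‖f‖)]
  refine div_le_of_le_mul₀ (sq_nonneg _) (abs_nonneg _) (h3.trans ?_)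
  exact mul_le_mul_of_nonneg_right (le_abs_self C) (sq_nonneg _)

variable [ν.IsAddHaarMeasure]

/-- The derivative of a Lipschitz function of `u` has a bounded density with respect to the
variation of the derivative of `u`. -/
theorem HasDeriv.exists_comp (hΩ : IsOpen Ω)
    (hΩb : Bornology.IsBounded Ω) {v : E} {g : E → ℝ} [IsFiniteMeasure m]
    (hm : m Ωᶜ = 0) (h : HasDeriv ν Ω v u m g) (hu : IntegrableOn u Ω ν) (hgm : Measurable g)
    (hg : Integrable g m) {T : ℝ → ℝ} {K : ℝ≥0} (hT : LipschitzWith K T) :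
    ∃ β : E → ℝ, Measurable β ∧ (∀ x, |β x| ≤ K) ∧
      HasDeriv ν Ω v (fun x => T (u x)) m (fun x => β x * |g x|) := by
  -- The variation of the derivative of `u` in the direction `v`.
  let m' := m.withDensity fun x => ‖g x‖ₑ
  have hm' : m' Ωᶜ = 0 := withDensity_absolutelyContinuous m _ hm
  have : IsFiniteMeasure m' := isFiniteMeasure_withDensity hg.2.ne
  have hint : ∀ F : E → ℝ, ∫ x, F x ∂m' = ∫ x, F x * |g x| ∂m := fun F => by
    rw [integral_withDensity_eq_integral_toReal_smul₀ hgm.enorm.aemeasurable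
      (ae_of_all _ fun x => enorm_lt_top)]
    refine integral_congr_ae (ae_of_all _ fun x => ?_)
    simp [mul_comm]
  have : IsFiniteMeasure (ν.restrict Ω) := ⟨by simpa using hΩb.measure_lt_top⟩
  have hTu : IntegrableOn (fun x => T (u x)) Ω ν := integrableOn_comp_lipschitz hT hu
  suffices h0 : ∃ β : E → ℝ, Measurable β ∧ (∀ x, |β x| ≤ K) ∧ ∀ φ, IsTest Ω φ →
      -∫ x in Ω, T (u x) * fderiv ℝ φ x v ∂ν = ∫ x, φ x * β x ∂m' by
    obtain ⟨β, hβm, hβ, hL⟩ := h0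
    refine ⟨β, hβm, hβ, fun φ hφ => ?_⟩
    rw [hL φ hφ, hint]
    simp only [mul_assoc]
  refine exists_density_of_abs_le hΩ hm'
    (fun φ => -∫ x in Ω, T (u x) * fderiv ℝ φ x v ∂ν) K.coe_nonneg (fun φ ψ hφ hψ => ?_)
    (fun c φ hφ => ?_) (fun φ hφ => ?_)
  · have e : ∀ x, fderiv ℝ (fun x => φ x + ψ x) x v = fderiv ℝ φ x v + fderiv ℝ ψ x v := fun x => by
      rw [fderiv_fun_add (hφ.smooth.differentiable (by simp) x)
        (hψ.smooth.differentiable (by simp) x)]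
      rfl
    simp only [e, mul_add]
    rw [integral_add, neg_add]
    · simp only [mul_comm (T _)]
      exact (hφ.fderiv_apply v).integrable_mul hTu
    · simp only [mul_comm (T _)]
      exact (hψ.fderiv_apply v).integrable_mul hTu
  · have e : ∀ x, fderiv ℝ (fun x => c * φ x) x v = c * fderiv ℝ φ x v := fun x => by
      rw [fderiv_const_mul (hφ.smooth.differentiable (by simp) x)]
      rfl
    simp only [e, mul_left_comm _ c]
    rw [integral_const_mul, mul_neg]
  · simp only [abs_neg]
    rw [hint]
    exact h.abs_integral_comp_mul_fderiv_le hΩ hΩb hu hg hT hφ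

/-- The gradient of a Lipschitz function of `u` is a bounded multiple of the gradient of `u`. -/
theorem HasGrad.exists_comp (hΩ : IsOpen Ω) (hΩb : Bornology.IsBounded Ω) [IsFiniteMeasure m]
    (hm : m Ωᶜ = 0) (h : HasGrad ν Ω d u m f) (hu : IntegrableOn u Ω ν) (hf : Integrable f m)
    {T : ℝ → ℝ} {K : ℝ≥0} (hT : LipschitzWith K T) :
    ∃ a : E → ℝ, Measurable a ∧ (∀ x, |a x| ≤ K) ∧
      HasGrad ν Ω d (fun x => T (u x)) m (fun x => a x • f x) := by
  obtain ⟨f', hf'm, hff'⟩ := hf.aestronglyMeasurable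
  have hf' : Integrable f' m := hf.congr hff'
  have h' : HasGrad ν Ω d u m f' := h.congr hff'
  have hfj : ∀ j, Measurable fun x => f' x j := fun j =>
    (EuclideanSpace.proj (𝕜 := ℝ) j).continuous.measurable.comp hf'm.measurable
  have : IsFiniteMeasure (ν.restrict Ω) := ⟨by simpa using hΩb.measure_lt_top⟩
  have hTu : IntegrableOn (fun x => T (u x)) Ω ν := integrableOn_comp_lipschitz hT hu
  choose β hβm hβ hL using fun j => (h' j).exists_comp hΩ hΩb hm hu (hfj j)
    (hf'.euclidean_apply j) hT
  let b : E → EuclideanSpace ℝ κ := fun x => WithLp.toLp 2 fun j => β j x * |f' x j|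
  have hbj : ∀ j, Integrable (fun x => β j x * |f' x j|) m := fun j =>
    (hf'.euclidean_apply j).abs.bdd_mul (hβm j).aestronglyMeasurable
      (ae_of_all _ fun x => hβ j x)
  have hin : ∀ v w : EuclideanSpace ℝ κ, ⟪v, w⟫ = ∑ j, v j * w j := fun v w => by
    simp [PiLp.inner_apply, mul_comm]
  -- The scalar estimate in the direction `∑ v_j d_j`; the exceptional null set depends on `v`.
  have key : ∀ v : EuclideanSpace ℝ κ, ∀ᵐ x ∂m, |⟪v, b x⟫| ≤ K * |⟪v, f' x⟫| := fun v => by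
    have h1 := HasDeriv.sum h' (fun j => hf'.euclidean_apply j) hu v
    have h2 := HasDeriv.sum hL hbj hTu v
    simp only [hin]
    refine ae_abs_le_of_integral_test_le hΩ hm
      (integrable_finsetSum _ fun j _ => (hbj j).const_mul _)
      ((integrable_finsetSum _ fun j _ => (hf'.euclidean_apply j).const_mul _).abs.const_mul _)
      fun φ hφ => ?_
    rw [h2 φ hφ, abs_neg]
    refine (h1.abs_integral_comp_mul_fderiv_le hΩ hΩb hu
      (integrable_finsetSum _ fun j _ => (hf'.euclidean_apply j).const_mul _) hT hφ).trans
      (le_of_eq ?_)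
    rw [← integral_const_mul]
    simp only [mul_left_comm]
  -- A countable dense set of directions gives one null set for all `v`, by continuity.
  have key' : ∀ᵐ x ∂m, ∀ v : EuclideanSpace ℝ κ, |⟪v, b x⟫| ≤ K * |⟪v, f' x⟫| := by
    filter_upwards [ae_all_iff.2 fun n => key (TopologicalSpace.denseSeq _ n)] with x hx v
    refine (TopologicalSpace.denseRange_denseSeq (EuclideanSpace ℝ κ)).induction_on v ?_ hx
    exact isClosed_le (continuous_id.inner continuous_const).abs
      (continuous_const.mul (continuous_id.inner continuous_const).abs)
  have hbm : Measurable b := (MeasurableEquiv.toLp 2 (κ → ℝ)).measurable.comp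
    (measurable_pi_lambda _ fun j => (hβm j).mul (hfj j).abs)
  refine ⟨fun x => max (-K) (min K (⟪f' x, b x⟫ / ‖f' x‖ ^ 2)), ?_, fun x => ?_, ?_⟩
  · exact measurable_const.max (measurable_const.min
      ((hf'm.measurable.inner hbm).div (hf'm.measurable.norm.pow_const 2)))
  · have := K.coe_nonneg
    rw [abs_le]
    exact ⟨le_max_left _ _, max_le (by linarith) (min_le_left _ _)⟩
  · refine HasGrad.congr (f := b) hL ?_
    filter_upwards [key', hff'] with x hx hx'
    obtain ⟨h1, h2⟩ := collinear_of_abs_inner_le hx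
    rw [NNReal.abs_eq, abs_le] at h2
    rw [min_eq_right h2.2, max_eq_right h2.1, hx']
    exact h1

/-- The gradient of a monotone Lipschitz function of `u` is a bounded nonnegative multiple of the
gradient of `u`. -/
theorem HasGrad.exists_comp_monotone (hΩ : IsOpen Ω) (hΩb : Bornology.IsBounded Ω)
    [IsFiniteMeasure m] (hm : m Ωᶜ = 0) (h : HasGrad ν Ω d u m f) (hu : IntegrableOn u Ω ν)
    (hf : Integrable f m) {T : ℝ → ℝ} {K : ℝ≥0} (hT : LipschitzWith K T) (hTm : Monotone T) :
    ∃ a : E → ℝ, Measurable a ∧ (∀ x, 0 ≤ a x) ∧ (∀ x, a x ≤ K) ∧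
      HasGrad ν Ω d (fun x => T (u x)) m (fun x => a x • f x) := by
  -- Monotonicity puts the slopes of `T` in `[0, K]`, so those of `T - (K/2) id` lie in `[-K/2,
  -- K/2]`. Adding `K/2` back to the density produces the range `[0, K]`.
  have hS : LipschitzWith (K / 2) (fun t => T t - (K / 2 : ℝ) * t) := by
    refine LipschitzWith.of_dist_le_mul fun s t => ?_
    wlog hst : s ≤ t generalizing s t
    · rw [dist_comm, dist_comm s]
      exact this t s (le_of_not_ge hst)
    · have h1 := hT.dist_le_mul s t
      have h2 := hTm hst
      rw [Real.dist_eq, abs_sub_comm, abs_of_nonneg (by linarith), Real.dist_eq, abs_sub_comm,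
        abs_of_nonneg (by linarith)] at h1
      rw [Real.dist_eq, Real.dist_eq, abs_sub_comm s, abs_of_nonneg (sub_nonneg.2 hst), abs_le]
      push_cast
      constructor <;> nlinarith
  obtain ⟨a, ham, ha, hgrad⟩ := h.exists_comp hΩ hΩb hm hu hf hS
  have : IsFiniteMeasure (ν.restrict Ω) := ⟨by simpa using hΩb.measure_lt_top⟩
  refine ⟨fun x => a x + K / 2, ham.add_const _, fun x => ?_, fun x => ?_, ?_⟩
  · have := (abs_le.1 (ha x)).1
    push_cast at this
    linarith
  · have := (abs_le.1 (ha x)).2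
    push_cast at this
    linarith
  · have h1 := h.linear_comb hgrad hf (hf.bdd_smul _ ham.aestronglyMeasurable (ae_of_all _ ha))
      hu (integrableOn_comp_lipschitz hS hu) (K / 2)
    simpa [add_smul] using h1

end ChainRule

/-! ### The pairing is dominated by `|D_{x₁}w|`. -/

section PairingBound

theorem clm_apply_eq_sum {ι : Type*} [Fintype ι] [DecidableEq ι]
    (L : EuclideanSpace ℝ ι →L[ℝ] ℝ) (v : EuclideanSpace ℝ ι) :
    L v = ∑ c, v c * L (EuclideanSpace.single c 1) := by
  conv_lhs => rw [← (EuclideanSpace.basisFun ι ℝ).sum_repr v]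
  simp [map_sum]

theorem IsTest.memLp_mul {E : Type*} [NormedAddCommGroup E] [NormedSpace ℝ E]
    [MeasurableSpace E] [BorelSpace E] [SecondCountableTopology E]
    {Ω : Set E} {φ : E → ℝ} (hφ : IsTest Ω φ) {μ : Measure E} {p : ℝ≥0∞} {f : E → ℝ}
    (hf : MemLp f p μ) : MemLp (fun x => φ x * f x) p μ := by
  obtain ⟨C, hC⟩ := hφ.exists_bound
  refine hf.of_le_mul (c := C) (hφ.continuous.aestronglyMeasurable.mul hf.aestronglyMeasurable)
    (ae_of_all _ fun x => ?_)
  rw [norm_mul]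
  exact mul_le_mul_of_nonneg_right (hC x) (norm_nonneg _)

theorem setIntegral_eq_integral_indicator_mul {E : Type*} [MeasurableSpace E] {ν : Measure E}
    {Ω : Set E} (hΩ : MeasurableSet Ω) (a b φ : E → ℝ) :
    ∫ x in Ω, φ x * (a x * b x) ∂ν = ∫ x, Ω.indicator a x * (φ x * Ω.indicator b x) ∂ν := by
  rw [← integral_indicator hΩ]
  refine integral_congr_ae (ae_of_all _ fun x => ?_)
  by_cases hx : x ∈ Ω
  · simp only [indicator_of_mem hx]; ring
  · simp only [indicator_of_notMem hx]; ring

theorem mollify_restrict {E : Type*} [NormedAddCommGroup E] [MeasurableSpace E] {ν : Measure E}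
    {Ω : Set E} (hΩ : MeasurableSet Ω) (ρ g : E → ℝ) :
    mollify ρ (ν.restrict Ω) g = mollify ρ ν (Ω.indicator g) := by
  ext x
  rw [mollify, mollify, ← integral_indicator hΩ]
  refine integral_congr_ae (ae_of_all _ fun y => ?_)
  by_cases hy : y ∈ Ω
  · simp only [indicator_of_mem hy]
  · simp only [indicator_of_notMem hy, zero_mul]

/-- The sum is a single integral of `⟪ζ, f y⟫` against the kernel, to which Cauchy–Schwarz applies.
-/
theorem abs_sum_mul_mollify_le {E κ : Type*} [NormedAddCommGroup E] [NormedSpace ℝ E]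
    [FiniteDimensional ℝ E] [MeasurableSpace E] [BorelSpace E] {ν : Measure E}
    [ν.IsAddHaarMeasure] [Fintype κ] {m : Measure E} {f : E → EuclideanSpace ℝ κ} (hf : Integrable f m)
    (ρ : ContDiffBump (0 : E)) (ζ : EuclideanSpace ℝ κ)
    (x : E) :
    |∑ k, ζ k * mollify (ρ.normed ν) m (fun y => f y k) x| ≤
      ‖ζ‖ * mollify (ρ.normed ν) m (fun y => ‖f y‖) x := by
  have e : ∑ k, ζ k * mollify (ρ.normed ν) m (fun y => f y k) x =
      ∫ y, ⟪ζ, f y⟫ * ρ.normed ν (x - y) ∂m := by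
    simp only [mollify, ← integral_const_mul]
    rw [← integral_finsetSum _ fun k _ =>
      (integrable_mul_normed ν ρ (hf.euclidean_apply k) x).const_mul _]
    refine integral_congr_ae (ae_of_all _ fun y => ?_)
    simp only [PiLp.inner_apply, Finset.sum_mul]
    refine Finset.sum_congr rfl fun k _ => ?_
    simp
    ring
  rw [e, mollify, ← integral_const_mul, ← Real.norm_eq_abs]
  refine norm_integral_le_of_norm_le ((integrable_mul_normed ν ρ hf.norm x).const_mul _)
    (ae_of_all _ fun y => ?_)
  rw [norm_mul, Real.norm_of_nonneg (ρ.nonneg_normed _), ← mul_assoc]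
  exact mul_le_mul_of_nonneg_right (norm_inner_le_norm _ _) (ρ.nonneg_normed _)

variable {κ σ : Type*} [Fintype κ] [Fintype σ] [DecidableEq κ] [DecidableEq σ]

/-- The coordinatewise form of the pairing of `z` with the part of the gradient of `w` in the
coordinates `κ`. -/
def coordPairing (Ω : Set (EuclideanSpace ℝ (κ ⊕ σ)))
    (z : EuclideanSpace ℝ (κ ⊕ σ) → EuclideanSpace ℝ (κ ⊕ σ))
    (d w : EuclideanSpace ℝ (κ ⊕ σ) → ℝ) (g : σ → EuclideanSpace ℝ (κ ⊕ σ) → ℝ)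
    (φ : EuclideanSpace ℝ (κ ⊕ σ) → ℝ) : ℝ :=
  -(∫ x in Ω, φ x * (w x * d x)) -
    ∑ c, (∫ x in Ω, fderiv ℝ φ x (EuclideanSpace.single c 1) * (w x * z x c)) -
    ∑ s, ∫ x in Ω, φ x * (g s x * z x (Sum.inr s))

variable {Ω : Set (EuclideanSpace ℝ (κ ⊕ σ))}
  {z : EuclideanSpace ℝ (κ ⊕ σ) → EuclideanSpace ℝ (κ ⊕ σ)}
  {d w : EuclideanSpace ℝ (κ ⊕ σ) → ℝ} {g : σ → EuclideanSpace ℝ (κ ⊕ σ) → ℝ}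
  {m : Measure (EuclideanSpace ℝ (κ ⊕ σ))}
  {f : EuclideanSpace ℝ (κ ⊕ σ) → EuclideanSpace ℝ κ}

/-- The pairing is dominated by the gradient of `w` in the coordinates `κ`. -/
theorem abs_coordPairing_le (hΩ : IsOpen Ω) (hΩb : Bornology.IsBounded Ω) [IsFiniteMeasure m]
    {q q' : ℝ≥0∞} [ENNReal.HolderConjugate q q'] (a b : σ → ℝ≥0∞)
    [∀ s, ENNReal.HolderConjugate (a s) (b s)]
    (hwq : MemLp w q (volume.restrict Ω)) (hd : MemLp d q' (volume.restrict Ω))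
    (hwa : ∀ s, MemLp w (a s) (volume.restrict Ω))
    (hga : ∀ s, MemLp (g s) (a s) (volume.restrict Ω))
    (hzb : ∀ s, MemLp (fun x => z x (Sum.inr s)) (b s) (volume.restrict Ω))
    (hz1 : ∀ k, MemLp (fun x => z x (Sum.inl k)) ⊤ (volume.restrict Ω))
    (hgrad : HasGrad volume Ω (fun k => EuclideanSpace.single (Sum.inl k) 1) w m f)
    (hf : Integrable f m)
    (hg : ∀ s, HasDeriv volume Ω (EuclideanSpace.single (Sum.inr s) 1) w (volume.restrict Ω) (g s))
    (hdiv : ∀ φ, IsTest Ω φ → ∫ x in Ω, φ x * d x = -∫ x in Ω, fderiv ℝ φ x (z x))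
    {Z : ℝ} (hZ : ∀ᵐ x ∂volume.restrict Ω, ‖block Sum.inl (z x)‖ ≤ Z)
    {φ : EuclideanSpace ℝ (κ ⊕ σ) → ℝ} (hφ : IsTest Ω φ) :
    |coordPairing Ω z d w g φ| ≤ Z * ∫ x, |φ x| * ‖f x‖ ∂m := by
  have hΩm := hΩ.measurableSet
  have : IsFiniteMeasure (volume.restrict Ω) := ⟨by simpa using hΩb.measure_lt_top⟩
  have hwi : IntegrableOn w Ω := hwq.integrable (ENNReal.HolderConjugate.one_le q q')
  have hW := hwi.integrable_indicator hΩm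
  have ind : ∀ {p : ℝ≥0∞} {h : EuclideanSpace ℝ (κ ⊕ σ) → ℝ}, MemLp h p (volume.restrict Ω) →
      MemLp (Ω.indicator h) p volume := fun hh => (memLp_indicator_iff_restrict hΩm).2 hh
  have intz : ∀ c, IntegrableOn (fun x => z x c) Ω := fun c => by
    cases c with
    | inl k => exact (hz1 k).integrable le_top
    | inr s =>
      have := ENNReal.HolderConjugate.symm (p := a s) (q := b s)
      exact (hzb s).integrable (ENNReal.HolderConjugate.one_le (b s) (a s))
  have intd : IntegrableOn d Ω := by
    have := ENNReal.HolderConjugate.symm (p := q) (q := q')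
    exact hd.integrable (ENNReal.HolderConjugate.one_le q' q)
  have indi : ∀ {h : EuclideanSpace ℝ (κ ⊕ σ) → ℝ}, IntegrableOn h Ω →
      Integrable (Ω.indicator h) volume := fun hh => hh.integrable_indicator hΩm
  set W := Ω.indicator w with hWdef
  let ρ := fun n => (stdBump (EuclideanSpace ℝ (κ ⊕ σ)) n)
  let M := fun (n : ℕ) (h : EuclideanSpace ℝ (κ ⊕ σ) → ℝ) => mollify ((ρ n).normed volume) volume h
  have lim1 : Tendsto (fun n => ∫ x, M n W x * (φ x * Ω.indicator d x)) atTop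
      (nhds (∫ x in Ω, φ x * (w x * d x))) := by
    rw [setIntegral_eq_integral_indicator_mul hΩm]
    exact tendsto_integral_mollify_mul volume (ind hwq) hW (hφ.memLp_mul (ind hd))
      (hφ.integrable_mul (indi intd))
  -- In the coordinates `κ` the components of `z` are bounded and `w ∈ L¹` suffices; in the
  -- coordinates `σ` the integrability of `w` to the power `a s` is needed.
  have lim2 : ∀ c, Tendsto (fun n => ∫ x, M n W x * (fderiv ℝ φ x (EuclideanSpace.single c 1) *
      Ω.indicator (fun x => z x c) x)) atTop
      (nhds (∫ x in Ω, fderiv ℝ φ x (EuclideanSpace.single c 1) * (w x * z x c))) := fun c => by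
    rw [setIntegral_eq_integral_indicator_mul hΩm]
    have hχ := hφ.fderiv_apply (EuclideanSpace.single c (1 : ℝ))
    cases c with
    | inl k =>
      exact tendsto_integral_mollify_mul (a := 1) (b := ⊤) volume
        (memLp_one_iff_integrable.2 hW) hW (hχ.memLp_mul (ind (hz1 k)))
        (hχ.integrable_mul (indi (intz _)))
    | inr s =>
      exact tendsto_integral_mollify_mul (a := a s) (b := b s) volume
        (ind (hwa s)) hW (hχ.memLp_mul (ind (hzb s)))
        (hχ.integrable_mul (indi (intz _)))
  have gi : ∀ s, IntegrableOn (g s) Ω := fun s =>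
    (hga s).integrable (ENNReal.HolderConjugate.one_le (a s) (b s))
  have lim3 : ∀ s, Tendsto (fun n => ∫ x, M n (Ω.indicator (g s)) x * (φ x *
      Ω.indicator (fun x => z x (Sum.inr s)) x)) atTop
      (nhds (∫ x in Ω, φ x * (g s x * z x (Sum.inr s)))) := fun s => by
    rw [setIntegral_eq_integral_indicator_mul hΩm]
    exact tendsto_integral_mollify_mul (a := a s) (b := b s) volume
      (ind (hga s)) (indi (gi s)) (hφ.memLp_mul (ind (hzb s)))
      (hφ.integrable_mul (indi (intz _)))
  have lim := ((lim1.neg).sub (tendsto_finsetSum Finset.univ fun c _ => lim2 c)).sub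
    (tendsto_finsetSum Finset.univ fun s _ => lim3 s)
  have limB := (tendsto_integral_mul_mollify volume (κ := m) hφ.continuous.abs
    (hφ.compact.comp_left (g := abs) abs_zero) hf.norm).const_mul Z
  refine le_of_tendsto_of_tendsto lim.abs limB ?_
  filter_upwards [eventually_closedBall_stdBump_subset hΩ hφ.compact hφ.supp] with n hn
  have hwn : ContDiff ℝ ∞ (M n W) := contDiff_mollify volume _ hW
  -- the divergence of `z` tested against `M n W * φ`
  have htest := hφ.mul_left hwn
  have hD := hdiv _ htest
  have e1 : ∫ x in Ω, M n W x * φ x * d x = ∫ x, M n W x * (φ x * Ω.indicator d x) := by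
    rw [← integral_indicator hΩm]
    refine integral_congr_ae (ae_of_all _ fun x => ?_)
    by_cases hx : x ∈ Ω
    · simp only [indicator_of_mem hx]; ring
    · simp only [indicator_of_notMem hx]; ring
  let Zc := fun c : κ ⊕ σ => Ω.indicator (fun x => z x c)
  let δ := fun c : κ ⊕ σ => (EuclideanSpace.single c (1 : ℝ))
  have hMb := exists_bound_mollify volume (ρ n) hW
  have i2 : ∀ c, Integrable (fun x => M n W x * (fderiv ℝ φ x (δ c) * Zc c x)) volume :=
    fun c => by
      obtain ⟨C, hC⟩ := hMb
      exact ((hφ.fderiv_apply (δ c)).integrable_mul (indi (intz c))).bdd_mul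
        hwn.continuous.aestronglyMeasurable (ae_of_all _ hC)
  have i3 : ∀ c, Integrable (fun x => φ x * fderiv ℝ (M n W) x (δ c) * Zc c x) volume :=
    fun c => by
      have ht : IsTest Ω (fun x => φ x * fderiv ℝ (M n W) x (δ c)) := by
        have := hφ.mul_left (w := fun x => fderiv ℝ (M n W) x (δ c))
          ((hwn.fderiv_right (m := ∞) (by norm_cast)).clm_apply contDiff_const)
        simpa only [mul_comm] using this
      exact ht.integrable_mul (indi (intz c))
  have e2 : ∫ x in Ω, fderiv ℝ (fun x => M n W x * φ x) x (z x) =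
      ∑ c, (∫ x, M n W x * (fderiv ℝ φ x (δ c) * Zc c x)) +
        ∑ c, ∫ x, φ x * fderiv ℝ (M n W) x (δ c) * Zc c x := by
    rw [← integral_finsetSum _ fun c _ => i2 c, ← integral_finsetSum _ fun c _ => i3 c,
      ← integral_add (integrable_finsetSum _ fun c _ => i2 c)
        (integrable_finsetSum _ fun c _ => i3 c), ← integral_indicator hΩm]
    refine integral_congr_ae (ae_of_all _ fun x => ?_)
    by_cases hx : x ∈ Ω
    · simp only [indicator_of_mem hx, Zc]
      rw [clm_apply_eq_sum, ← Finset.sum_add_distrib]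
      refine Finset.sum_congr rfl fun c _ => ?_
      rw [fderiv_fun_mul (hwn.differentiable (by simp) x) (hφ.smooth.differentiable (by simp) x)]
      simp only [add_apply, smul_apply, smul_eq_mul, δ]
      ring
    · simp only [indicator_of_notMem hx, Zc, mul_zero, Finset.sum_const_zero, add_zero]
  rw [e1, e2] at hD
  -- the derivatives of `M n W` are mollifications of the derivatives of `w`
  have e3 : ∀ s, ∫ x, φ x * fderiv ℝ (M n W) x (δ (Sum.inr s)) * Zc (Sum.inr s) x =
      ∫ x, M n (Ω.indicator (g s)) x * (φ x * Zc (Sum.inr s) x) := fun s => by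
    refine integral_congr_ae (ae_of_all _ fun x => ?_)
    by_cases hx : x ∈ tsupport φ
    · simp only [M, δ]
      rw [(hg s).fderiv_mollify_eq hΩ hwi (ρ n) (hn x hx), mollify_restrict hΩm]
      ring
    · simp [image_eq_zero_of_notMem_tsupport hx]
  have e4 : ∑ k, (∫ x, φ x * fderiv ℝ (M n W) x (δ (Sum.inl k)) * Zc (Sum.inl k) x) =
      ∫ x, φ x * ∑ k, Zc (Sum.inl k) x *
        mollify ((ρ n).normed volume) m (fun y => f y k) x := by
    rw [← integral_finsetSum _ fun k _ => i3 _]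
    refine integral_congr_ae (ae_of_all _ fun x => ?_)
    simp only [Finset.mul_sum]
    refine Finset.sum_congr rfl fun k _ => ?_
    by_cases hx : x ∈ tsupport φ
    · simp only [M, δ]
      rw [(hgrad k).fderiv_mollify_eq hΩ hwi (ρ n) (hn x hx)]
      ring
    · simp [image_eq_zero_of_notMem_tsupport hx]
  -- The identity for `div z` leaves all derivatives of `M n W` on the right. Those in the
  -- coordinates `σ` cancel with the mollified `g s`, so only the part controlled by `|f| m`
  -- remains.
  have e5 : -(∫ x, M n W x * (φ x * Ω.indicator d x)) -
      ∑ c, (∫ x, M n W x * (fderiv ℝ φ x (δ c) * Zc c x)) -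
      ∑ s, (∫ x, M n (Ω.indicator (g s)) x * (φ x * Zc (Sum.inr s) x)) =
      ∫ x, φ x * ∑ k, Zc (Sum.inl k) x *
        mollify ((ρ n).normed volume) m (fun y => f y k) x := by
    rw [← e4, hD, Fintype.sum_sum_type (fun c => ∫ x, φ x * fderiv ℝ (M n W) x (δ c) * Zc c x)]
    simp only [e3]
    ring
  refine (le_of_eq (congrArg abs e5)).trans ?_
  rw [← integral_const_mul, ← Real.norm_eq_abs]
  refine norm_integral_le_of_norm_le (Integrable.const_mul ?_ _) ?_
  · exact (hφ.continuous.abs.mul (continuous_mollify volume _ hf.norm)).integrable_of_hasCompactSupport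
      (hφ.compact.comp_left (g := abs) abs_zero).mul_right
  · filter_upwards [(ae_restrict_iff' hΩm).1 hZ] with x hx
    by_cases hxΩ : x ∈ Ω
    · simp only [Zc, indicator_of_mem hxΩ]
      rw [norm_mul, Real.norm_eq_abs, mul_left_comm]
      refine mul_le_mul_of_nonneg_left ?_ (abs_nonneg _)
      refine (abs_sum_mul_mollify_le hf (ρ n) (block Sum.inl (z x)) x).trans ?_
      refine mul_le_mul_of_nonneg_right (hx hxΩ) ?_
      exact integral_nonneg fun y => mul_nonneg (norm_nonneg _) ((ρ n).nonneg_normed _)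
    · simp [hφ.eq_zero hxΩ]

end PairingBound

/-! ### Vector measures as densities with respect to finite measures. -/

section VectorMeasures

variable {X : Type*} [MeasurableSpace X]

theorem isFiniteMeasure_variation_withDensityᵥ {G : Type*} [NormedAddCommGroup G]
    [NormedSpace ℝ G] [CompleteSpace G] {m : Measure X} {f : X → G} (hf : Integrable f m) :
    IsFiniteMeasure (m.withDensityᵥ f).variation := by
  rw [Measure.variation_withDensityᵥ hf]
  exact isFiniteMeasure_withDensity hf.2.ne

/-- The bridge from integration against a vector measure to the Bochner integral: indicators, then
simple functions, then bounded pointwise approximation. -/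
theorem integral_withDensityᵥ {G : Type*} [NormedAddCommGroup G]
    [NormedSpace ℝ G] [CompleteSpace G] {m : Measure X} {f : X → G} (hf : Integrable f m)
    {φ : X → ℝ} (hφ : StronglyMeasurable φ) {C : ℝ} (hC : ∀ x, ‖φ x‖ ≤ C) :
    ∫ᵛ x, φ x ∂•(m.withDensityᵥ f) = ∫ x, φ x • f x ∂m := by
  have := isFiniteMeasure_variation_withDensityᵥ hf
  rcases isEmpty_or_nonempty X with hX | ⟨⟨x₀⟩⟩
  · simp [VectorMeasure.integral_of_isEmpty, Measure.eq_zero_of_isEmpty]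
  have hC0 : 0 ≤ C := (norm_nonneg _).trans (hC x₀)
  have hb : ∀ (s : SimpleFunc X ℝ), ∃ D, ∀ x, ‖s x‖ ≤ D := fun s => s.exists_forall_norm_le
  have hs : ∀ s : SimpleFunc X ℝ, ∫ᵛ x, s x ∂•(m.withDensityᵥ f) = ∫ x, s x • f x ∂m := by
    intro s
    induction s using SimpleFunc.induction with
    | const c hA =>
      rename_i A
      simp only [SimpleFunc.const_zero, SimpleFunc.coe_piecewise, SimpleFunc.coe_const,
        SimpleFunc.coe_zero, piecewise_eq_indicator]
      have h1 := VectorMeasure.integral_indicator_const (μ := m.withDensityᵥ f)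
        (B := ContinuousLinearMap.lsmul ℝ ℝ) c hA
      refine (Eq.trans ?_ h1).trans ?_
      · rfl
      · rw [withDensityᵥ_apply hf hA, ← integral_indicator hA,
          ContinuousLinearMap.lsmul_apply, ← integral_smul]
        refine integral_congr_ae (ae_of_all _ fun x => ?_)
        by_cases hx : x ∈ A <;> simp [hx]
    | add _ hs ht =>
      rename_i s t _
      have hint : ∀ s : SimpleFunc X ℝ, Integrable s (m.withDensityᵥ f).variation := fun s => by
        obtain ⟨D, hD⟩ := hb s
        exact Integrable.of_bound s.stronglyMeasurable.aestronglyMeasurable D (ae_of_all _ hD)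
      have hint' : ∀ s : SimpleFunc X ℝ, Integrable (fun x => s x • f x) m := fun s => by
        obtain ⟨D, hD⟩ := hb s
        exact hf.bdd_smul D s.stronglyMeasurable.aestronglyMeasurable (ae_of_all _ hD)
      simp only [SimpleFunc.coe_add, Pi.add_apply, add_smul]
      rw [VectorMeasure.integral_fun_add (hint s) (hint t), hs, ht,
        integral_add (hint' s) (hint' t)]
  have l1 : Tendsto (fun n => ∫ᵛ x, hφ.approxBounded C n x ∂•(m.withDensityᵥ f)) atTop
      (nhds (∫ᵛ x, φ x ∂•(m.withDensityᵥ f))) :=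
    VectorMeasure.tendsto_integral_of_dominated_convergence (fun _ => C)
    (fun n => (hφ.approxBounded C n).stronglyMeasurable.aestronglyMeasurable)
    (integrable_const C) (fun n => ae_of_all _ (hφ.norm_approxBounded_le hC0 n))
    (ae_of_all _ fun x => hφ.tendsto_approxBounded_of_norm_le (hC x))
  have l2 : Tendsto (fun n => ∫ x, hφ.approxBounded C n x • f x ∂m) atTop
      (nhds (∫ x, φ x • f x ∂m)) := by
    refine tendsto_integral_of_dominated_convergence (fun x => C * ‖f x‖)
      (fun n => (hφ.approxBounded C n).stronglyMeasurable.aestronglyMeasurable.smul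
        hf.aestronglyMeasurable) (hf.norm.const_mul C) (fun n => ae_of_all _ fun x => ?_)
      (ae_of_all _ fun x => (hφ.tendsto_approxBounded_of_norm_le (hC x)).smul_const _)
    rw [norm_smul]
    exact mul_le_mul_of_nonneg_right (hφ.norm_approxBounded_le hC0 n x) (norm_nonneg _)
  exact tendsto_nhds_unique l1 (l2.congr fun n => (hs _).symm)

/-- A vector measure with values in a finite-dimensional space which is concentrated on `Ω` has a
density with respect to a finite measure concentrated on `Ω`. -/
theorem exists_eq_withDensityᵥ {κ : Type*} [Fintype κ] {Ω : Set X} (hΩ : MeasurableSet Ω)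
    (μ : VectorMeasure X (EuclideanSpace ℝ κ))
    (hμ : ∀ B, MeasurableSet B → Disjoint B Ω → μ B = 0) :
    ∃ (m : Measure X) (f : X → EuclideanSpace ℝ κ), IsFiniteMeasure m ∧ m Ωᶜ = 0 ∧
      Measurable f ∧ Integrable f m ∧ μ = m.withDensityᵥ f := by
  let pr : κ → EuclideanSpace ℝ κ →L[ℝ] ℝ := fun j => EuclideanSpace.proj j
  let s : κ → SignedMeasure X := fun j =>
    μ.mapRange (pr j).toLinearMap.toAddMonoidHom (pr j).continuous
  -- The sum of the variations of the components dominates each of them, so Radon–Nikodym applies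
  -- componentwise.
  let m₀ : Measure X := ∑ j, (s j).totalVariation
  have hm₀ : IsFiniteMeasure m₀ := by
    have : ∀ j, IsFiniteMeasure (s j).totalVariation := fun j => by
      unfold SignedMeasure.totalVariation; infer_instance
    infer_instance
  have hac : ∀ j, s j ≪ᵥ m₀.toENNRealVectorMeasure := fun j => by
    rw [SignedMeasure.absolutelyContinuous_ennreal_iff,
      show m₀.toENNRealVectorMeasure.ennrealToMeasure = m₀ from
        VectorMeasure.equivMeasure.right_inv m₀]
    intro B hB
    have h1 : ∑ i, (s i).totalVariation B = 0 := by
      rw [← hB]; simp [m₀]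
    exact (Finset.sum_eq_zero_iff.1 h1) j (Finset.mem_univ _)
  let f : X → EuclideanSpace ℝ κ := fun x => WithLp.toLp 2 fun j => (s j).rnDeriv m₀ x
  have hfm : Measurable f := (MeasurableEquiv.toLp 2 (κ → ℝ)).measurable.comp
    (measurable_pi_lambda _ fun j => SignedMeasure.measurable_rnDeriv _ _)
  have hfi : Integrable f m₀ := by
    refine ⟨hfm.aestronglyMeasurable, ?_⟩
    refine (integrable_finsetSum Finset.univ fun j _ =>
      (SignedMeasure.integrable_rnDeriv (s j) m₀).norm).2.mono (ae_of_all _ fun x => ?_)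
    have h1 : ‖f x‖ ≤ ∑ j, ‖(s j).rnDeriv m₀ x‖ := by
      have h2 : f x = ∑ j, (s j).rnDeriv m₀ x • EuclideanSpace.basisFun κ ℝ j := by
        conv_lhs => rw [← (EuclideanSpace.basisFun κ ℝ).sum_repr (f x)]
        simp [f]
      rw [h2]
      refine (norm_sum_le _ _).trans (Finset.sum_le_sum fun j _ => ?_)
      rw [norm_smul, (EuclideanSpace.basisFun κ ℝ).norm_eq_one, mul_one]
    exact h1.trans (le_abs_self _)
  have hμf : ∀ B, MeasurableSet B → μ B = ∫ x in B, f x ∂m₀ := fun B hB => by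
    ext j
    have h1 : (μ B) j = s j B := rfl
    have h2 : (∫ x in B, f x ∂m₀) j = ∫ x in B, (f x) j ∂m₀ :=
      ((pr j).integral_comp_comm hfi.integrableOn).symm
    rw [h1, h2, ← SignedMeasure.withDensityᵥ_rnDeriv_eq (s j) m₀ (hac j),
      withDensityᵥ_apply (SignedMeasure.integrable_rnDeriv _ _) hB]
  refine ⟨m₀.restrict Ω, f, inferInstance, by simp [Measure.restrict_apply hΩ.compl],
    hfm, hfi.restrict, ?_⟩
  ext1 B hB
  rw [withDensityᵥ_apply hfi.restrict hB, Measure.restrict_restrict hB,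
    ← hμf _ (hB.inter hΩ), ← inter_union_sdiff B Ω,
    VectorMeasure.of_union (disjoint_sdiff_inter.symm) (hB.inter hΩ) (hB.diff hΩ),
    hμ (B \ Ω) (hB.diff hΩ) disjoint_sdiff_left, add_zero, inter_union_sdiff]

theorem withDensityᵥ_apply_eq_zero {G : Type*} [NormedAddCommGroup G]
    [NormedSpace ℝ G] [CompleteSpace G] {m : Measure X} {f : X → G} (hf : Integrable f m)
    {Ω : Set X} (hm : m Ωᶜ = 0) {B : Set X} (hB : MeasurableSet B) (hd : Disjoint B Ω) :
    m.withDensityᵥ f B = 0 := by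
  rw [withDensityᵥ_apply hf hB, Measure.restrict_eq_zero.2
    (measure_mono_null (subset_compl_iff_disjoint_right.2 hd) hm), integral_zero_measure]

end VectorMeasures

/-! ### Uniqueness of distributional gradients and divergences; passage to densities. -/

section Gradients

variable {ι κ : Type*} [Fintype ι] [Fintype κ] {Ω : Set (EuclideanSpace ℝ ι)}
  {e : κ → ι} {u : EuclideanSpace ℝ ι → ℝ}

/-- The coordinate directions `e`. -/
abbrev coordDir {ι κ : Type*} [DecidableEq ι] (e : κ → ι) (j : κ) : EuclideanSpace ℝ ι :=
  EuclideanSpace.single (e j) 1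

theorem IsTest.integral_withDensityᵥ {G : Type*} [NormedAddCommGroup G]
    [NormedSpace ℝ G] [CompleteSpace G] {m : Measure (EuclideanSpace ℝ ι)}
    {f : EuclideanSpace ℝ ι → G} (hf : Integrable f m) {φ : EuclideanSpace ℝ ι → ℝ}
    (hφ : IsTest Ω φ) : ∫ᵛ x, φ x ∂•(m.withDensityᵥ f) = ∫ x, φ x • f x ∂m := by
  obtain ⟨C, hC⟩ := hφ.exists_bound
  exact AnisoPairing.integral_withDensityᵥ hf hφ.continuous.stronglyMeasurable hC

theorem setIntegral_smul_eq_integral {E G : Type*} [NormedAddCommGroup E] [NormedSpace ℝ E]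
    [MeasurableSpace E] {ν : Measure E} [NormedAddCommGroup G] [NormedSpace ℝ G] {Ω : Set E}
    {φ : E → ℝ} (hφ : ∀ x, x ∉ Ω → φ x = 0) (g : E → G) :
    ∫ x in Ω, φ x • g x ∂ν = ∫ x, φ x • g x ∂ν :=
  setIntegral_eq_integral_of_forall_compl_eq_zero fun x hx => by rw [hφ x hx, zero_smul]

theorem IsTest.integrable_smul_of_locallyIntegrableOn {G : Type*} [NormedAddCommGroup G]
    [NormedSpace ℝ G] {φ : EuclideanSpace ℝ ι → ℝ} (hφ : IsTest Ω φ)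
    {g : EuclideanSpace ℝ ι → G} (hg : LocallyIntegrableOn g Ω) :
    Integrable (fun x => φ x • g x) := by
  have h1 : IntegrableOn g (tsupport φ) := hg.integrableOn_compact_subset hφ.supp hφ.compact
  obtain ⟨C, hC⟩ := hφ.exists_bound
  have h2 : IntegrableOn (fun x => φ x • g x) (tsupport φ) :=
    h1.bdd_smul C hφ.continuous.aestronglyMeasurable (ae_of_all _ hC)
  exact (integrableOn_iff_integrable_of_support_subset
    ((Function.support_smul_subset_left φ g).trans (subset_tsupport φ))).1 h2

/-- The fundamental lemma of the calculus of variations. It makes the chosen representatives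
`weakGrad` and `weakDiv` agree a.e. with any others. -/
theorem ae_eq_of_setIntegral_test_smul_eq {G : Type*} [NormedAddCommGroup G] [NormedSpace ℝ G]
    [CompleteSpace G] (hΩ : IsOpen Ω)
    {g g' : EuclideanSpace ℝ ι → G} (hg : LocallyIntegrableOn g Ω) (hg' : LocallyIntegrableOn g' Ω)
    (h : ∀ φ, IsTest Ω φ → ∫ x in Ω, φ x • g x = ∫ x in Ω, φ x • g' x) :
    g =ᵐ[volume.restrict Ω] g' := by
  have h1 := hΩ.ae_eq_zero_of_integral_contDiff_smul_eq_zero (μ := volume) (hg.sub hg')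
    fun φ h1 h2 h3 => by
      have hφ : IsTest Ω φ := ⟨h1, h2, h3⟩
      have h4 := h φ hφ
      rw [setIntegral_smul_eq_integral fun x hx => hφ.eq_zero hx,
        setIntegral_smul_eq_integral fun x hx => hφ.eq_zero hx] at h4
      simp only [Pi.sub_apply, smul_sub]
      rw [integral_sub (hφ.integrable_smul_of_locallyIntegrableOn hg)
        (hφ.integrable_smul_of_locallyIntegrableOn hg'), h4, sub_self]
  filter_upwards [(ae_restrict_iff' hΩ.measurableSet).2 h1] with x hx
  exact sub_eq_zero.1 hx

theorem weakDiv_ae_eq (hΩ : IsOpen Ω) {z : EuclideanSpace ℝ ι → EuclideanSpace ℝ ι}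
    {g : EuclideanSpace ℝ ι → ℝ}
    (hg : IsWeakDiv Ω z g) : weakDiv Ω z =ᵐ[volume.restrict Ω] g := by
  have h : ∃ g, IsWeakDiv Ω z g := ⟨g, hg⟩
  rw [weakDiv, dif_pos h]
  refine ae_eq_of_setIntegral_test_smul_eq hΩ h.choose_spec.locInt hg.locInt fun φ hφ => ?_
  simp only [smul_eq_mul]
  rw [hg.byParts φ hφ, h.choose_spec.byParts φ hφ]

variable [DecidableEq ι]

/-- Both sides are compared coordinate by coordinate; the integrability of `f` and `u` lets
projections pass through the integrals. -/
theorem integral_smul_eq_iff {m : Measure (EuclideanSpace ℝ ι)}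
    {f : EuclideanSpace ℝ ι → EuclideanSpace ℝ κ} (hf : Integrable f m)
    (hu : IntegrableOn u Ω) :
    (∀ φ, IsTest Ω φ → ∫ x, φ x • f x ∂m = -∫ x in Ω, u x • partialGrad e φ x) ↔
      HasGrad volume Ω (coordDir e) u m f := by
  have h1 : ∀ φ, IsTest Ω φ → ∀ j, (∫ x, φ x • f x ∂m) j = ∫ x, φ x * f x j ∂m :=
    fun φ hφ j => by
      obtain ⟨C, hC⟩ := hφ.exists_bound
      exact ((EuclideanSpace.proj j : EuclideanSpace ℝ κ →L[ℝ] ℝ).integral_comp_comm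
        (hf.bdd_smul C hφ.continuous.aestronglyMeasurable (ae_of_all _ hC))).symm
  have h2 : ∀ φ, IsTest Ω φ → ∀ j, (-∫ x in Ω, u x • partialGrad e φ x) j =
      -∫ x in Ω, u x * fderiv ℝ φ x (coordDir e j) := fun φ hφ j => by
    have hint : Integrable (fun x => u x • partialGrad e φ x) (volume.restrict Ω) := by
      have hpg : ∀ x, u x • partialGrad e φ x = WithLp.toLp 2 fun j =>
          fderiv ℝ φ x (coordDir e j) * u x := fun x => by
        ext j
        simp [partialGrad, mul_comm]
      simp only [hpg]
      have h3 := fun j => (hφ.fderiv_apply (coordDir e j)).integrable_mul hu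
      exact (PiLp.continuousLinearEquiv 2 ℝ (fun _ : κ => ℝ)).symm.toContinuousLinearMap.integrable_comp
        (Integrable.of_eval h3)
    have h4 := ((EuclideanSpace.proj j : EuclideanSpace ℝ κ →L[ℝ] ℝ).integral_comp_comm hint).symm
    exact congrArg Neg.neg h4
  constructor
  · intro h j φ hφ
    rw [← h1 φ hφ, h φ hφ, h2 φ hφ]
  · intro h φ hφ
    ext j
    rw [h1 φ hφ, h2 φ hφ]
    exact h j φ hφ

theorem isGradMeasure_withDensityᵥ_iff {m : Measure (EuclideanSpace ℝ ι)}
    (hm : m Ωᶜ = 0) {f : EuclideanSpace ℝ ι → EuclideanSpace ℝ κ} (hf : Integrable f m)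
    (hu : IntegrableOn u Ω) :
    IsGradMeasure Ω e u (m.withDensityᵥ f) ↔ HasGrad volume Ω (coordDir e) u m f := by
  rw [← integral_smul_eq_iff hf hu]
  constructor
  · intro h φ hφ
    rw [← hφ.integral_withDensityᵥ hf]
    exact h.byParts φ hφ
  · intro h
    refine ⟨fun B hB hd => withDensityᵥ_apply_eq_zero hf hm hB hd, fun φ hφ => ?_⟩
    rw [hφ.integral_withDensityᵥ hf]
    exact h φ hφ

theorem IsGradMeasure.exists_hasGrad (hΩ : IsOpen Ω) (hu : IntegrableOn u Ω)
    {μ : VectorMeasure (EuclideanSpace ℝ ι) (EuclideanSpace ℝ κ)} (hμ : IsGradMeasure Ω e u μ) :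
    ∃ (m : Measure (EuclideanSpace ℝ ι)) (f : EuclideanSpace ℝ ι → EuclideanSpace ℝ κ),
      IsFiniteMeasure m ∧ m Ωᶜ = 0 ∧ Measurable f ∧ Integrable f m ∧ μ = m.withDensityᵥ f ∧
      HasGrad volume Ω (coordDir e) u m f := by
  obtain ⟨m, f, hfin, hm, hfm, hf, rfl⟩ := exists_eq_withDensityᵥ hΩ.measurableSet μ hμ.concentrated
  exact ⟨m, f, hfin, hm, hfm, hf, rfl, (isGradMeasure_withDensityᵥ_iff hm hf hu).1 hμ⟩

/-- The difference of two gradient measures is a gradient measure of `0`; its density vanishes by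
`HasGrad.ae_eq`. -/
theorem IsGradMeasure.unique (hΩ : IsOpen Ω)
    {μ μ' : VectorMeasure (EuclideanSpace ℝ ι) (EuclideanSpace ℝ κ)} (hμ : IsGradMeasure Ω e u μ)
    (hμ' : IsGradMeasure Ω e u μ') : μ = μ' := by
  obtain ⟨m, f, hfin, hm, -, hf, hmf⟩ := exists_eq_withDensityᵥ hΩ.measurableSet (μ - μ')
    fun B hB hd => by simp [hμ.concentrated B hB hd, hμ'.concentrated B hB hd]
  have hvar : ∀ μ : VectorMeasure (EuclideanSpace ℝ ι) (EuclideanSpace ℝ κ),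
      IsFiniteMeasure μ.variation := fun μ => by
    obtain ⟨m, f, -, -, -, hf, rfl⟩ := exists_eq_withDensityᵥ MeasurableSet.univ μ
      fun B _ hd => by rw [disjoint_univ.1 hd, VectorMeasure.empty]
    exact isFiniteMeasure_variation_withDensityᵥ hf
  have h0 : HasGrad volume Ω (coordDir e) (fun _ => 0) m f := by
    refine (integral_smul_eq_iff hf integrableOn_zero).1 fun φ hφ => ?_
    have hint : ∀ μ : VectorMeasure (EuclideanSpace ℝ ι) (EuclideanSpace ℝ κ),
        μ.Integrable φ := fun μ => by
      have := hvar μ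
      exact hφ.integrable
    rw [← hφ.integral_withDensityᵥ hf, ← hmf,
      VectorMeasure.integral_sub_vectorMeasure (hint μ) (hint μ'), hμ.byParts φ hφ,
      hμ'.byParts φ hφ]
    simp
  have h0' : HasGrad volume Ω (coordDir e) (fun _ => 0) m (fun _ => (0 : EuclideanSpace ℝ κ)) :=
    fun j φ hφ => by simp
  have hf0 := h0.ae_eq hΩ hm h0' hf (integrable_zero _ _ _)
  rw [← sub_eq_zero, hmf, WithDensityᵥEq.congr_ae hf0]
  exact withDensityᵥ_zero

theorem gradMeasure_eq (hΩ : IsOpen Ω)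
    {μ : VectorMeasure (EuclideanSpace ℝ ι) (EuclideanSpace ℝ κ)} (hμ : IsGradMeasure Ω e u μ) :
    gradMeasure Ω e u = μ := by
  have h : ∃ μ, IsGradMeasure Ω e u μ := ⟨μ, hμ⟩
  rw [gradMeasure, dif_pos h]
  exact h.choose_spec.unique hΩ hμ

theorem isWeakGrad_iff {g : EuclideanSpace ℝ ι → EuclideanSpace ℝ κ} (hg : IntegrableOn g Ω)
    (hu : IntegrableOn u Ω) :
    IsWeakGrad Ω e u g ↔ HasGrad volume Ω (coordDir e) u (volume.restrict Ω) g := by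
  rw [← integral_smul_eq_iff hg hu]
  exact ⟨fun h => h.byParts, fun h => ⟨hg.locallyIntegrableOn, h⟩⟩

theorem weakGrad_ae_eq (hΩ : IsOpen Ω) {g : EuclideanSpace ℝ ι → EuclideanSpace ℝ κ}
    (hg : IsWeakGrad Ω e u g) : weakGrad Ω e u =ᵐ[volume.restrict Ω] g := by
  have h : ∃ g, IsWeakGrad Ω e u g := ⟨g, hg⟩
  rw [weakGrad, dif_pos h]
  refine ae_eq_of_setIntegral_test_smul_eq hΩ h.choose_spec.locInt hg.locInt fun φ hφ => ?_
  rw [hg.byParts φ hφ, h.choose_spec.byParts φ hφ]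

end Gradients

/-! ### Primitives of indicator functions on the line. -/

section Primitive

/-- The primitive, vanishing at `0`, of the indicator function of `A`. -/
def indicatorPrimitive (A : Set ℝ) (t : ℝ) : ℝ := ∫ x in (0 : ℝ)..t, A.indicator 1 x

variable {A : Set ℝ}

theorem intervalIntegrable_indicator_one (hA : MeasurableSet A) (a b : ℝ) :
    IntervalIntegrable (A.indicator (1 : ℝ → ℝ)) volume a b := by
  have h1 : IntervalIntegrable (1 : ℝ → ℝ) volume a b := intervalIntegrable_const (c := (1 : ℝ))
  exact ⟨h1.1.indicator hA, h1.2.indicator hA⟩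

theorem indicatorPrimitive_sub (hA : MeasurableSet A) (a b : ℝ) :
    indicatorPrimitive A b - indicatorPrimitive A a = ∫ x in a..b, A.indicator 1 x :=
  intervalIntegral.integral_interval_sub_left (intervalIntegrable_indicator_one hA _ _)
    (intervalIntegrable_indicator_one hA _ _)

theorem indicatorPrimitive_sub_monotone {B : Set ℝ} (hA : MeasurableSet A) (hB : MeasurableSet B)
    (hBA : B ⊆ A) : Monotone fun t => indicatorPrimitive A t - indicatorPrimitive B t := by
  intro s t hst
  have h1 := indicatorPrimitive_sub hA s t
  have h2 := indicatorPrimitive_sub hB s t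
  have h3 : ∫ x in s..t, B.indicator (1 : ℝ → ℝ) x ≤ ∫ x in s..t, A.indicator (1 : ℝ → ℝ) x :=
    intervalIntegral.integral_mono_on hst (intervalIntegrable_indicator_one hB _ _)
      (intervalIntegrable_indicator_one hA _ _)
      fun x _ => indicator_le_indicator_of_subset hBA (fun _ => zero_le_one) x
  simp only
  linarith

theorem indicatorPrimitive_monotone (hA : MeasurableSet A) : Monotone (indicatorPrimitive A) := by
  intro s t hst
  have := indicatorPrimitive_sub_monotone hA MeasurableSet.empty (empty_subset A) hst
  simpa [indicatorPrimitive] using this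

theorem indicatorPrimitive_add_compl (hA : MeasurableSet A) (t : ℝ) :
    indicatorPrimitive A t + indicatorPrimitive Aᶜ t = t := by
  rw [indicatorPrimitive, indicatorPrimitive, ← intervalIntegral.integral_add
    (intervalIntegrable_indicator_one hA _ _) (intervalIntegrable_indicator_one hA.compl _ _)]
  have h : ∀ x, A.indicator (1 : ℝ → ℝ) x + Aᶜ.indicator (1 : ℝ → ℝ) x = 1 := fun x => by
    by_cases hx : x ∈ A <;> simp [hx]
  simp [h]

theorem indicatorPrimitive_lipschitz (hA : MeasurableSet A) :
    LipschitzWith 1 (indicatorPrimitive A) := by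
  refine LipschitzWith.of_dist_le_mul fun s t => ?_
  wlog hst : s ≤ t generalizing s t
  · rw [dist_comm, dist_comm s]
    exact this t s (le_of_not_ge hst)
  · have h1 := indicatorPrimitive_monotone hA hst
    have h2 := indicatorPrimitive_monotone hA.compl hst
    have h3 := indicatorPrimitive_add_compl hA s
    have h4 := indicatorPrimitive_add_compl hA t
    rw [Real.dist_eq, Real.dist_eq, abs_sub_comm, abs_of_nonneg (by linarith), abs_sub_comm,
      abs_of_nonneg (by linarith)]
    simp only [NNReal.coe_one, one_mul]
    linarith

theorem abs_indicatorPrimitive_le (hA : MeasurableSet A) (t : ℝ) :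
    |indicatorPrimitive A t| ≤ |t| := by
  have h1 := (indicatorPrimitive_lipschitz hA).dist_le_mul t 0
  have h2 : indicatorPrimitive A 0 = 0 := by simp [indicatorPrimitive]
  simpa [h2, Real.dist_eq] using h1

theorem tendsto_indicatorPrimitive {A : ℕ → Set ℝ} (hA : ∀ n, MeasurableSet (A n))
    (h : ∀ᵐ x, ∀ᶠ n in atTop, x ∉ A n) (t : ℝ) :
    Tendsto (fun n => indicatorPrimitive (A n) t) atTop (nhds 0) := by
  have h1 : Tendsto (fun n => ∫ x in (0 : ℝ)..t, (A n).indicator (1 : ℝ → ℝ) x) atTop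
      (nhds (∫ x in (0 : ℝ)..t, (0 : ℝ))) := by
    refine intervalIntegral.tendsto_integral_filter_of_dominated_convergence (fun _ => (1 : ℝ))
      (Eventually.of_forall fun n => (measurable_one.indicator (hA n)).aestronglyMeasurable)
      (Eventually.of_forall fun n => ae_of_all _ fun x _ => ?_) intervalIntegrable_const ?_
    · refine (norm_indicator_le_norm_self _ _).trans ?_
      simp
    · filter_upwards [h] with x hx _
      refine tendsto_const_nhds.congr' ?_
      filter_upwards [hx] with n hn
      rw [indicator_of_notMem hn]
  simpa [indicatorPrimitive] using h1

/-- Where the derivative of a monotone function `T` is at least `c⁻¹`, the function `c T` grows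
at least as fast as the identity. -/
theorem mul_sub_indicatorPrimitive_monotone {T : ℝ → ℝ} (hT : Monotone T) {c : ℝ} (hc : 0 ≤ c)
    (hA : MeasurableSet A) (h : ∀ x ∈ A, 1 ≤ c * deriv T x) :
    Monotone fun t => c * T t - indicatorPrimitive A t := by
  intro s t hst
  have h1 := indicatorPrimitive_sub hA s t
  -- Only the inequality valid for every monotone function is needed.
  have h2 : ∫ x in s..t, deriv T x ≤ T t - T s := by
    have := (hT.monotoneOn (uIcc s t)).intervalIntegral_deriv_mem_uIcc
    rw [uIcc_of_le (sub_nonneg.2 (hT hst))] at this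
    exact this.2
  have h3 : ∫ x in s..t, A.indicator (1 : ℝ → ℝ) x ≤ ∫ x in s..t, c * deriv T x := by
    refine intervalIntegral.integral_mono_on hst (intervalIntegrable_indicator_one hA _ _)
      (((hT.monotoneOn (uIcc s t)).intervalIntegrable_deriv).const_mul c) fun x _ => ?_
    by_cases hx : x ∈ A
    · rw [indicator_of_mem hx]; exact h x hx
    · rw [indicator_of_notMem hx]
      exact mul_nonneg hc hT.deriv_nonneg
  rw [intervalIntegral.integral_const_mul] at h3
  simp only
  nlinarith [mul_le_mul_of_nonneg_left h2 hc]

end Primitive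

/-! ### Nonvanishing of the chain rule density when `T' > 0` almost everywhere. -/

section Positivity

variable {E : Type*} [NormedAddCommGroup E] [NormedSpace ℝ E] [FiniteDimensional ℝ E]
  [MeasurableSpace E] [BorelSpace E] {ν : Measure E} [ν.IsAddHaarMeasure]
  {κ : Type*} [Fintype κ] {Ω : Set E} {d : κ → E} {u : E → ℝ} {m : Measure E}
  {f : E → EuclideanSpace ℝ κ}

/-- If `T' > 0` almost everywhere, the density of the gradient of `T ∘ u` with respect to that of
`u` does not vanish. -/
theorem HasGrad.ae_ne_zero_of_deriv_pos (hΩ : IsOpen Ω) (hΩb : Bornology.IsBounded Ω)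
    [IsFiniteMeasure m] (hm : m Ωᶜ = 0) (h : HasGrad ν Ω d u m f) (hu : IntegrableOn u Ω ν)
    (hf : Integrable f m) {T : ℝ → ℝ} {K : ℝ≥0} (hT : LipschitzWith K T) (hTm : Monotone T)
    (hTpos : ∀ᵐ t, 0 < deriv T t) {a : E → ℝ} (ham : Measurable a)
    (haK : ∀ x, |a x| ≤ K) (ha : HasGrad ν Ω d (fun x => T (u x)) m (fun x => a x • f x)) :
    ∀ᵐ x ∂m, a x = 0 → f x = 0 := by
  -- The sets where `T' < 1/(n+1)`: they decrease, and almost every point eventually leaves them.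
  let A : ℕ → Set ℝ := fun n => {t | ((n : ℝ) + 1) * deriv T t < 1}
  have hA : ∀ n, MeasurableSet (A n) := fun n =>
    measurableSet_lt ((measurable_deriv T).const_mul _) measurable_const
  have hA_anti : ∀ n, A (n + 1) ⊆ A n := fun n t ht => by
    simp only [A, mem_ofPred_eq] at ht ⊢
    push_cast at ht
    have : 0 ≤ deriv T t := hTm.deriv_nonneg
    nlinarith
  have hA_lim : ∀ᵐ t, ∀ᶠ n in atTop, t ∉ A n := by
    filter_upwards [hTpos] with t ht
    obtain ⟨N, hN⟩ := exists_nat_gt (deriv T t)⁻¹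
    filter_upwards [eventually_ge_atTop N] with n hn
    simp only [A, mem_ofPred_eq, not_lt]
    have h1 : (deriv T t)⁻¹ ≤ (n : ℝ) + 1 := by
      have : (N : ℝ) ≤ n := by exact_mod_cast hn
      linarith
    calc (1 : ℝ) = (deriv T t)⁻¹ * deriv T t := (inv_mul_cancel₀ ht.ne').symm
      _ ≤ _ := mul_le_mul_of_nonneg_right h1 ht.le
  have : IsFiniteMeasure (ν.restrict Ω) := ⟨by simpa using hΩb.measure_lt_top⟩
  have comp : ∀ {F : ℝ → ℝ} {C : ℝ≥0}, LipschitzWith C F → IntegrableOn (fun x => F (u x)) Ω ν :=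
    fun hF => integrableOn_comp_lipschitz hF hu
  have hRl := fun n => indicatorPrimitive_lipschitz (hA n)
  have hSl := fun n => indicatorPrimitive_lipschitz (hA n).compl
  -- The densities `r`, `s`, `δ`, `v` belong to `R_n`, `S_n`, `R_n - R_{n+1}` and `(n+1) T - S_n`.
  -- All four functions are monotone, so all four densities are nonnegative.
  choose r hrm hr0 hr1 hr using fun n =>
    h.exists_comp_monotone hΩ hΩb hm hu hf (hRl n) (indicatorPrimitive_monotone (hA n))
  choose s hsm hs0 hs1 hs using fun n =>
    h.exists_comp_monotone hΩ hΩb hm hu hf (hSl n) (indicatorPrimitive_monotone (hA n).compl)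
  choose δ hδm hδ0 hδ1 hδ using fun n =>
    h.exists_comp_monotone hΩ hΩb hm hu hf ((hRl n).sub (hRl (n + 1)))
      (indicatorPrimitive_sub_monotone (hA n) (hA (n + 1)) (hA_anti n))
  have hcT : ∀ n : ℕ, LipschitzWith (‖(n : ℝ) + 1‖₊ * K) (fun t => ((n : ℝ) + 1) * T t) :=
    fun n => (lipschitzWith_smul ((n : ℝ) + 1)).comp hT
  choose v hvm hv0 hv1 hv using fun n =>
    h.exists_comp_monotone hΩ hΩb hm hu hf ((hcT n).sub (hSl n))
      (mul_sub_indicatorPrimitive_monotone hTm (by positivity) (hA n).compl fun x hx => by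
        simpa [A] using hx)
  have int : ∀ {b : E → ℝ} {C : ℝ}, Measurable b → (∀ x, |b x| ≤ C) →
      Integrable (fun x => b x • f x) m := fun hb hC =>
    hf.bdd_smul _ hb.aestronglyMeasurable (ae_of_all _ hC)
  have int0 : ∀ {b : E → ℝ} {C : ℝ}, Measurable b → (∀ x, 0 ≤ b x) → (∀ x, b x ≤ C) →
      Integrable (fun x => b x • f x) m := fun hb h0 hC =>
    int hb fun x => (abs_of_nonneg (h0 x)).trans_le (hC x)
  have ir := fun n => int0 (hrm n) (hr0 n) (hr1 n)
  have is := fun n => int0 (hsm n) (hs0 n) (hs1 n)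
  have iδ := fun n => int0 (hδm n) (hδ0 n) (hδ1 n)
  have iv := fun n => int0 (hvm n) (hv0 n) (hv1 n)
  have ia := int ham haK
  -- the relations between the densities
  have e1 : ∀ n, ∀ᵐ x ∂m, (r n x + s n x) • f x = f x := fun n => by
    have h1 := (hs n).linear_comb (hr n) (is n) (ir n) (comp (hSl n)) (comp (hRl n)) 1
    simp only [one_mul, indicatorPrimitive_add_compl (hA n)] at h1
    filter_upwards [h1.ae_eq hΩ hm h ((ir n).add ((is n).smul (1 : ℝ))) hf] with x hx
    rw [one_smul] at hx
    rw [add_smul, hx]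
  have e2 : ∀ n, ∀ᵐ x ∂m, (r n x - r (n + 1) x) • f x = δ n x • f x := fun n => by
    have h1 := (hr (n + 1)).linear_comb (hr n) (ir (n + 1)) (ir n) (comp (hRl (n + 1)))
      (comp (hRl n)) (-1)
    simp only [neg_one_mul, ← sub_eq_add_neg] at h1
    filter_upwards [h1.ae_eq hΩ hm (hδ n) ((ir n).add ((ir (n + 1)).smul (-1 : ℝ))) (iδ n)]
      with x hx
    rw [← hx, sub_smul, neg_one_smul, sub_eq_add_neg]
  -- The combination `((n+1) T - S_n) - (n+1) T + S_n` is zero, hence so is the corresponding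
  -- combination of densities times `f`.
  have e3 : ∀ n : ℕ, ∀ᵐ x ∂m, (((n : ℝ) + 1) * a x - s n x) • f x = v n x • f x := fun n => by
    have h2 := ha.linear_comb (hv n) ia (iv n) (comp hT) (comp ((hcT n).sub (hSl n)))
      (-((n : ℝ) + 1))
    have h3 := (hs n).linear_comb h2 (is n) ((iv n).add (ia.smul (-((n : ℝ) + 1)))) (comp (hSl n))
      ((comp ((hcT n).sub (hSl n))).add ((comp hT).const_mul (-((n : ℝ) + 1)))) 1
    have h0 : HasGrad ν Ω d (fun _ => 0) m (fun _ => (0 : EuclideanSpace ℝ κ)) :=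
      fun j φ hφ => by simp
    have h4 : HasGrad ν Ω d (fun _ => 0) m (fun x => v n x • f x + -((n : ℝ) + 1) • a x • f x +
        (1 : ℝ) • s n x • f x) := by
      convert h3 using 2 with x
      ring
    filter_upwards [h4.ae_eq hΩ hm h0 (((iv n).add (ia.smul (-((n : ℝ) + 1)))).add
      ((is n).smul (1 : ℝ))) (integrable_zero _ _ _)] with x hx
    rw [one_smul, smul_smul, ← add_smul, ← add_smul] at hx
    rw [← sub_eq_zero, ← sub_smul, ← neg_eq_zero, ← neg_smul, ← hx]
    congr 1
    ring
  -- the limit of the densities `r n`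
  let r' : E → ℝ := fun x => ⨅ n, r n x
  have hbdd : ∀ x, BddBelow (range fun n => r n x) := fun x =>
    ⟨0, by rintro _ ⟨n, rfl⟩; exact hr0 n x⟩
  have hr'm : Measurable r' := Measurable.iInf hrm
  have hr'1 : ∀ x, |r' x| ≤ 1 := fun x => by
    rw [abs_of_nonneg (le_ciInf fun n => hr0 n x)]
    exact (ciInf_le (hbdd x) 0).trans (by simpa using hr1 0 x)
  -- Only where `f ≠ 0` do the relations make `r n x` decreasing in `n`; elsewhere both sides
  -- vanish.
  have hlim : ∀ᵐ x ∂m, Tendsto (fun n => r n x • f x) atTop (nhds (r' x • f x)) := by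
    filter_upwards [ae_all_iff.2 e2] with x hx
    by_cases hfx : f x = 0
    · simp [hfx]
    · refine Tendsto.smul_const (tendsto_atTop_ciInf ?_ (hbdd x)) _
      refine antitone_nat_of_succ_le fun n => ?_
      have := smul_left_injective ℝ hfx (hx n)
      linarith [hδ0 n x]
  -- Pass to the limit in the definition of the gradient of `R_n ∘ u`, using `R_n → 0` pointwise and
  -- `|R_n(t)| ≤ |t|`.
  have hzero : HasGrad ν Ω d (fun _ => 0) m (fun x => r' x • f x) := fun j φ hφ => by
    have hχ := hφ.fderiv_apply (d j)
    obtain ⟨C, hC⟩ := hφ.exists_bound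
    have l1 : Tendsto (fun n => ∫ x, φ x * (r n x • f x) j ∂m) atTop
        (nhds (∫ x, φ x * (r' x • f x) j ∂m)) := by
      refine tendsto_integral_of_dominated_convergence (fun x => C * ‖f x‖)
        (fun n => (hφ.integrable_mul ((ir n).euclidean_apply j)).aestronglyMeasurable)
        (hf.norm.const_mul C) (fun n => ae_of_all _ fun x => ?_) ?_
      · rw [norm_mul]
        refine mul_le_mul (hC x) ?_ (norm_nonneg _) ((norm_nonneg _).trans (hC x))
        refine (PiLp.norm_apply_le _ j).trans ?_
        rw [norm_smul, Real.norm_of_nonneg (hr0 n x)]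
        exact mul_le_of_le_one_left (norm_nonneg _) (by simpa using hr1 n x)
      · filter_upwards [hlim] with x hx
        exact (((EuclideanSpace.proj j : EuclideanSpace ℝ κ →L[ℝ] ℝ).continuous.tendsto _).comp
          hx).const_mul (φ x)
    have l2 : Tendsto (fun n => -∫ x in Ω, indicatorPrimitive (A n) (u x) * fderiv ℝ φ x (d j) ∂ν)
        atTop (nhds (-∫ x in Ω, (0 : ℝ) * fderiv ℝ φ x (d j) ∂ν)) := by
      refine Tendsto.neg (tendsto_integral_of_dominated_convergence
        (fun x => ‖fderiv ℝ φ x (d j) * u x‖)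
        (fun n => ?_) (hχ.integrable_mul hu).norm (fun n => ae_of_all _ fun x => ?_)
        (ae_of_all _ fun x => (tendsto_indicatorPrimitive hA hA_lim (u x)).mul_const _))
      · simp only [mul_comm (indicatorPrimitive _ _)]
        exact (hχ.integrable_mul (comp (hRl n))).aestronglyMeasurable
      · rw [norm_mul, norm_mul, mul_comm]
        exact mul_le_mul_of_nonneg_left (abs_indicatorPrimitive_le (hA n) _) (norm_nonneg _)
    exact tendsto_nhds_unique l1 (l2.congr fun n => (hr n j φ hφ).symm)
  have h0 : HasGrad ν Ω d (fun _ => 0) m (fun _ => (0 : EuclideanSpace ℝ κ)) :=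
    fun j φ hφ => by simp
  filter_upwards [hzero.ae_eq hΩ hm h0 (int hr'm hr'1) (integrable_zero _ _ _),
    ae_all_iff.2 e1, ae_all_iff.2 e3] with x hx0 hx1 hx3 hax
  by_contra hfx
  -- With `a x = 0`, the third relation reads `-s n x = v n x`; both being nonnegative, `s n x = 0`,
  -- and the first relation gives `r n x = 1`.
  have hrx : ∀ n, r n x = 1 := fun n => by
    have h1 := smul_left_injective ℝ hfx ((hx1 n).trans (one_smul ℝ (f x)).symm)
    have h3 := smul_left_injective ℝ hfx (hx3 n)
    simp only [hax] at h1 h3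
    linarith [hv0 n x, hs0 n x]
  have : r' x = 1 := by simp [r', hrx]
  rw [this, one_smul] at hx0
  exact hfx hx0

end Positivity

/-! ### Linearity of the pairing and comparison of pairing densities. -/

section PairingDensity

variable {κ σ : Type*} [Fintype κ] [Fintype σ] [DecidableEq κ] [DecidableEq σ]

/-- The function `w`, whose derivatives in the coordinates `σ` are the functions `g`, can be paired
with vector fields in the class dual to the exponents `q` and `a`. -/
structure IsPairable (Ω : Set (EuclideanSpace ℝ (κ ⊕ σ))) (q : ℝ≥0∞) (a : σ → ℝ≥0∞)
    (w : EuclideanSpace ℝ (κ ⊕ σ) → ℝ) (g : σ → EuclideanSpace ℝ (κ ⊕ σ) → ℝ) : Prop where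
  memLp : MemLp w q (volume.restrict Ω)
  memLp_exponent : ∀ s, MemLp w (a s) (volume.restrict Ω)
  memLp_deriv : ∀ s, MemLp (g s) (a s) (volume.restrict Ω)
  hasDeriv : ∀ s, HasDeriv volume Ω (EuclideanSpace.single (Sum.inr s) 1) w
    (volume.restrict Ω) (g s)

/-- The vector field `z` has divergence `d`, both in the classes given by the exponents `q'` and
`b`, and its components in the coordinates `κ` are bounded by `Z`. -/
structure IsPairingField (Ω : Set (EuclideanSpace ℝ (κ ⊕ σ))) (q' : ℝ≥0∞) (b : σ → ℝ≥0∞)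
    (Z : ℝ) (z : EuclideanSpace ℝ (κ ⊕ σ) → EuclideanSpace ℝ (κ ⊕ σ))
    (d : EuclideanSpace ℝ (κ ⊕ σ) → ℝ) : Prop where
  memLp_div : MemLp d q' (volume.restrict Ω)
  memLp_inl : ∀ k, MemLp (fun x => z x (Sum.inl k)) ⊤ (volume.restrict Ω)
  memLp_inr : ∀ s, MemLp (fun x => z x (Sum.inr s)) (b s) (volume.restrict Ω)
  byParts : ∀ φ, IsTest Ω φ → ∫ x in Ω, φ x * d x = -∫ x in Ω, fderiv ℝ φ x (z x)
  bound_nonneg : 0 ≤ Z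
  bound : ∀ᵐ x ∂volume.restrict Ω, ‖block Sum.inl (z x)‖ ≤ Z

variable {Ω : Set (EuclideanSpace ℝ (κ ⊕ σ))} {q q' : ℝ≥0∞} {a b : σ → ℝ≥0∞}
  {Z : ℝ} {z : EuclideanSpace ℝ (κ ⊕ σ) → EuclideanSpace ℝ (κ ⊕ σ)}
  {d w w' : EuclideanSpace ℝ (κ ⊕ σ) → ℝ} {g g' : σ → EuclideanSpace ℝ (κ ⊕ σ) → ℝ}
  {m : Measure (EuclideanSpace ℝ (κ ⊕ σ))}
  {f : EuclideanSpace ℝ (κ ⊕ σ) → EuclideanSpace ℝ κ}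

theorem IsPairable.integrableOn (hΩb : Bornology.IsBounded Ω)
    (q' : ℝ≥0∞) [ENNReal.HolderConjugate q q'] (hw : IsPairable Ω q a w g) :
    IntegrableOn w Ω := by
  have : IsFiniteMeasure (volume.restrict Ω) := ⟨by simpa using hΩb.measure_lt_top⟩
  exact hw.memLp.integrable (ENNReal.HolderConjugate.one_le q q')

theorem IsPairable.integrable_deriv (hΩb : Bornology.IsBounded Ω)
    (b : σ → ℝ≥0∞) [∀ s, ENNReal.HolderConjugate (a s) (b s)] (hw : IsPairable Ω q a w g) (s : σ) :
    IntegrableOn (g s) Ω := by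
  have : IsFiniteMeasure (volume.restrict Ω) := ⟨by simpa using hΩb.measure_lt_top⟩
  exact (hw.memLp_deriv s).integrable (ENNReal.HolderConjugate.one_le (a s) (b s))

theorem IsPairable.integrable_mul_div [ENNReal.HolderConjugate q q'] (hw : IsPairable Ω q a w g)
    (hz : IsPairingField Ω q' b Z z d) : IntegrableOn (fun x => w x * d x) Ω :=
  MemLp.integrable_mul hw.memLp hz.memLp_div

theorem IsPairable.integrable_deriv_mul [∀ s, ENNReal.HolderConjugate (a s) (b s)]
    (hw : IsPairable Ω q a w g)
    (hz : IsPairingField Ω q' b Z z d) (s : σ) :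
    IntegrableOn (fun x => g s x * z x (Sum.inr s)) Ω :=
  MemLp.integrable_mul (hw.memLp_deriv s) (hz.memLp_inr s)

variable [ENNReal.HolderConjugate q q'] [∀ s, ENNReal.HolderConjugate (a s) (b s)]

theorem IsPairable.integrable_mul_field (hΩb : Bornology.IsBounded Ω) (hw : IsPairable Ω q a w g)
    (hz : IsPairingField Ω q' b Z z d) (c : κ ⊕ σ) : IntegrableOn (fun x => w x * z x c) Ω := by
  cases c with
  | inl k =>
    exact MemLp.integrable_mul (p := 1) (q := ⊤)
      (memLp_one_iff_integrable.2 (hw.integrableOn hΩb q')) (hz.memLp_inl k)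
  | inr s => exact MemLp.integrable_mul (hw.memLp_exponent s) (hz.memLp_inr s)


theorem IsPairable.linear_comb (hΩb : Bornology.IsBounded Ω) (q' : ℝ≥0∞)
    [ENNReal.HolderConjugate q q'] (b : σ → ℝ≥0∞) [∀ s, ENNReal.HolderConjugate (a s) (b s)]
    (hw : IsPairable Ω q a w g) (hw' : IsPairable Ω q a w' g') (c : ℝ) :
    IsPairable Ω q a (fun x => w' x + c * w x) (fun s x => g' s x + c * g s x) where
  memLp := hw'.memLp.add (hw.memLp.const_mul c)
  memLp_exponent s := (hw'.memLp_exponent s).add ((hw.memLp_exponent s).const_mul c)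
  memLp_deriv s := (hw'.memLp_deriv s).add ((hw.memLp_deriv s).const_mul c)
  hasDeriv s := (hw.hasDeriv s).linear_comb (hw'.hasDeriv s) (hw.integrable_deriv hΩb b s)
    (hw'.integrable_deriv hΩb b s) (hw.integrableOn hΩb q') (hw'.integrableOn hΩb q') c

theorem coordPairing_linear_comb (hΩb : Bornology.IsBounded Ω) (hz : IsPairingField Ω q' b Z z d)
    (hw : IsPairable Ω q a w g) (hw' : IsPairable Ω q a w' g') (c : ℝ)
    {φ : EuclideanSpace ℝ (κ ⊕ σ) → ℝ} (hφ : IsTest Ω φ) :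
    coordPairing Ω z d (fun x => w' x + c * w x) (fun s x => g' s x + c * g s x) φ =
      coordPairing Ω z d w' g' φ + c * coordPairing Ω z d w g φ := by
  have key : ∀ {φ h h' k : EuclideanSpace ℝ (κ ⊕ σ) → ℝ}, IsTest Ω φ →
      IntegrableOn (fun x => h x * k x) Ω → IntegrableOn (fun x => h' x * k x) Ω →
      ∫ x in Ω, φ x * ((h' x + c * h x) * k x) =
        (∫ x in Ω, φ x * (h' x * k x)) + c * ∫ x in Ω, φ x * (h x * k x) := by
    intro φ h h' k hφ i i'
    rw [← integral_const_mul, ← integral_add (hφ.integrable_mul i')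
      ((hφ.integrable_mul i).const_mul c)]
    exact integral_congr_ae (ae_of_all _ fun x => by ring)
  simp only [coordPairing]
  rw [key hφ (hw.integrable_mul_div hz) (hw'.integrable_mul_div hz)]
  simp only [fun v => key (hφ.fderiv_apply (EuclideanSpace.single v 1))
    (hw.integrable_mul_field hΩb hz v) (hw'.integrable_mul_field hΩb hz v),
    fun s => key hφ (hw.integrable_deriv_mul hz s) (hw'.integrable_deriv_mul hz s),
    Finset.sum_add_distrib, ← Finset.mul_sum]
  ring

theorem coordPairing_add_test (hΩb : Bornology.IsBounded Ω) (hz : IsPairingField Ω q' b Z z d)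
    (hw : IsPairable Ω q a w g)
    {φ ψ : EuclideanSpace ℝ (κ ⊕ σ) → ℝ} (hφ : IsTest Ω φ) (hψ : IsTest Ω ψ) :
    coordPairing Ω z d w g (fun x => φ x + ψ x) =
      coordPairing Ω z d w g φ + coordPairing Ω z d w g ψ := by
  have key : ∀ {φ ψ h : EuclideanSpace ℝ (κ ⊕ σ) → ℝ}, IsTest Ω φ → IsTest Ω ψ →
      IntegrableOn h Ω → ∫ x in Ω, (φ x + ψ x) * h x =
        (∫ x in Ω, φ x * h x) + ∫ x in Ω, ψ x * h x := by
    intro φ ψ h hφ hψ i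
    rw [← integral_add (hφ.integrable_mul i) (hψ.integrable_mul i)]
    exact integral_congr_ae (ae_of_all _ fun x => by ring)
  have hd : ∀ x v, fderiv ℝ (fun x => φ x + ψ x) x v = fderiv ℝ φ x v + fderiv ℝ ψ x v :=
    fun x v => by
      rw [fderiv_fun_add (hφ.smooth.differentiable (by simp) x)
        (hψ.smooth.differentiable (by simp) x)]
      rfl
  simp only [coordPairing, hd]
  rw [key hφ hψ (hw.integrable_mul_div hz)]
  simp only [fun v => key (hφ.fderiv_apply (EuclideanSpace.single v 1))
    (hψ.fderiv_apply (EuclideanSpace.single v 1)) (hw.integrable_mul_field hΩb hz v),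
    fun s => key hφ hψ (hw.integrable_deriv_mul hz s), Finset.sum_add_distrib]
  ring

theorem coordPairing_const_mul_test {φ : EuclideanSpace ℝ (κ ⊕ σ) → ℝ} (hφ : IsTest Ω φ) (c : ℝ) :
    coordPairing Ω z d w g (fun x => c * φ x) = c * coordPairing Ω z d w g φ := by
  have hd : ∀ x v, fderiv ℝ (fun x => c * φ x) x v = c * fderiv ℝ φ x v := fun x v => by
    rw [fderiv_const_mul (hφ.smooth.differentiable (by simp) x)]
    rfl
  simp only [coordPairing, hd, mul_assoc, integral_const_mul, ← Finset.mul_sum]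
  ring

theorem integral_withDensity_enorm {X G : Type*} [MeasurableSpace X] [NormedAddCommGroup G]
    [MeasurableSpace G] [OpensMeasurableSpace G] {m : Measure X}
    {f : X → G} (hf : Measurable f) (h : X → ℝ) :
    ∫ x, h x ∂(m.withDensity fun x => ‖f x‖ₑ) = ∫ x, h x * ‖f x‖ ∂m := by
  rw [integral_withDensity_eq_integral_toReal_smul hf.enorm (ae_of_all _ fun x => enorm_lt_top)]
  simp [mul_comm]

theorem IsPairable.abs_coordPairing_le (hΩ : IsOpen Ω) (hΩb : Bornology.IsBounded Ω)
    [IsFiniteMeasure m] (hw : IsPairable Ω q a w g) (hz : IsPairingField Ω q' b Z z d)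
    (hgrad : HasGrad volume Ω (coordDir Sum.inl) w m f) (hf : Integrable f m)
    {φ : EuclideanSpace ℝ (κ ⊕ σ) → ℝ} (hφ : IsTest Ω φ) :
    |coordPairing Ω z d w g φ| ≤ Z * ∫ x, |φ x| * ‖f x‖ ∂m :=
  AnisoPairing.abs_coordPairing_le hΩ hΩb a b hw.memLp hz.memLp_div hw.memLp_exponent
    hw.memLp_deriv hz.memLp_inr hz.memLp_inl hgrad hf hw.hasDeriv hz.byParts hz.bound hφ

/-- The factor `α` allows one reference measure `|f| m` to serve functions with different gradients,
so that their densities can be compared pointwise. -/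
theorem IsPairable.exists_density (hΩ : IsOpen Ω) (hΩb : Bornology.IsBounded Ω)
    [IsFiniteMeasure m] (hm : m Ωᶜ = 0) (hw : IsPairable Ω q a w g)
    (hz : IsPairingField Ω q' b Z z d) (hfm : Measurable f) (hf : Integrable f m)
    {α : EuclideanSpace ℝ (κ ⊕ σ) → ℝ} (hα : Measurable α) {A : ℝ} (hαA : ∀ x, |α x| ≤ A)
    (hgrad : HasGrad volume Ω (coordDir Sum.inl) w m fun x => α x • f x) :
    ∃ s : EuclideanSpace ℝ (κ ⊕ σ) → ℝ, Measurable s ∧ (∀ x, |s x| ≤ Z * A) ∧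
      ∀ φ, IsTest Ω φ →
        coordPairing Ω z d w g φ = ∫ x, φ x * s x ∂(m.withDensity fun x => ‖f x‖ₑ) := by
  have : IsFiniteMeasure (m.withDensity fun x => ‖f x‖ₑ) := isFiniteMeasure_withDensity hf.2.ne
  have hA : 0 ≤ A := (abs_nonneg _).trans (hαA 0)
  refine exists_density_of_abs_le hΩ (withDensity_absolutelyContinuous m _ hm) _
    (mul_nonneg hz.bound_nonneg hA)
    (fun φ ψ hφ hψ => coordPairing_add_test hΩb hz hw hφ hψ)
    (fun c φ hφ => coordPairing_const_mul_test hφ c) fun φ hφ => ?_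
  have hαf : Integrable (fun x => α x • f x) m :=
    hf.bdd_smul A hα.aestronglyMeasurable (ae_of_all _ hαA)
  obtain ⟨C, hC⟩ := hφ.exists_bound
  have habs : ∀ h : EuclideanSpace ℝ (κ ⊕ σ) → ℝ, Integrable h m →
      Integrable (fun x => |φ x| * h x) m := fun h hh =>
    hh.bdd_mul hφ.continuous.abs.aestronglyMeasurable (ae_of_all _ fun x => by
      simpa using hC x)
  refine (hw.abs_coordPairing_le hΩ hΩb hz hgrad hαf hφ).trans ?_
  rw [mul_assoc, integral_withDensity_enorm hfm, ← integral_const_mul A]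
  refine mul_le_mul_of_nonneg_left (integral_mono (habs _ hαf.norm)
    ((habs _ hf.norm).const_mul A) fun x => ?_) hz.bound_nonneg
  simp only [norm_smul, Real.norm_eq_abs]
  rw [mul_left_comm]
  exact mul_le_mul_of_nonneg_right (hαA x) (mul_nonneg (abs_nonneg _) (norm_nonneg _))

/-- By density of the rationals the inequality extends to `c = a`, where its right side is zero.
Rational `c` keep the family of exceptional null sets countable. -/
theorem eq_mul_of_forall_rat_abs_sub_le {t s a Z : ℝ}
    (h : ∀ c : ℚ, |t - c * s| ≤ Z * |a - c|) : t = a * s := by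
  have h' : ∀ c : ℝ, |t - c * s| ≤ Z * |a - c| := fun c =>
    DenseRange.induction_on (p := fun c : ℝ => |t - c * s| ≤ Z * |a - c|) Rat.denseRange_cast c
      (isClosed_le (by fun_prop) (by fun_prop)) h
  have := h' a
  simp only [sub_self, abs_zero, mul_zero, abs_nonpos_iff] at this
  linarith

/-- If the gradient of `w'` in the coordinates `κ` is `α` times that of `w`, then so are the
measures obtained by pairing with `z`. -/
theorem IsPairable.eq_integral_mul (hΩ : IsOpen Ω) (hΩb : Bornology.IsBounded Ω)
    [IsFiniteMeasure m] (hm : m Ωᶜ = 0) (hw : IsPairable Ω q a w g) (hw' : IsPairable Ω q a w' g')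
    (hz : IsPairingField Ω q' b Z z d) (hfm : Measurable f) (hf : Integrable f m)
    (hgrad : HasGrad volume Ω (coordDir Sum.inl) w m f)
    {α : EuclideanSpace ℝ (κ ⊕ σ) → ℝ} (hα : Measurable α) {A : ℝ} (hαA : ∀ x, |α x| ≤ A)
    (hgrad' : HasGrad volume Ω (coordDir Sum.inl) w' m fun x => α x • f x)
    {s : EuclideanSpace ℝ (κ ⊕ σ) → ℝ} (hs : Integrable s (m.withDensity fun x => ‖f x‖ₑ))
    (hws : ∀ φ, IsTest Ω φ →
        coordPairing Ω z d w g φ = ∫ x, φ x * s x ∂(m.withDensity fun x => ‖f x‖ₑ))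
    {φ : EuclideanSpace ℝ (κ ⊕ σ) → ℝ} (hφ : IsTest Ω φ) :
    coordPairing Ω z d w' g' φ =
      ∫ x, φ x * (α x * s x) ∂(m.withDensity fun x => ‖f x‖ₑ) := by
  have : IsFiniteMeasure (m.withDensity fun x => ‖f x‖ₑ) := isFiniteMeasure_withDensity hf.2.ne
  have hαf : Integrable (fun x => α x • f x) m :=
    hf.bdd_smul A hα.aestronglyMeasurable (ae_of_all _ hαA)
  obtain ⟨t, htm, htb, ht⟩ := hw'.exists_density hΩ hΩb hm hz hfm hf hα hαA hgrad'
  have hti : Integrable t (m.withDensity fun x => ‖f x‖ₑ) :=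
    Integrable.of_bound htm.aestronglyMeasurable _ (ae_of_all _ htb)
  have hαi : Integrable α (m.withDensity fun x => ‖f x‖ₑ) :=
    Integrable.of_bound hα.aestronglyMeasurable _ (ae_of_all _ hαA)
  -- Apply the pairing bound to `w' - c w`, whose gradient in the coordinates `κ` is `(α - c) f m`.
  have hc : ∀ c : ℚ, ∀ᵐ x ∂(m.withDensity fun x => ‖f x‖ₑ),
      |t x - c * s x| ≤ Z * |α x - c| := fun c => by
    refine ae_abs_le_of_integral_test_le hΩ (withDensity_absolutelyContinuous m _ hm)
      (hti.sub (hs.const_mul (c : ℝ))) ((hαi.sub (integrable_const (c : ℝ))).abs.const_mul Z)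
      fun ψ hψ => ?_
    have e : ∫ x, ψ x * (t x - c * s x) ∂(m.withDensity fun x => ‖f x‖ₑ) =
        coordPairing Ω z d (fun x => w' x + (-c : ℝ) * w x)
          (fun s x => g' s x + (-c : ℝ) * g s x) ψ := by
      rw [coordPairing_linear_comb hΩb hz hw hw' _ hψ, ht ψ hψ, hws ψ hψ, ← integral_const_mul,
        ← integral_add (hψ.integrable_mul hti) ((hψ.integrable_mul hs).const_mul _)]
      exact integral_congr_ae (ae_of_all _ fun x => by ring)
    have hcomb := hgrad.linear_comb hgrad' hf hαf (hw.integrableOn hΩb q')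
      (hw'.integrableOn hΩb q') (-c : ℝ)
    have hb := (hw.linear_comb hΩb q' b hw' (-c : ℝ)).abs_coordPairing_le hΩ hΩb hz hcomb
      (hαf.add (hf.smul (-c : ℝ))) hψ
    refine (le_of_eq (congrArg abs e)).trans (hb.trans (le_of_eq ?_))
    rw [integral_withDensity_enorm hfm, ← integral_const_mul]
    refine integral_congr_ae (ae_of_all _ fun x => ?_)
    simp only
    rw [← add_smul, norm_smul, Real.norm_eq_abs, ← sub_eq_add_neg]
    ring
  rw [ht φ hφ]
  refine integral_congr_ae ?_
  filter_upwards [ae_all_iff.2 hc] with x hx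
  rw [eq_mul_of_forall_rat_abs_sub_le hx]

end PairingDensity

/-! ### The product domain is open and bounded. -/

section ProductDomain

theorem continuous_block {ι κ : Type*} (e : κ → ι) :
    Continuous (block e : EuclideanSpace ℝ ι → EuclideanSpace ℝ κ) := by
  unfold block
  fun_prop

variable {n₁ m : ℕ} {n : Fin m → ℕ} {Ω₁ : Set (EuclideanSpace ℝ (Fin n₁))}
  {Ω₂ : Set (EuclideanSpace ℝ (Σ i : Fin m, Fin (n i)))}

theorem isOpen_prodDomain (hΩ₁ : IsOpen Ω₁) (hΩ₂ : IsOpen Ω₂) :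
    IsOpen (prodDomain (n := n) Ω₁ Ω₂) :=
  (hΩ₁.preimage (continuous_block Sum.inl)).inter (hΩ₂.preimage (continuous_block Sum.inr))

theorem isBounded_prodDomain (hΩ₁ : Bornology.IsBounded Ω₁) (hΩ₂ : Bornology.IsBounded Ω₂) :
    Bornology.IsBounded (prodDomain (n := n) Ω₁ Ω₂) := by
  obtain ⟨R₁, h₁⟩ := hΩ₁.exists_norm_le
  obtain ⟨R₂, h₂⟩ := hΩ₂.exists_norm_le
  refine isBounded_iff_forall_norm_le.2 ⟨R₁ + R₂, fun x hx => ?_⟩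
  have hsq : ‖x‖ ^ 2 = ‖block Sum.inl x‖ ^ 2 + ‖block Sum.inr x‖ ^ 2 := by
    simp only [EuclideanSpace.norm_sq_eq, Fintype.sum_sum_type, block]
  refine le_trans (abs_le_of_sq_le_sq' ?_ (by positivity)).2 (add_le_add (h₁ _ hx.1) (h₂ _ hx.2))
  nlinarith [norm_nonneg (block Sum.inl x), norm_nonneg (block Sum.inr x)]

end ProductDomain

/-! ### Lipschitz composition preserves the function classes. -/

section Composition

theorem memLp_comp_lipschitz {X : Type*} [MeasurableSpace X] {μ : Measure X} [IsFiniteMeasure μ]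
    {r : ℝ≥0∞} {u : X → ℝ} (hu : MemLp u r μ) {T : ℝ → ℝ} {K : ℝ≥0} (hT : LipschitzWith K T) :
    MemLp (T ∘ u) r μ := by
  have h : MemLp ((fun t => T t - T 0) ∘ u) r μ :=
    LipschitzWith.comp_memLp (K := K) (LipschitzWith.of_dist_le_mul fun s t => by
      simpa using hT.dist_le_mul s t) (by simp) hu
  exact (h.add (memLp_const (T 0))).ae_eq (ae_of_all _ fun x => by simp)

theorem _root_.MeasureTheory.MemLp.euclidean_apply {X κ : Type*} [Fintype κ]
    [MeasurableSpace X] {μ : Measure X} {r : ℝ≥0∞}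
    {f : X → EuclideanSpace ℝ κ} (hf : MemLp f r μ) (j : κ) : MemLp (fun x => f x j) r μ :=
  hf.mono ((EuclideanSpace.proj (𝕜 := ℝ) j).continuous.comp_aestronglyMeasurable
    hf.aestronglyMeasurable) (ae_of_all _ fun x => PiLp.norm_apply_le (f x) j)

variable {ι κ : Type*} [Fintype ι] [DecidableEq ι] [Fintype κ] {Ω : Set (EuclideanSpace ℝ ι)}
  {e : κ → ι} {u : EuclideanSpace ℝ ι → ℝ} {T : ℝ → ℝ} {K : ℝ≥0}

theorem IsGradMeasure.exists_comp (hΩ : IsOpen Ω) (hΩb : Bornology.IsBounded Ω)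
    {μ : VectorMeasure (EuclideanSpace ℝ ι) (EuclideanSpace ℝ κ)} (hμ : IsGradMeasure Ω e u μ)
    (hu : IntegrableOn u Ω) (hT : LipschitzWith K T) :
    ∃ μ', IsGradMeasure Ω e (T ∘ u) μ' := by
  have : IsFiniteMeasure (volume.restrict Ω) := ⟨by simpa using hΩb.measure_lt_top⟩
  obtain ⟨m, f, _, hm, -, hf, -, hgrad⟩ := hμ.exists_hasGrad hΩ hu
  obtain ⟨a, ham, haK, ha⟩ := hgrad.exists_comp hΩ hΩb hm hu hf hT
  exact ⟨_, (isGradMeasure_withDensityᵥ_iff hm (hf.bdd_smul K ham.aestronglyMeasurable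
    (ae_of_all _ haK)) (integrableOn_comp_lipschitz hT hu)).2 ha⟩

theorem IsWeakGrad.exists_comp (hΩ : IsOpen Ω) (hΩb : Bornology.IsBounded Ω)
    {g : EuclideanSpace ℝ ι → EuclideanSpace ℝ κ} {r : ℝ≥0∞} (hr : 1 ≤ r)
    (hgr : MemLp g r (volume.restrict Ω)) (hg : IsWeakGrad Ω e u g)
    (hu : IntegrableOn u Ω) (hT : LipschitzWith K T) :
    ∃ g', MemLp g' r (volume.restrict Ω) ∧ IsWeakGrad Ω e (T ∘ u) g' := by
  have : IsFiniteMeasure (volume.restrict Ω) := ⟨by simpa using hΩb.measure_lt_top⟩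
  have hgi : IntegrableOn g Ω := hgr.integrable hr
  obtain ⟨a, ham, haK, ha⟩ := ((isWeakGrad_iff hgi hu).1 hg).exists_comp hΩ hΩb
    (Measure.restrict_apply_eq_zero' hΩ.measurableSet |>.2 (by simp)) hu hgi hT
  have hag : MemLp (fun x => a x • g x) r (volume.restrict Ω) := by
    refine hgr.of_le_mul (c := K) (ham.aestronglyMeasurable.smul hgr.aestronglyMeasurable)
      (ae_of_all _ fun x => ?_)
    rw [norm_smul]
    exact mul_le_mul_of_nonneg_right (haK x) (norm_nonneg _)
  exact ⟨_, hag, (isWeakGrad_iff (hag.integrable hr) (integrableOn_comp_lipschitz hT hu)).2 ha⟩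

end Composition

/-! ### The anisotropic pairing in coordinates and its densities. -/

section AnisotropicPairing

variable {n₁ m : ℕ} {n : Fin m → ℕ} {Ω : Set (Space n₁ n)} {p : Fin m → ℝ≥0∞} {q r : ℝ≥0∞}
  {u : Space n₁ n → ℝ} {z : Space n₁ n → Space n₁ n}

theorem MemAnisoBV.comp (hΩ : IsOpen Ω) (hΩb : Bornology.IsBounded Ω) (hp : ∀ i, 1 ≤ p i)
    (hu : MemAnisoBV Ω p u) {T : ℝ → ℝ} {K : ℝ≥0} (hT : LipschitzWith K T) :
    MemAnisoBV Ω p (T ∘ u) := by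
  have : IsFiniteMeasure (volume.restrict Ω) := ⟨by simpa using hΩb.measure_lt_top⟩
  have hui : IntegrableOn u Ω := memLp_one_iff_integrable.1 hu.memBV.memLp
  obtain ⟨μ, hμ⟩ := hu.memBV.exists_grad
  obtain ⟨μ₁, hμ₁⟩ := hu.exists_grad₁
  refine ⟨⟨memLp_comp_lipschitz hu.memBV.memLp hT, hμ.exists_comp hΩ hΩb hui hT⟩,
    hμ₁.exists_comp hΩ hΩb hui hT, fun i => ?_⟩
  obtain ⟨g, hgr, hg⟩ := hu.exists_grad i
  exact hg.exists_comp hΩ hΩb (hp i) hgr hui hT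

theorem MemAnisoBV.isPairable (hΩ : IsOpen Ω) (hΩb : Bornology.IsBounded Ω) (hp : ∀ i, 1 ≤ p i)
    (hu : MemAnisoBV Ω p u) (huq : MemLp u q (volume.restrict Ω))
    (hup : ∀ i, MemLp u (p i) (volume.restrict Ω)) :
    IsPairable Ω q (fun s : Σ i : Fin m, Fin (n i) => p s.1) u
      (fun s x => weakGrad Ω (dir n₁ n s.1) u x s.2) := by
  have : IsFiniteMeasure (volume.restrict Ω) := ⟨by simpa using hΩb.measure_lt_top⟩
  have hui : IntegrableOn u Ω := memLp_one_iff_integrable.1 hu.memBV.memLp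
  refine ⟨huq, fun s => hup s.1, fun s => ?_, fun s => ?_⟩
  · obtain ⟨g, hgr, hg⟩ := hu.exists_grad s.1
    exact (hgr.ae_eq (weakGrad_ae_eq hΩ hg).symm).euclidean_apply s.2
  · obtain ⟨g, hgr, hg⟩ := hu.exists_grad s.1
    exact ((isWeakGrad_iff (hgr.integrable (hp s.1)) hui).1 hg).congr
      (weakGrad_ae_eq hΩ hg).symm s.2

/-- The bound `Z` is the essential supremum of `|z₁|`, and `weakDiv` inherits its integrability from
any other representative. -/
theorem MemX.exists_isPairingField (hΩ : IsOpen Ω) (hz : MemX Ω p r z) :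
    ∃ Z, IsPairingField Ω r (fun s : Σ i : Fin m, Fin (n i) => (p s.1).conjExponent) Z z
      (weakDiv Ω z) := by
  obtain ⟨d, hdr, hd⟩ := hz.exists_div
  have hae := weakDiv_ae_eq hΩ hd
  have hZ : ∀ᵐ x ∂volume.restrict Ω, ‖block (dir₁ n₁ n) (z x)‖ ≤
      (eLpNorm (fun x => block (dir₁ n₁ n) (z x)) ⊤ (volume.restrict Ω)).toReal := by
    filter_upwards [enorm_ae_le_eLpNormEssSup (fun x => block (dir₁ n₁ n) (z x))
      (volume.restrict Ω)] with x hx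
    rw [← toReal_enorm]
    exact ENNReal.toReal_mono hz.memLp₁.eLpNorm_ne_top (by rwa [eLpNorm_exponent_top])
  refine ⟨_, hdr.ae_eq hae.symm, fun k => hz.memLp₁.euclidean_apply k,
    fun s => (hz.memLp s.1).euclidean_apply s.2, fun φ hφ => ?_, ENNReal.toReal_nonneg, hZ⟩
  rw [← hd.byParts φ hφ]
  refine integral_congr_ae ?_
  filter_upwards [hae] with x hx
  rw [hx]

theorem pairing₁_eq_coordPairing [∀ i, ENNReal.HolderConjugate (p i) (p i).conjExponent]
    [ENNReal.HolderConjugate q r] (hΩb : Bornology.IsBounded Ω) {Z : ℝ}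
    (hz : IsPairingField Ω r (fun s : Σ i : Fin m, Fin (n i) => (p s.1).conjExponent) Z z
      (weakDiv Ω z))
    (hu : IsPairable Ω q (fun s : Σ i : Fin m, Fin (n i) => p s.1) u
      (fun s x => weakGrad Ω (dir n₁ n s.1) u x s.2))
    {φ : Space n₁ n → ℝ} (hφ : IsTest Ω φ) :
    pairing₁ Ω z u φ = coordPairing Ω z (weakDiv Ω z) u
      (fun s x => weakGrad Ω (dir n₁ n s.1) u x s.2) φ := by
  have e1 : ∫ x in Ω, u x * φ x * weakDiv Ω z x = ∫ x in Ω, φ x * (u x * weakDiv Ω z x) :=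
    integral_congr_ae (ae_of_all _ fun x => by ring)
  have e2 : ∫ x in Ω, u x * fderiv ℝ φ x (z x) =
      ∑ c, ∫ x in Ω, fderiv ℝ φ x (EuclideanSpace.single c 1) * (u x * z x c) := by
    rw [← integral_finsetSum _ fun c _ => (hφ.fderiv_apply (EuclideanSpace.single c 1)).integrable_mul
      (hu.integrable_mul_field hΩb hz c)]
    refine integral_congr_ae (ae_of_all _ fun x => ?_)
    simp only
    rw [clm_apply_eq_sum, Finset.mul_sum]
    exact Finset.sum_congr rfl fun c _ => by ring
  have e3 : ∑ i, ∫ x in Ω, φ x * ⟪block (dir n₁ n i) (z x), weakGrad Ω (dir n₁ n i) u x⟫ =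
      ∑ s : Σ i : Fin m, Fin (n i), ∫ x in Ω,
        φ x * (weakGrad Ω (dir n₁ n s.1) u x s.2 * z x (Sum.inr s)) := by
    rw [Fintype.sum_sigma]
    refine Finset.sum_congr rfl fun i _ => ?_
    rw [← integral_finsetSum _ fun j _ => hφ.integrable_mul (hu.integrable_deriv_mul hz ⟨i, j⟩)]
    refine integral_congr_ae (ae_of_all _ fun x => ?_)
    simp [PiLp.inner_apply, block, Finset.mul_sum]
  rw [pairing₁, pairing, coordPairing, e1, e2, e3]

theorem absGrad₁_eq (hΩ : IsOpen Ω) {μ : Measure (Space n₁ n)} (hμ : μ Ωᶜ = 0)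
    {f : Space n₁ n → EuclideanSpace ℝ (Fin n₁)} (hf : Integrable f μ) (hu : IntegrableOn u Ω)
    (h : HasGrad volume Ω (coordDir (dir₁ n₁ n)) u μ f) :
    absGrad₁ Ω u = μ.withDensity fun x => ‖f x‖ₑ := by
  rw [absGrad₁, gradMeasure_eq hΩ ((isGradMeasure_withDensityᵥ_iff hμ hf hu).2 h),
    Measure.variation_withDensityᵥ hf]

/-- This replaces the signed measure by integrals against test functions; conversely, the measure
with density `θ` is the required one. -/
theorem isPairingDensity_iff (h0 : absGrad₁ Ω u Ωᶜ = 0) {θ : Space n₁ n → ℝ} :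
    IsPairingDensity Ω z u θ ↔ Measurable θ ∧ Integrable θ (absGrad₁ Ω u) ∧
      ∀ φ, IsTest Ω φ → ∫ x, φ x * θ x ∂(absGrad₁ Ω u) = pairing₁ Ω z u φ := by
  constructor
  · rintro ⟨hm, hi, σ, hσ, h⟩
    refine ⟨hm, hi, fun φ hφ => ?_⟩
    have e : σ = (absGrad₁ Ω u).withDensityᵥ θ := by
      ext1 B hB
      rw [h B hB, withDensityᵥ_apply hi hB]
    rw [← hσ.eq_pairing φ hφ, e, hφ.integral_withDensityᵥ hi]
    rfl
  · rintro ⟨hm, hi, h⟩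
    refine ⟨hm, hi, (absGrad₁ Ω u).withDensityᵥ θ, ⟨fun B hB hd =>
      withDensityᵥ_apply_eq_zero hi h0 hB hd, fun φ hφ => ?_⟩,
      fun B hB => withDensityᵥ_apply hi hB⟩
    rw [← h φ hφ, hφ.integral_withDensityᵥ hi]
    rfl

end AnisotropicPairing

/-! ### A common density for `u` and `T ∘ u`. -/

section DensityOfComposition

/-- In the application this is `|D_{x₁}(T ∘ u)| ≤ K |D_{x₁}u|`, which transfers integrability of a
density. -/
theorem withDensity_enorm_smul_le {X G : Type*} [MeasurableSpace X] [NormedAddCommGroup G]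
    [NormedSpace ℝ G] {μ : Measure X} (f : X → G) {a : X → ℝ}
    {K : ℝ≥0} (ha : ∀ x, |a x| ≤ K) :
    (μ.withDensity fun x => ‖a x • f x‖ₑ) ≤ (K : ℝ≥0∞) • μ.withDensity fun x => ‖f x‖ₑ := by
  rw [← withDensity_smul' _ _ ENNReal.coe_ne_top]
  refine withDensity_mono (ae_of_all _ fun x => ?_)
  simp only [Pi.smul_apply, smul_eq_mul, enorm_smul]
  gcongr
  exact enorm_le_coe.2 (by exact_mod_cast ha x)

theorem ae_withDensity_enorm_iff {X G : Type*} [MeasurableSpace X] [NormedAddCommGroup G]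
    [MeasurableSpace G] [OpensMeasurableSpace G] {μ : Measure X} {f : X → G} (hf : Measurable f)
    {P : X → Prop} :
    (∀ᵐ x ∂(μ.withDensity fun x => ‖f x‖ₑ), P x) ↔ ∀ᵐ x ∂μ, f x ≠ 0 → P x := by
  rw [ae_withDensity_iff hf.enorm]
  simp only [ne_eq, enorm_eq_zero]

variable {n₁ m : ℕ} {n : Fin (m + 1) → ℕ} {Ω : Set (Space n₁ n)} {p : Fin (m + 1) → ℝ≥0∞}
  {q : ℝ≥0∞} {u : Space n₁ n → ℝ} {z : Space n₁ n → Space n₁ n}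

theorem Admissible.comp (hΩ : IsOpen Ω) (hΩb : Bornology.IsBounded Ω) (hp : ∀ i, 1 ≤ p i)
    (h : Admissible Ω p q u z) {T : ℝ → ℝ} {K : ℝ≥0} (hT : LipschitzWith K T) :
    Admissible Ω p q (T ∘ u) z := by
  have : IsFiniteMeasure (volume.restrict Ω) := ⟨by simpa using hΩb.measure_lt_top⟩
  exact ⟨h.memBV.comp hΩ hΩb hp hT, memLp_comp_lipschitz h.memLp hT, h.memX⟩

theorem Admissible.isPairable (hΩ : IsOpen Ω) (hΩb : Bornology.IsBounded Ω) (hp : ∀ i, 1 ≤ p i)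
    (hpm : Monotone p) (h : Admissible Ω p q u z) :
    IsPairable Ω q (fun s : Σ i : Fin (m + 1), Fin (n i) => p s.1) u
      (fun s x => weakGrad Ω (dir n₁ n s.1) u x s.2) := by
  have : IsFiniteMeasure (volume.restrict Ω) := ⟨by simpa using hΩb.measure_lt_top⟩
  exact h.memBV.isPairable hΩ hΩb hp (h.memLp.mono_exponent (le_max_right _ _))
    fun i => h.memLp.mono_exponent ((hpm (Fin.le_last i)).trans (le_max_left _ _))

/-- The measures `(z₁, D_{x₁}u)` and `(z₁, D_{x₁}(T ∘ u))` have the common density `s` with respect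
to `|D_{x₁}u| = |f| μ` and `|D_{x₁}(T ∘ u)| = a |f| μ`. -/
theorem Admissible.exists_common_density (hΩ : IsOpen Ω) (hΩb : Bornology.IsBounded Ω)
    (hp : ∀ i, 1 ≤ p i) (hpm : Monotone p) (hq : 1 ≤ q) (h : Admissible Ω p q u z)
    {T : ℝ → ℝ} {K : ℝ≥0} (hT : LipschitzWith K T) (hTm : Monotone T) :
    ∃ (μ : Measure (Space n₁ n)) (f : Space n₁ n → EuclideanSpace ℝ (Fin n₁))
      (a s : Space n₁ n → ℝ), IsFiniteMeasure μ ∧ μ Ωᶜ = 0 ∧ Measurable f ∧ Integrable f μ ∧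
      Measurable a ∧ (∀ x, 0 ≤ a x) ∧ (∀ x, a x ≤ K) ∧
      HasGrad volume Ω (coordDir (dir₁ n₁ n)) u μ f ∧
      HasGrad volume Ω (coordDir (dir₁ n₁ n)) (T ∘ u) μ (fun x => a x • f x) ∧
      absGrad₁ Ω u = (μ.withDensity fun x => ‖f x‖ₑ) ∧
      absGrad₁ Ω (T ∘ u) = (μ.withDensity fun x => ‖a x • f x‖ₑ) ∧
      Measurable s ∧ Integrable s (μ.withDensity fun x => ‖f x‖ₑ) ∧
      (∀ φ, IsTest Ω φ →
        pairing₁ Ω z u φ = ∫ x, φ x * s x ∂(μ.withDensity fun x => ‖f x‖ₑ)) ∧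
      ∀ φ, IsTest Ω φ →
        pairing₁ Ω z (T ∘ u) φ = ∫ x, φ x * (a x * s x) ∂(μ.withDensity fun x => ‖f x‖ₑ) := by
  have hfin : IsFiniteMeasure (volume.restrict Ω) := ⟨by simpa using hΩb.measure_lt_top⟩
  have hqc : ENNReal.HolderConjugate q q.conjExponent := .conjExponent hq
  have hpc : ∀ i, ENNReal.HolderConjugate (p i) (p i).conjExponent := fun i => .conjExponent (hp i)
  have hpc' : ∀ s : Σ i : Fin (m + 1), Fin (n i),
      ENNReal.HolderConjugate (p s.1) (p s.1).conjExponent := fun s => hpc s.1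
  have hui : IntegrableOn u Ω := memLp_one_iff_integrable.1 h.memBV.memBV.memLp
  have hw := h.isPairable hΩ hΩb hp hpm
  have hwT := (h.comp hΩ hΩb hp hT).isPairable hΩ hΩb hp hpm
  obtain ⟨Z, hz⟩ := h.memX.exists_isPairingField hΩ
  obtain ⟨_, hμ₁⟩ := h.memBV.exists_grad₁
  obtain ⟨μ, f, hμ, hμ0, hfm, hf, -, hgrad⟩ := hμ₁.exists_hasGrad hΩ hui
  obtain ⟨a, ham, ha0, haK, ha⟩ := hgrad.exists_comp_monotone hΩ hΩb hμ0 hui hf hT hTm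
  have haK' : ∀ x, |a x| ≤ K := fun x => (abs_of_nonneg (ha0 x)).trans_le (haK x)
  have : IsFiniteMeasure (μ.withDensity fun x => ‖f x‖ₑ) := isFiniteMeasure_withDensity hf.2.ne
  -- For `u` itself the factor `α` is the constant `1`.
  obtain ⟨s, hsm, hsb, hs⟩ := hw.exists_density hΩ hΩb hμ0 hz hfm hf
    (measurable_const (a := (1 : ℝ))) (A := 1) (by simp) (by simpa using hgrad)
  have hsi : Integrable s (μ.withDensity fun x => ‖f x‖ₑ) :=
    Integrable.of_bound hsm.aestronglyMeasurable _ (ae_of_all _ hsb)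
  refine ⟨μ, f, a, s, hμ, hμ0, hfm, hf, ham, ha0, haK, hgrad, ha,
    absGrad₁_eq hΩ hμ0 hf hui hgrad,
    absGrad₁_eq hΩ hμ0 (hf.bdd_smul K ham.aestronglyMeasurable (ae_of_all _ haK'))
      (integrableOn_comp_lipschitz hT hui) ha, hsm, hsi,
    fun φ hφ => ?_, fun φ hφ => ?_⟩
  · rw [pairing₁_eq_coordPairing hΩb hz hw hφ, hs φ hφ]
  · rw [pairing₁_eq_coordPairing hΩb hz hwT hφ]
    exact hw.eq_integral_mul hΩ hΩb hμ0 hwT hz hfm hf hgrad ham haK' ha hsi hs hφ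

theorem IsPairingDensity.ae_eq (hΩ : IsOpen Ω) [IsFiniteMeasure (absGrad₁ Ω u)]
    (h0 : absGrad₁ Ω u Ωᶜ = 0) {θ θ' : Space n₁ n → ℝ} (hθ : IsPairingDensity Ω z u θ)
    (hθ' : IsPairingDensity Ω z u θ') : θ =ᵐ[absGrad₁ Ω u] θ' := by
  rw [isPairingDensity_iff h0] at hθ hθ'
  exact ae_eq_of_integral_test_eq hΩ h0 hθ.2.1 hθ'.2.1
    fun φ hφ => (hθ.2.2 φ hφ).trans (hθ'.2.2 φ hφ).symm

end DensityOfComposition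

end AnisoPairing

end

/-! ### The invariance theorem. -/

theorem mainTheorem7 {n₁ m : ℕ} (hn₁ : 0 < n₁) {n : Fin (m + 1) → ℕ} (hn : ∀ i, 0 < n i)
    (Ω₁ : Set (EuclideanSpace ℝ (Fin n₁)))
    (Ω₂ : Set (EuclideanSpace ℝ (Σ i : Fin (m + 1), Fin (n i))))
    (hΩ₁ : IsOpen Ω₁) (hΩ₂ : IsOpen Ω₂)
    (hΩ₁b : Bornology.IsBounded Ω₁) (hΩ₂b : Bornology.IsBounded Ω₂)
    (p : Fin (m + 1) → ℝ≥0∞) (hp : ∀ i, 1 < p i) (hp_top : ∀ i, p i ≠ ⊤) (hp_mono : Monotone p)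
    (q : ℝ≥0∞) (hq : 1 ≤ q)
    (u : AnisoPairing.Space n₁ n → ℝ) (z : AnisoPairing.Space n₁ n → AnisoPairing.Space n₁ n)
    (h : AnisoPairing.Admissible (AnisoPairing.prodDomain Ω₁ Ω₂) p q u z)
    (T : ℝ → ℝ) (K : ℝ≥0) (hT : LipschitzWith K T) (hT_mono : Monotone T) :
    AnisoPairing.Admissible (AnisoPairing.prodDomain Ω₁ Ω₂) p q (T ∘ u) z ∧
    (∃ θ, AnisoPairing.IsPairingDensity (AnisoPairing.prodDomain Ω₁ Ω₂) z u θ) ∧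
    (∀ θ, AnisoPairing.IsPairingDensity (AnisoPairing.prodDomain Ω₁ Ω₂) z u θ →
      AnisoPairing.IsPairingDensity (AnisoPairing.prodDomain Ω₁ Ω₂) z (T ∘ u) θ) ∧
    (∀ θ θT, AnisoPairing.IsPairingDensity (AnisoPairing.prodDomain Ω₁ Ω₂) z u θ →
      AnisoPairing.IsPairingDensity (AnisoPairing.prodDomain Ω₁ Ω₂) z (T ∘ u) θT →
      (∀ᵐ x ∂(AnisoPairing.absGrad₁ (AnisoPairing.prodDomain Ω₁ Ω₂) (T ∘ u)), θT x = θ x) ∧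
      ((∀ᵐ t : ℝ, 0 < deriv T t) →
        ∀ᵐ x ∂(AnisoPairing.absGrad₁ (AnisoPairing.prodDomain Ω₁ Ω₂) u), θT x = θ x)) := by
  have hΩ := AnisoPairing.isOpen_prodDomain (n := n) hΩ₁ hΩ₂
  have hΩb := AnisoPairing.isBounded_prodDomain (n := n) hΩ₁b hΩ₂b
  have hp1 : ∀ i, 1 ≤ p i := fun i => (hp i).le
  set Ω := AnisoPairing.prodDomain (n := n) Ω₁ Ω₂
  have hui : IntegrableOn u Ω := memLp_one_iff_integrable.1 h.memBV.memBV.memLp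
  obtain ⟨μ, f, a, s, hμ, hμ0, hfm, hf, ham, ha0, haK, hgrad, hgradT, hu, hTu, hsm, hsi, hs, hsT⟩ :=
    h.exists_common_density hΩ hΩb hp1 hp_mono hq hT hT_mono
  have haK' : ∀ x, |a x| ≤ K := fun x => (abs_of_nonneg (ha0 x)).trans_le (haK x)
  have haf : Integrable (fun x => a x • f x) μ :=
    hf.bdd_smul K ham.aestronglyMeasurable (ae_of_all _ haK')
  have hafm : Measurable fun x => a x • f x := ham.smul hfm
  have hfin : IsFiniteMeasure (AnisoPairing.absGrad₁ Ω u) := by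
    rw [hu]; exact isFiniteMeasure_withDensity hf.2.ne
  have hfinT : IsFiniteMeasure (AnisoPairing.absGrad₁ Ω (T ∘ u)) := by
    rw [hTu]; exact isFiniteMeasure_withDensity haf.2.ne
  have h0 : AnisoPairing.absGrad₁ Ω u Ωᶜ = 0 := by
    rw [hu]; exact withDensity_absolutelyContinuous μ _ hμ0
  have h0T : AnisoPairing.absGrad₁ Ω (T ∘ u) Ωᶜ = 0 := by
    rw [hTu]; exact withDensity_absolutelyContinuous μ _ hμ0
  have hsd : AnisoPairing.IsPairingDensity Ω z u s := by
    rw [AnisoPairing.isPairingDensity_iff h0, hu]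
    exact ⟨hsm, hsi, fun φ hφ => (hs φ hφ).symm⟩
  have htransfer : ∀ θ, AnisoPairing.IsPairingDensity Ω z u θ →
      AnisoPairing.IsPairingDensity Ω z (T ∘ u) θ := fun θ hθ => by
    have hae := hθ.ae_eq hΩ h0 hsd
    rw [AnisoPairing.isPairingDensity_iff h0T, hTu]
    refine ⟨hθ.measurable, ?_, fun φ hφ => ?_⟩
    · have := hθ.integrable
      rw [hu] at this
      exact (this.smul_measure ENNReal.coe_ne_top).mono_measure
        (AnisoPairing.withDensity_enorm_smul_le f haK')
    -- Both sides become integrals against `μ`. The factor `a` moves from the measure to the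
    -- integrand because `‖a f‖ = a ‖f‖`, which is where `a ≥ 0` enters, and `θ = s` is needed only
    -- where `f ≠ 0`.
    · rw [hsT φ hφ, AnisoPairing.integral_withDensity_enorm hafm,
        AnisoPairing.integral_withDensity_enorm hfm]
      rw [hu] at hae
      refine integral_congr_ae ?_
      filter_upwards [(AnisoPairing.ae_withDensity_enorm_iff hfm).1 hae] with x hx
      by_cases hfx : f x = 0
      · simp [hfx]
      · rw [hx hfx, norm_smul, Real.norm_of_nonneg (ha0 x)]
        ring
  refine ⟨h.comp hΩ hΩb hp1 hT, ⟨s, hsd⟩, htransfer, fun θ θT hθ hθT => ?_⟩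
  have hae := hθT.ae_eq hΩ h0T (htransfer θ hθ)
  refine ⟨hae, fun hTpos => ?_⟩
  -- Since `a ≠ 0` where `f ≠ 0`, null sets of `|a f| μ` are null for `|f| μ`, so the equality
  -- already proved carries over to `|D_{x₁}u|`.
  have hne := hgrad.ae_ne_zero_of_deriv_pos hΩ hΩb hμ0 hui hf hT hT_mono hTpos ham haK' hgradT
  rw [hTu] at hae
  rw [hu, AnisoPairing.ae_withDensity_enorm_iff hfm]
  filter_upwards [hne, (AnisoPairing.ae_withDensity_enorm_iff hafm).1 hae] with x hx hx' hfx
  exact hx' (smul_ne_zero (fun h => hfx (hx h)) hfx)
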